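/- Let $\mathfrak n$ be a Lie algebra of nilpotent real $m\times m$ matrices, let $N=\exp\mathfrak n\subset GL(m,\mathbb R)$, and let $\{X_1,\dots,X_n\}$ be a strong Malcev basis of $\mathfrak n$, i.e. a basis such that each $\mathfrak n_i=\operatorname{span}_{\mathbb R}\{X_1,\dots,X_i\}$ is an ideal of $\mathfrak n$. Assume that $\Gamma=\exp\mathbb ZX_1\exp\mathbb ZX_2\cdots\exp\mathbb ZX_n$ is a subgroup of $N$. Let $A$ be an automorphism of the Lie algebra $\mathfrak n$ that is diagonal in this basis, $AX_k=a_kX_k$ with $a_k\in\mathbb R$, let $\alpha$ be the automorphism of $N$ with $\alpha(\exp X)=\exp AX$ for all $X\in\mathfrak n$, and let $\Gamma_\alpha$ be the subgroup of $N$ generated by $\bigcup_{k\in\mathbb Z}\alpha^k(\Gamma)$. For $\lambda\in\mathfrak n^*$ put $\mathfrak n_i(\lambda)=\{Y\in\mathfrak n_i:\lambda[X,Y]=0\text{ for all }X\in\mathfrak n_i\}$, $\mathfrak p(\lambda)=\sum_{i=1}^n\mathfrak n_i(\lambda)$, $P(\lambda)=\exp\mathfrak p(\lambda)$ and $\chi_\lambda(\exp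 Y)=e^{2\pi i\lambda(Y)}$ for $Y\in\mathfrak p(\lambda)$. Let $\{j_1<\dots<j_d\}$ be the set of indices $k$ with $X_k\notin\mathfrak n_{k-1}+\mathfrak p(\lambda)$, and put $c(t)=\exp t_1X_{j_1}\cdots\exp t_dX_{j_d}$ for $t\in\mathbb R^d$. Let $\pi_\lambda$ be the representation of $N$ induced from $P(\lambda)$ by $\chi_\lambda$, realized on $L^2(\mathbb R^d)$: a function $g:N\to\mathbb C$ with $g(xp)=\chi_\lambda(p)^{-1}g(x)$ for $x\in N$, $p\in P(\lambda)$ and $g\circ c\in L^2(\mathbb R^d)$ is identified with $g\circ c$, and $\pi_\lambda(y)g(x)=g(y^{-1}x)$. Suppose that $A$ is expansive, i.e. all its eigenvalues have absolute value strictly greater than one. Then for every $\lambda\in\mathfrak n^*$ (in particular for every $\lambda$ in any cross-section $\Lambda\subset\mathfrak n^*$ of the generic coadjoint orbits) these formulas determine exactly one unitary representation $\pi_\lambda$ of $N$ on $L^2(\mathbb R^d)$; it is strongly continuous and irreducible, and its restriction $\pi_\lambda|_{\Gamma_\alpha}$ to $\Gamma_\alpha$ is irreducible. -/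

import Mathlib

open MeasureTheory

-- matrices with the commutator bracket
attribute [local instance] LieRing.ofAssociativeRing

noncomputable section

namespace WaveletRep

/-- The matrix exponential, as an element of `GL(m, ℝ)`. -/
def expGL {m : ℕ} (X : Matrix (Fin m) (Fin m) ℝ) : GL (Fin m) ℝ where
  val := NormedSpace.exp X
  inv := NormedSpace.exp (-X)
  val_inv := by
    rw [← Matrix.exp_add_of_commute X (-X) (Commute.neg_right (Commute.refl X)), add_neg_cancel,
      NormedSpace.exp_zero]
  inv_val := by
    rw [← Matrix.exp_add_of_commute (-X) X (Commute.neg_left (Commute.refl X)), neg_add_cancel,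
      NormedSpace.exp_zero]

variable {m n : ℕ} {𝔫 : LieSubalgebra ℝ (Matrix (Fin m) (Fin m) ℝ)}

/-- The analytic subgroup `N` of `GL(m, ℝ)` with Lie algebra `𝔫`: the subgroup generated by
`exp 𝔫`.  (When `𝔫` consists of nilpotent matrices it is equal to the set `exp 𝔫`.) -/
def lieGroup (𝔫 : LieSubalgebra ℝ (Matrix (Fin m) (Fin m) ℝ)) : Subgroup (GL (Fin m) ℝ) :=
  Subgroup.closure (Set.range fun X : 𝔫 => expGL (X : Matrix (Fin m) (Fin m) ℝ))

/-- The exponential map `exp : 𝔫 → N`. -/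
def expN (X : 𝔫) : lieGroup 𝔫 :=
  ⟨expGL (X : Matrix (Fin m) (Fin m) ℝ), Subgroup.subset_closure ⟨X, rfl⟩⟩

/-- `flag X i` is the span of the first `i` vectors of the basis `X`. -/
def flag (X : Module.Basis (Fin n) ℝ 𝔫) (i : ℕ) : Submodule ℝ 𝔫 :=
  Submodule.span ℝ (X '' {k | (k : ℕ) < i})

/-- A basis is a strong Malcev basis if each `flag X i` is an ideal. -/
def IsStrongMalcev (X : Module.Basis (Fin n) ℝ 𝔫) : Prop :=
  ∀ i : ℕ, ∀ Z : 𝔫, ∀ Y ∈ flag X i, ⁅Z, Y⁆ ∈ flag X i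

/-- `exp (t₁ X₁) exp (t₂ X₂) ⋯ exp (tₙ Xₙ)`, the factors in increasing order of the index. -/
def malcevCoord (X : Module.Basis (Fin n) ℝ 𝔫) (t : Fin n → ℝ) : lieGroup 𝔫 :=
  ((List.finRange n).map fun k => expN (t k • X k)).prod

/-- `𝔫ᵢ(λ)`: the radical of the form `(X, Y) ↦ λ[X, Y]` restricted to `𝔫ᵢ = flag X i`. -/
def radical (X : Module.Basis (Fin n) ℝ 𝔫) (l : Module.Dual ℝ 𝔫) (i : ℕ) : Submodule ℝ 𝔫 where
  carrier := {Y | Y ∈ flag X i ∧ ∀ Z ∈ flag X i, l ⁅Z, Y⁆ = 0}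
  zero_mem' := ⟨Submodule.zero_mem _, fun Z _ => by simp⟩
  add_mem' := fun {a b} ha hb => ⟨Submodule.add_mem _ ha.1 hb.1, fun Z hZ => by
    rw [lie_add, map_add, ha.2 Z hZ, hb.2 Z hZ, add_zero]⟩
  smul_mem' := fun c a ha => ⟨Submodule.smul_mem _ c ha.1, fun Z hZ => by
    rw [lie_smul, map_smul, ha.2 Z hZ, smul_zero]⟩

/-- The polarizing subalgebra `𝔭(λ) = 𝔫₁(λ) + ⋯ + 𝔫ₙ(λ)`; `P(λ) = exp 𝔭(λ)`. -/
def polarization (X : Module.Basis (Fin n) ℝ 𝔫) (l : Module.Dual ℝ 𝔫) : Submodule ℝ 𝔫 :=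
  ⨆ k : Fin n, radical X l ((k : ℕ) + 1)

open Classical in
/-- The index set `𝐣 = {j₁ < ⋯ < j_d}`: the indices at which the flag jumps modulo `𝔭(λ)`, so
that the `X_j`, `j ∈ 𝐣`, span a complement of `𝔭(λ)`. -/
def jumpSet (X : Module.Basis (Fin n) ℝ 𝔫) (l : Module.Dual ℝ 𝔫) : Finset (Fin n) :=
  Finset.univ.filter fun k => X k ∉ flag X k ⊔ polarization X l

open Classical in
/-- The section `(t₁, …, t_d) ↦ exp (t₁ X_{j₁}) ⋯ exp (t_d X_{j_d})` of `N → N / P(λ)`. -/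
def crossSection (X : Module.Basis (Fin n) ℝ 𝔫) (l : Module.Dual ℝ 𝔫) (t : jumpSet X l → ℝ) :
    lieGroup 𝔫 :=
  malcevCoord X fun k => if h : k ∈ jumpSet X l then t ⟨k, h⟩ else 0

/-- The Hilbert space `L²(ℝᵈ)` with Lebesgue measure, the coordinates of `ℝᵈ` being indexed by
the `d`-element set `𝐣`. -/
abbrev L2 (X : Module.Basis (Fin n) ℝ 𝔫) (l : Module.Dual ℝ 𝔫) : Type :=
  Lp ℂ 2 (volume : Measure (jumpSet X l → ℝ))

/-- `g(xp) = χ_λ(p)⁻¹ g(x)` for `x ∈ N` and `p ∈ P(λ)`, with `χ_λ(exp Y) = e^{2πi λ(Y)}` for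
`Y ∈ 𝔭(λ)`. -/
def IsEquivariant (X : Module.Basis (Fin n) ℝ 𝔫) (l : Module.Dual ℝ 𝔫) (g : lieGroup 𝔫 → ℂ) :
    Prop :=
  ∀ x : lieGroup 𝔫, ∀ Y ∈ polarization X l,
    g (x * expN Y) = Complex.exp (-(2 * Real.pi * Complex.I * (l Y : ℂ))) * g x

/-- `π` is the representation of `N` induced from `P(λ)` by `χ_λ`, realized on `L²(ℝᵈ)`: an
equivariant function `g` on `N` that is square integrable along the cross-section is identified
with its restriction to the cross-section, and `π(y)` is the left translation
`g ↦ g(y⁻¹ ·)`. -/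
def IsInducedRep (X : Module.Basis (Fin n) ℝ 𝔫) (l : Module.Dual ℝ 𝔫)
    (π : lieGroup 𝔫 →* (L2 X l ≃ₗᵢ[ℂ] L2 X l)) : Prop :=
  ∀ (y : lieGroup 𝔫) (g : lieGroup 𝔫 → ℂ), IsEquivariant X l g →
    ∀ hg : MemLp (fun t => g (crossSection X l t)) 2 (volume : Measure (jumpSet X l → ℝ)),
      (π y (hg.toLp _) : (jumpSet X l → ℝ) → ℂ) =ᵐ[volume]
        fun t => g (y⁻¹ * crossSection X l t)

/-- Strong continuity of a unitary representation. -/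
def IsStronglyContinuous {G H : Type*} [Group G] [TopologicalSpace G] [NormedAddCommGroup H]
    [InnerProductSpace ℂ H] (π : G →* (H ≃ₗᵢ[ℂ] H)) : Prop :=
  ∀ f : H, Continuous fun x => π x f

/-- Irreducibility of a unitary representation: the space is nonzero and there is no closed
invariant subspace besides `0` and the whole space. -/
def IsIrreducibleRep {G H : Type*} [Group G] [NormedAddCommGroup H] [InnerProductSpace ℂ H]
    (π : G →* (H ≃ₗᵢ[ℂ] H)) : Prop :=
  Nontrivial H ∧ ∀ V : Submodule ℂ H, IsClosed (V : Set H) →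
    (∀ x : G, ∀ f ∈ V, π x f ∈ V) → V = ⊥ ∨ V = ⊤

/-- A real square matrix is expansive if all its (complex) eigenvalues have absolute value
greater than one. -/
def IsExpansive (M : Matrix (Fin n) (Fin n) ℝ) : Prop :=
  ∀ z ∈ spectrum ℂ (M.map (algebraMap ℝ ℂ)), 1 < ‖z‖

/-- `Γ_α`: the subgroup generated by the sets `α^k(Γ)`, `k ∈ ℤ`. -/
def dilationClosure {G : Type*} [Group G] (α : MulAut G) (Γ : Subgroup G) : Subgroup G :=
  Subgroup.closure (⋃ k : ℤ, (fun x => (α ^ k) x) '' (Γ : Set G))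

end WaveletRep

end

/-!
Since `𝔫` consists of nilpotent matrices, `exp : 𝔫 → N` is a homeomorphism with inverse `log`, and
by Baker–Campbell–Hausdorff `exp` carries subalgebras to subgroups. Every `x ∈ N` factors uniquely
and continuously as `x = c(t) p` with `p ∈ P(λ)`, so an equivariant function is determined by its
restriction to the cross-section, and left translation by `y` moves `t` by a triangular, hence
measure preserving, map and multiplies by a phase. This gives the unitary representation `π_λ`, its
uniqueness and its strong continuity.

For irreducibility, let `𝔥ᵢ₊₁` be the set of vectors of `𝔥ᵢ` that are `λ[·, ·]`-orthogonal to
`𝔥ᵢ ∩ 𝔫ᵢ₊₁`; these subalgebras descend from `𝔥₀ = 𝔫` to `𝔥ₙ = 𝔭(λ)`. Suppose all matrix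
coefficients `⟨π_λ(x) f, g⟩` vanish. When `𝔥ᵢ₊₁ ≠ 𝔥ᵢ`, a one-parameter group in `exp (𝔥ᵢ ∩ 𝔫ᵢ₊₁)`
acts on the cross-section coordinate transverse to `exp 𝔥ᵢ₊₁` by a character, so uniqueness of the
Fourier transform removes the integration over that coordinate. After `n` steps nothing is left to
integrate, and `f ⊗ g` vanishes almost everywhere, that is, `f = 0` or `g = 0`.

Finally, for `a ≠ 0`, `|a| ≠ 1` the numbers `N aᶻ` with `N, z ∈ ℤ` are dense in `ℝ`. Hence the
closure of `Γ_α` contains all one-parameter groups `exp ℝX_k`, so `Γ_α` is dense in `N`, and by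
strong continuity the closed subspaces invariant under `Γ_α` are invariant under `N`.
-/

noncomputable section

namespace WaveletRep

section NilpotentSeries

open Finset Polynomial

variable {A : Type*} [Ring A] [Algebra ℚ A]

/-- `(e^a - 1) / a` for a nilpotent element `a`, that is, `∑ a^j / (j + 1)!`. -/
def expSubOneDiv (a : A) : A :=
  ∑ j ∈ range (nilpotencyClass a), ((j + 1).factorial : ℚ)⁻¹ • a ^ j

/-- `log u` for a unipotent element `u`. -/
def unipotentLog (u : A) : A :=
  ∑ i ∈ range (nilpotencyClass (u - 1)), ((-1) ^ i / (i + 1) : ℚ) • (u - 1) ^ (i + 1)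

theorem sum_range_nilpotencyClass {R M : Type*} [MonoidWithZero R] [AddCommMonoid M] {a : R}
    {K : ℕ} (ha : a ^ K = 0) {f : ℕ → M} (hf : ∀ i, a ^ i = 0 → f i = 0) :
    ∑ i ∈ range (nilpotencyClass a), f i = ∑ i ∈ range K, f i :=
  sum_subset (range_mono (csInf_le' ha)) fun i _ hi => hf i <|
    pow_eq_zero_of_le (not_lt.1 fun h => hi (mem_range.2 h)) (pow_nilpotencyClass ⟨K, ha⟩)

theorem expSubOneDiv_eq_sum {a : A} {K : ℕ} (ha : a ^ K = 0) :
    expSubOneDiv a = ∑ j ∈ range K, ((j + 1).factorial : ℚ)⁻¹ • a ^ j :=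
  sum_range_nilpotencyClass ha fun i hi => by rw [hi, smul_zero]

theorem unipotentLog_eq_sum {u : A} {K : ℕ} (hu : (u - 1) ^ K = 0) :
    unipotentLog u = ∑ i ∈ range K, ((-1) ^ i / (i + 1) : ℚ) • (u - 1) ^ (i + 1) :=
  sum_range_nilpotencyClass hu fun i hi => by rw [pow_succ, hi, zero_mul, smul_zero]

theorem exp_sub_one_eq_sum {a : A} {K : ℕ} (ha : a ^ K = 0) :
    IsNilpotent.exp a - 1 = ∑ j ∈ range K, ((j + 1).factorial : ℚ)⁻¹ • a ^ (j + 1) := by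
  rw [IsNilpotent.exp_eq_sum (pow_eq_zero_of_le K.le_succ ha), sum_range_succ']
  simp

theorem expSubOneDiv_mul_self {a : A} (ha : IsNilpotent a) :
    expSubOneDiv a * a = IsNilpotent.exp a - 1 := by
  obtain ⟨K, hK⟩ := ha
  simp only [exp_sub_one_eq_sum hK, expSubOneDiv_eq_sum hK, sum_mul, smul_mul_assoc, pow_succ]

theorem isUnit_expSubOneDiv {a : A} (ha : IsNilpotent a) : IsUnit (expSubOneDiv a) := by
  obtain ⟨K, hK⟩ := id ha
  rw [expSubOneDiv_eq_sum (pow_eq_zero_of_le K.le_succ hK), sum_range_succ']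
  simp only [zero_add, Nat.factorial_one, Nat.cast_one, inv_one, one_smul, pow_zero]
  refine IsNilpotent.isUnit_add_one (Commute.isNilpotent_sum (fun j _ => ?_) fun i j _ _ => ?_)
  · exact (ha.pow_succ j).smul _
  · exact ((Commute.refl a).pow_pow _ _).smul_left _ |>.smul_right _

theorem isNilpotent_unipotentLog {u : A} (hu : IsNilpotent (u - 1)) :
    IsNilpotent (unipotentLog u) :=
  Commute.isNilpotent_sum (fun i _ => (hu.pow_succ i).smul _)
    fun _ _ _ _ => ((Commute.refl (u - 1)).pow_pow _ _).smul_left _ |>.smul_right _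

theorem commute_exp {a b : A} (h : Commute a b) : Commute (IsNilpotent.exp a) b :=
  Commute.sum_left _ _ _ fun i _ => (h.pow_left i).smul_left _

theorem commute_unipotentLog {u b : A} (h : Commute u b) : Commute (unipotentLog u) b :=
  Commute.sum_left _ _ _ fun i _ =>
    ((h.sub_left (Commute.one_left b)).pow_left (i + 1)).smul_left _

theorem map_unipotentLog {B : Type*} [Ring B] [Algebra ℚ B] (f : A →+* B) {u : A}
    (hu : IsNilpotent (u - 1)) : f (unipotentLog u) = unipotentLog (f u) := by
  obtain ⟨K, hK⟩ := hu
  have hK' : (f u - 1) ^ K = 0 := by rw [← map_one f, ← map_sub, ← map_pow, hK, map_zero]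
  simp [unipotentLog_eq_sum hK, unipotentLog_eq_sum hK', map_rat_smul]

theorem unipotentLog_one : unipotentLog (1 : A) = 0 := by simp [unipotentLog]

/-- Evaluation at `1`, a ring homomorphism also over a noncommutative ring, as `1` is central. -/
def evalOne {A : Type*} [Ring A] : A[X] →+* A :=
  eval₂RingHom' (RingHom.id A) 1 fun a => Commute.one_right a

theorem evalOne_C {A : Type*} [Ring A] (a : A) : evalOne (C a) = a := by
  simp [evalOne, eval₂RingHom']

theorem evalOne_X {A : Type*} [Ring A] : evalOne (X : A[X]) = 1 := by
  simp [evalOne, eval₂RingHom']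

theorem evalOne_X_mul_C {A : Type*} [Ring A] (a : A) : evalOne (X * C a : A[X]) = a := by
  rw [map_mul, evalOne_X, evalOne_C, one_mul]

theorem isNilpotent_X_mul_C {A : Type*} [Ring A] {a : A} (ha : IsNilpotent a) :
    IsNilpotent (X * C a : A[X]) :=
  (commute_X (C a)).isNilpotent_mul_left (ha.map C)

theorem derivative_X_mul_C {A : Type*} [Ring A] (a : A) : derivative (X * C a : A[X]) = C a := by
  simp

theorem eq_C_constantCoeff_of_derivative_eq_zero {p : A[X]} (h : derivative p = 0) :
    p = C (constantCoeff p) :=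
  have : IsAddTorsionFree A := IsAddTorsionFree.of_module_rat A
  eq_C_of_derivative_eq_zero h

theorem derivative_rat_smul (q : ℚ) (p : A[X]) : derivative (q • p) = q • derivative p :=
  map_rat_smul derivative q p

theorem exp_ad_apply (R : Type*) [CommRing R] [Algebra ℚ R] [Algebra R A] [IsScalarTower ℚ R A]
    {a : A} (ha : IsNilpotent a) (b : A) :
    IsNilpotent.exp (LieAlgebra.ad R A a) b = IsNilpotent.exp a * b * IsNilpotent.exp (-a) := by
  have hL : IsNilpotent (LinearMap.mulLeft R a) := (LinearMap.isNilpotent_mulLeft_iff R a).2 ha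
  have hR : IsNilpotent (LinearMap.mulRight R (-a)) :=
    (LinearMap.isNilpotent_mulRight_iff R (-a)).2 ha.neg
  have had : LieAlgebra.ad R A a = LinearMap.mulLeft R a + LinearMap.mulRight R (-a) := by
    ext b
    simp [Ring.lie_def, sub_eq_add_neg]
  have exp_mulLeft : IsNilpotent.exp (LinearMap.mulLeft R a) =
      LinearMap.mulLeft R (IsNilpotent.exp a) := (IsNilpotent.map_exp ha (Algebra.lmul R A)).symm
  have exp_mulRight : IsNilpotent.exp (LinearMap.mulRight R (-a)) =
      LinearMap.mulRight R (IsNilpotent.exp (-a)) := by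
    obtain ⟨K, hK⟩ := ha.neg
    have hK' : LinearMap.mulRight R (-a) ^ K = 0 := by
      rw [LinearMap.pow_mulRight, hK, LinearMap.mulRight_zero_eq_zero]
    ext b
    simp [IsNilpotent.exp_eq_sum hK, IsNilpotent.exp_eq_sum hK', LinearMap.pow_mulRight, mul_sum]
  rw [had, IsNilpotent.exp_add_of_commute (LinearMap.commute_mulLeft_right a (-a)) hL hR,
    exp_mulLeft, exp_mulRight]
  simp [mul_assoc]

section Endomorphisms

variable {R M N : Type*} [CommRing R] [Algebra ℚ R]
  [AddCommGroup M] [Module R M] [Module ℚ M] [IsScalarTower ℚ R M]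
  [AddCommGroup N] [Module R N] [Module ℚ N] [IsScalarTower ℚ R N]

theorem expSubOneDiv_comp_of_comp_eq {S : Module.End R N} {T : Module.End R M} {f : M →ₗ[R] N}
    (hS : IsNilpotent S) (hT : IsNilpotent T) (h : S ∘ₗ f = f ∘ₗ T) (w : M) :
    expSubOneDiv S (f w) = f (expSubOneDiv T w) := by
  obtain ⟨k, hS⟩ := hS
  obtain ⟨l, hT⟩ := hT
  have hpow (i : ℕ) : (S ^ i) (f w) = f ((T ^ i) w) :=
    LinearMap.congr_fun (Module.End.commute_pow_left_of_commute h i) w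
  simp [expSubOneDiv_eq_sum (pow_eq_zero_of_le (le_max_left k l) hS),
    expSubOneDiv_eq_sum (pow_eq_zero_of_le (le_max_right k l) hT), hpow, map_rat_smul]

theorem exp_apply_sub_self {T : Module.End R M} (hT : IsNilpotent T) (w : M) :
    IsNilpotent.exp T w - w = expSubOneDiv T (T w) :=
  (LinearMap.congr_fun (expSubOneDiv_mul_self hT) w).symm

theorem exp_comp_of_comp_eq {S : Module.End R N} {T : Module.End R M} {f : M →ₗ[R] N}
    (hS : IsNilpotent S) (hT : IsNilpotent T) (h : S ∘ₗ f = f ∘ₗ T) (w : M) :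
    IsNilpotent.exp S (f w) = f (IsNilpotent.exp T w) := by
  have hw : S (f w) = f (T w) := LinearMap.congr_fun h w
  rw [← sub_left_inj (a := f w), exp_apply_sub_self hS, ← map_sub, exp_apply_sub_self hT, hw,
    expSubOneDiv_comp_of_comp_eq hS hT h]

theorem expSubOneDiv_apply_sub_mem {T : Module.End R M} {E E' : Submodule R M} (hEE' : E' ≤ E)
    (hTE : ∀ w ∈ E, T w ∈ E') (hT : IsNilpotent T) {w : M} (hw : w ∈ E) :
    expSubOneDiv T w - w ∈ E' := by
  obtain ⟨K, hK⟩ := hT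
  have hpow (j : ℕ) : (T ^ j) w ∈ E := by
    induction j with
    | zero => simpa using hw
    | succ j ih => rw [pow_succ', Module.End.mul_apply]; exact hEE' (hTE _ ih)
  rw [expSubOneDiv_eq_sum (pow_eq_zero_of_le K.le_succ hK), sum_range_succ']
  simp only [zero_add, Nat.factorial_one, Nat.cast_one, inv_one, one_smul, pow_zero,
    LinearMap.add_apply, LinearMap.sum_apply, LinearMap.smul_apply, Module.End.one_apply,
    add_sub_cancel_right]
  refine E'.sum_mem fun j _ => E'.smul_of_tower_mem _ ?_
  rw [pow_succ', Module.End.mul_apply]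
  exact hTE _ (hpow j)

theorem mem_of_expSubOneDiv_apply_mem {T : Module.End R M} {E : Submodule R M}
    (hTE : E ≤ E.comap T) (hT : IsNilpotent T) {w : M} (hw : expSubOneDiv T w ∈ E) : w ∈ E := by
  have hquot : expSubOneDiv (E.mapQ E T hTE) (E.mkQ w) = 0 := by
    rwa [expSubOneDiv_comp_of_comp_eq (Module.End.IsNilpotent.mapQ hTE hT) hT (E.mapQ_mkQ E T),
      Submodule.mkQ_apply, Submodule.Quotient.mk_eq_zero]
  have hunit := isUnit_expSubOneDiv (Module.End.IsNilpotent.mapQ hTE hT)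
  rwa [map_eq_zero_iff _ ((Module.End.isUnit_iff _).1 hunit).injective, Submodule.mkQ_apply,
    Submodule.Quotient.mk_eq_zero] at hquot

end Endomorphisms

/-- Conjugate the derivation `D` by `e^z`, with `z` acting by multiplication: since `[z, D] = -z'`,
this gives `e^z D e^{-z} = D - ((e^{ad z} - 1) / ad z) z'`. -/
theorem exp_mul_derivative_exp_neg {z : A[X]} (hz : IsNilpotent z) :
    IsNilpotent.exp z * derivative (IsNilpotent.exp (-z)) =
      -expSubOneDiv (LieAlgebra.ad ℚ A[X] z) (derivative z) := by
  let L := Algebra.lmul ℚ A[X]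
  let D : Module.End ℚ A[X] := (derivative : A[X] →ₗ[A] A[X]).restrictScalars ℚ
  have hL : IsNilpotent (L z) := hz.map L
  have had : IsNilpotent (LieAlgebra.ad ℚ _ (L z)) := LieAlgebra.ad_nilpotent_of_nilpotent hL
  have hLD : LieAlgebra.ad ℚ _ (L z) D = L (-derivative z) := by
    ext p : 1
    simp [L, D, Ring.lie_def, derivative_mul]
  have hint : LieAlgebra.ad ℚ _ (L z) ∘ₗ L.toLinearMap =
      L.toLinearMap ∘ₗ LieAlgebra.ad ℚ A[X] z := by
    ext w : 1
    simp only [LinearMap.comp_apply, LieAlgebra.ad_apply, AlgHom.toLinearMap_apply, Ring.lie_def,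
      map_sub, map_mul]
  have hconj : L (IsNilpotent.exp z) * D * L (IsNilpotent.exp (-z)) - D =
      -L (expSubOneDiv (LieAlgebra.ad ℚ A[X] z) (derivative z)) := by
    rw [IsNilpotent.map_exp hz L, IsNilpotent.map_exp hz.neg L, map_neg, ← exp_ad_apply ℚ hL D]
    have h := LinearMap.congr_fun (expSubOneDiv_mul_self had) D
    rw [LinearMap.sub_apply, Module.End.one_apply, Module.End.mul_apply, hLD] at h
    rw [← h, map_neg, map_neg]
    exact congrArg Neg.neg (expSubOneDiv_comp_of_comp_eq had
      (LieAlgebra.ad_nilpotent_of_nilpotent hz) hint (derivative z))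
  simpa [L, D] using LinearMap.congr_fun hconj 1

theorem derivative_exp {z : A[X]} (hz : IsNilpotent z) :
    derivative (IsNilpotent.exp z) =
      expSubOneDiv (LieAlgebra.ad ℚ A[X] z) (derivative z) * IsNilpotent.exp z := by
  have h : derivative (IsNilpotent.exp z * IsNilpotent.exp (-z)) = 0 := by
    rw [IsNilpotent.exp_mul_exp_neg_self hz, derivative_one]
  rw [derivative_mul, exp_mul_derivative_exp_neg hz, add_neg_eq_zero] at h
  rw [← h, mul_assoc, IsNilpotent.exp_neg_mul_exp_self hz, mul_one]

theorem derivative_exp_of_commute {z : A[X]} (hz : IsNilpotent z) (h : Commute z (derivative z)) :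
    derivative (IsNilpotent.exp z) = derivative z * IsNilpotent.exp z := by
  have hfix : expSubOneDiv (LieAlgebra.ad ℚ A[X] z) (derivative z) - derivative z ∈
      (⊥ : Submodule ℚ A[X]) :=
    expSubOneDiv_apply_sub_mem (E := LinearMap.ker (LieAlgebra.ad ℚ A[X] z)) bot_le
      (fun _ hw => hw) (LieAlgebra.ad_nilpotent_of_nilpotent hz) (sub_eq_zero.2 h)
  rw [derivative_exp hz, sub_eq_zero.1 ((Submodule.mem_bot ℚ).1 hfix)]

theorem derivative_unipotentLog_one_add_X_mul_C {v : A} {K : ℕ} (hv : v ^ K = 0) :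
    derivative (unipotentLog (1 + X * C v : A[X])) =
      (∑ i ∈ range K, (-(X * C v)) ^ i) * C v := by
  have hpow (i : ℕ) : (X * C v : A[X]) ^ i = X ^ i * C (v ^ i) := by
    rw [(commute_X (C v)).mul_pow, C_pow]
  have hderiv (i : ℕ) : derivative ((X * C v : A[X]) ^ (i + 1)) =
      ((i + 1 : ℕ) : ℚ) • ((X * C v) ^ i * C v) := by
    rw [hpow, hpow, derivative_mul, derivative_C, mul_zero, add_zero, derivative_X_pow, mul_assoc,
      mul_assoc, ← C_mul, ← pow_succ, C_eq_natCast, Nat.add_sub_cancel, Nat.cast_smul_eq_nsmul,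
      nsmul_eq_mul]
  have hK : (1 + X * C v - 1 : A[X]) ^ K = 0 := by rw [add_sub_cancel_left, hpow, hv, C_0, mul_zero]
  rw [unipotentLog_eq_sum hK, derivative_sum, sum_mul]
  refine sum_congr rfl fun i _ => ?_
  have hcoeff : ((-1) ^ i / (i + 1) : ℚ) * ((i + 1 : ℕ) : ℚ) = (-1) ^ i := by
    push_cast
    field_simp
  have hsign : (-1 : ℚ) ^ i • (1 : A[X]) = (-1) ^ i := by
    rw [← Algebra.algebraMap_eq_smul_one, map_pow, map_neg, map_one]
  rw [add_sub_cancel_left, derivative_rat_smul, hderiv, smul_smul, hcoeff, neg_pow (X * C v),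
    mul_assoc, ← smul_one_mul, hsign]

theorem evalOne_eq_constantCoeff_of_derivative_eq_zero {p : A[X]} (h : derivative p = 0) :
    evalOne p = constantCoeff p := by
  rw [eq_C_constantCoeff_of_derivative_eq_zero h, evalOne_C]
  simp

theorem derivative_exp_neg_unipotentLog_mul {v : A} (hv : IsNilpotent v) :
    derivative (IsNilpotent.exp (-unipotentLog (1 + X * C v)) * (1 + X * C v) : A[X]) = 0 := by
  obtain ⟨K, hK⟩ := id hv
  set w : A[X] := X * C v with hw
  set z : A[X] := unipotentLog (1 + w)
  have hz_nil : IsNilpotent z :=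
    isNilpotent_unipotentLog (by rw [add_sub_cancel_left]; exact isNilpotent_X_mul_C hv)
  have hz' : derivative z = (∑ i ∈ range K, (-w) ^ i) * C v :=
    derivative_unipotentLog_one_add_X_mul_C hK
  have hwz' : (1 + w) * derivative z = C v := by
    have hwK : (-w) ^ K = 0 := by
      rw [neg_pow, hw, (commute_X (C v)).mul_pow, ← C_pow, hK, C_0, mul_zero, mul_zero]
    rw [hz', ← mul_assoc, ← sub_neg_eq_add, mul_neg_geom_sum, hwK, sub_zero, one_mul]
  have hcomm {b : A[X]} (hb : Commute (C v) b) :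
      Commute (1 + w) b ∧ Commute z b ∧ Commute (derivative z) b := by
    have hwb : Commute w b := (commute_X b).mul_left hb
    have hwb' : Commute (1 + w) b := (Commute.one_left b).add_left hwb
    refine ⟨hwb', commute_unipotentLog hwb', ?_⟩
    rw [hz']
    exact (Commute.sum_left _ _ _ fun i _ => hwb.neg_left.pow_left i).mul_left hb
  have hvz' : Commute (C v) (derivative z) := (hcomm (Commute.refl _)).2.2.symm
  have hzz' : Commute (-z) (derivative z) := (hcomm hvz').2.1.neg_left
  rw [derivative_mul, derivative_exp_of_commute hz_nil.neg
    (by rw [derivative_neg]; exact hzz'.neg_right), derivative_neg, neg_mul,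
    ← (commute_exp hzz').eq, neg_mul, mul_assoc, ← (hcomm hvz').1.eq, hwz', derivative_add,
    derivative_one, zero_add, derivative_X_mul_C, neg_add_cancel]

theorem exp_unipotentLog {u : A} (hu : IsNilpotent (u - 1)) :
    IsNilpotent.exp (unipotentLog u) = u := by
  set v := u - 1 with hv
  have hw_nil : IsNilpotent (1 + X * C v - 1 : A[X]) := by
    rw [add_sub_cancel_left]; exact isNilpotent_X_mul_C hu
  have hmap (f : A[X] →+* A) :
      f (IsNilpotent.exp (-unipotentLog (1 + X * C v)) * (1 + X * C v)) =
        IsNilpotent.exp (-unipotentLog (1 + f (X * C v))) * (1 + f (X * C v)) := by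
    rw [map_mul, IsNilpotent.map_exp (isNilpotent_unipotentLog hw_nil).neg, map_neg,
      map_unipotentLog f hw_nil, map_add, map_one]
  have hcoeff : constantCoeff (X * C v : A[X]) = 0 := by simp
  have hone : IsNilpotent.exp (-unipotentLog u) * u = 1 := by
    have heval := evalOne_eq_constantCoeff_of_derivative_eq_zero
      (derivative_exp_neg_unipotentLog_mul hu)
    rwa [hmap, hmap, evalOne_X_mul_C, hcoeff, add_zero, unipotentLog_one, neg_zero,
      IsNilpotent.exp_zero, one_mul, hv, add_sub_cancel] at heval
  rw [← mul_one (IsNilpotent.exp _), ← hone, ← mul_assoc,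
    IsNilpotent.exp_mul_exp_neg_self (isNilpotent_unipotentLog hu), one_mul]

theorem eq_of_exp_eq_exp_of_commute {a b : A} (ha : IsNilpotent a) (hb : IsNilpotent b)
    (hab : Commute a b) (h : IsNilpotent.exp a = IsNilpotent.exp b) : a = b := by
  have hsub : IsNilpotent (a - b) := hab.isNilpotent_sub ha hb
  have hone : IsNilpotent.exp (a - b) = 1 := by
    rw [sub_eq_add_neg, IsNilpotent.exp_add_of_commute hab.neg_right ha hb.neg, h,
      IsNilpotent.exp_mul_exp_neg_self hb]
  have hzero := expSubOneDiv_mul_self hsub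
  rw [hone, sub_self] at hzero
  exact sub_eq_zero.1 ((isUnit_expSubOneDiv hsub).mul_right_eq_zero.1 hzero)

theorem unipotentLog_exp {a : A} (ha : IsNilpotent a) : unipotentLog (IsNilpotent.exp a) = a :=
  eq_of_exp_eq_exp_of_commute (isNilpotent_unipotentLog ha.isNilpotent_exp_sub_one) ha
    (commute_unipotentLog (commute_exp (Commute.refl a)))
    (exp_unipotentLog ha.isNilpotent_exp_sub_one)

end NilpotentSeries

section BakerCampbellHausdorff

open Finset Polynomial

variable {A : Type*} [Ring A] [Algebra ℚ A] {U V k k' : Submodule ℚ A}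

/-- The polynomials whose coefficients up to order `j` lie in `U`. -/
def coeffLE (U : Submodule ℚ A) (j : ℕ∞) : Submodule ℚ A[X] where
  carrier := {p | ∀ i : ℕ, i ≤ j → p.coeff i ∈ U}
  zero_mem' := fun i _ => by simp
  add_mem' := fun hp hq i hi => by rw [coeff_add]; exact U.add_mem (hp i hi) (hq i hi)
  smul_mem' := fun c p hp i hi => by rw [coeff_smul]; exact U.smul_mem c (hp i hi)

theorem coeffLE_mono (h : U ≤ V) (j : ℕ∞) : coeffLE U j ≤ coeffLE V j :=
  fun _ hp i hi => h (hp i hi)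

theorem C_mem_coeffLE {a : A} (ha : a ∈ U) (j : ℕ∞) : C a ∈ coeffLE U j := by
  intro i _
  rw [coeff_C]
  split_ifs
  exacts [ha, U.zero_mem]

theorem X_mul_C_mem_coeffLE {a : A} (ha : a ∈ U) (j : ℕ∞) : X * C a ∈ coeffLE U j := by
  intro i _
  rw [X_mul_C, coeff_C_mul_X]
  split_ifs
  exacts [ha, U.zero_mem]

theorem coeffLE_mul_le (U V : Submodule ℚ A) (j : ℕ∞) :
    coeffLE U j * coeffLE V j ≤ coeffLE (U * V) j := by
  refine Submodule.mul_le.2 fun p hp q hq i hi => ?_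
  rw [coeff_mul]
  refine Submodule.sum_mem _ fun ij hij => Submodule.mul_mem_mul (hp _ ?_) (hq _ ?_)
  · exact (Nat.cast_le.2 (HasAntidiagonal.antidiagonal.fst_le hij)).trans hi
  · exact (Nat.cast_le.2 (HasAntidiagonal.antidiagonal.snd_le hij)).trans hi

theorem coeffLE_pow_le (U : Submodule ℚ A) (j : ℕ∞) (K : ℕ) :
    coeffLE U j ^ K ≤ coeffLE (U ^ K) j := by
  induction K with
  | zero =>
    rw [pow_zero, pow_zero, Submodule.one_le, ← C_1]
    exact C_mem_coeffLE (Submodule.one_le.1 le_rfl) j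
  | succ K ih =>
    rw [pow_succ, pow_succ]
    exact (mul_le_mul_left ih _).trans (coeffLE_mul_le _ _ j)

theorem isNilpotent_coeffLE_top (hU : IsNilpotent U) : IsNilpotent (coeffLE U ⊤) := by
  obtain ⟨K, hK⟩ := hU
  refine ⟨K, (Submodule.eq_bot_iff _).2 fun p hp => ?_⟩
  have hcoeff := coeffLE_pow_le U ⊤ K hp
  rw [hK] at hcoeff
  ext i
  exact hcoeff i le_top

theorem mem_coeffLE_succ {p : A[X]} {j : ℕ∞} (h0 : constantCoeff p ∈ U)
    (h : derivative p ∈ coeffLE U j) : p ∈ coeffLE U (j + 1) := by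
  rintro (_ | i) hi
  · exact h0
  · have hmem := h i (by simpa using hi)
    rw [coeff_derivative, ← Nat.cast_succ, ← nsmul_eq_mul', ← Nat.cast_smul_eq_nsmul ℚ] at hmem
    exact (U.smul_mem_iff (by positivity)).1 hmem

theorem evalOne_mem {p : A[X]} (hp : p ∈ coeffLE U ⊤) : evalOne p ∈ U := by
  have heval : evalOne p = p.eval 1 := by simp [evalOne, eval₂RingHom', eval₂_eq_sum, eval_eq_sum]
  rw [heval, eval_eq_sum]
  exact U.sum_mem fun i _ => by simpa using hp i le_top

theorem lie_mem_coeffLE (hlie : ∀ a ∈ k, ∀ b ∈ k, ⁅a, b⁆ ∈ k') {j : ℕ∞} {p q : A[X]}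
    (hp : p ∈ coeffLE k j) (hq : q ∈ coeffLE k j) : ⁅p, q⁆ ∈ coeffLE k' j := by
  intro i hi
  rw [Ring.lie_def, coeff_sub, coeff_mul, coeff_mul, ← Nat.sum_antidiagonal_swap,
    ← sum_sub_distrib]
  refine Submodule.sum_mem _ fun ij hij => hlie _ (hp _ ?_) _ (hq _ ?_)
  · exact (Nat.cast_le.2 (HasAntidiagonal.antidiagonal.snd_le hij)).trans hi
  · exact (Nat.cast_le.2 (HasAntidiagonal.antidiagonal.fst_le hij)).trans hi

theorem isNilpotent_of_mem (hU : IsNilpotent U) {a : A} (ha : a ∈ U) : IsNilpotent a := by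
  obtain ⟨K, hK⟩ := hU
  refine ⟨K, (Submodule.mem_bot ℚ).1 ?_⟩
  rw [← Submodule.zero_eq_bot, ← hK]
  exact Submodule.pow_mem_pow _ ha K

theorem pow_succ_mem (hU : U * U ≤ U) {a : A} (ha : a ∈ U) (i : ℕ) : a ^ (i + 1) ∈ U := by
  induction i with
  | zero => simpa using ha
  | succ i ih => rw [pow_succ]; exact hU (Submodule.mul_mem_mul ih ha)

theorem exp_sub_one_mem (hU : U * U ≤ U) {a : A} (ha : a ∈ U) (hn : IsNilpotent a) :
    IsNilpotent.exp a - 1 ∈ U := by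
  obtain ⟨K, hK⟩ := hn
  rw [exp_sub_one_eq_sum hK]
  exact U.sum_mem fun i _ => U.smul_mem _ (pow_succ_mem hU ha i)

theorem exp_mul_exp_sub_one_mem (hU : U * U ≤ U) (hn : IsNilpotent U) {a b : A} (ha : a ∈ U)
    (hb : b ∈ U) : IsNilpotent.exp a * IsNilpotent.exp b - 1 ∈ U := by
  have hexp_a := exp_sub_one_mem hU ha (isNilpotent_of_mem hn ha)
  have hexp_b := exp_sub_one_mem hU hb (isNilpotent_of_mem hn hb)
  have hexpand : IsNilpotent.exp a * IsNilpotent.exp b - 1 =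
      (IsNilpotent.exp a - 1) * (IsNilpotent.exp b - 1) + (IsNilpotent.exp a - 1) +
        (IsNilpotent.exp b - 1) := by noncomm_ring
  rw [hexpand]
  exact U.add_mem (U.add_mem (hU (Submodule.mul_mem_mul hexp_a hexp_b)) hexp_a) hexp_b

/-- The path `t ↦ log (exp (t y) exp x)` from `x` to `log (exp y exp x)`, as a polynomial. -/
def bchPath (x y : A) : A[X] :=
  unipotentLog (IsNilpotent.exp (X * C y) * IsNilpotent.exp (C x))

variable {x y : A}

theorem isNilpotent_exp_X_mul_exp_sub_one (hU : U * U ≤ U) (hn : IsNilpotent U) (hx : x ∈ U)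
    (hy : y ∈ U) : IsNilpotent (IsNilpotent.exp (X * C y) * IsNilpotent.exp (C x) - 1) :=
  have hn' := isNilpotent_coeffLE_top hn
  isNilpotent_of_mem hn' (exp_mul_exp_sub_one_mem
    ((coeffLE_mul_le U U ⊤).trans (coeffLE_mono hU ⊤)) hn'
    (X_mul_C_mem_coeffLE hy ⊤) (C_mem_coeffLE hx ⊤))

theorem constantCoeff_bchPath (hU : U * U ≤ U) (hn : IsNilpotent U) (hx : x ∈ U) (hy : y ∈ U) :
    constantCoeff (bchPath x y) = x := by
  have hx_nil := isNilpotent_of_mem hn hx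
  rw [bchPath, map_unipotentLog _ (isNilpotent_exp_X_mul_exp_sub_one hU hn hx hy), map_mul,
    IsNilpotent.map_exp (isNilpotent_X_mul_C (isNilpotent_of_mem hn hy)),
    IsNilpotent.map_exp (hx_nil.map C), map_mul, constantCoeff_apply X, coeff_X_zero, zero_mul,
    IsNilpotent.exp_zero, one_mul, constantCoeff_apply, coeff_C_zero, unipotentLog_exp hx_nil]

theorem evalOne_bchPath (hU : U * U ≤ U) (hn : IsNilpotent U) (hx : x ∈ U) (hy : y ∈ U) :
    evalOne (bchPath x y) = unipotentLog (IsNilpotent.exp y * IsNilpotent.exp x) := by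
  rw [bchPath, map_unipotentLog _ (isNilpotent_exp_X_mul_exp_sub_one hU hn hx hy), map_mul,
    IsNilpotent.map_exp (isNilpotent_X_mul_C (isNilpotent_of_mem hn hy)),
    IsNilpotent.map_exp ((isNilpotent_of_mem hn hx).map C), evalOne_X_mul_C, evalOne_C]

/-- Differentiate `exp (bchPath x y) = exp (X y) exp x`. -/
theorem expSubOneDiv_ad_bchPath (hU : U * U ≤ U) (hn : IsNilpotent U) (hx : x ∈ U) (hy : y ∈ U) :
    expSubOneDiv (LieAlgebra.ad ℚ A[X] (bchPath x y)) (derivative (bchPath x y)) = C y := by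
  have hunip := isNilpotent_exp_X_mul_exp_sub_one hU hn hx hy
  have hexp : IsNilpotent.exp (bchPath x y) = IsNilpotent.exp (X * C y) * IsNilpotent.exp (C x) :=
    exp_unipotentLog hunip
  have hnil : IsNilpotent (bchPath x y) := isNilpotent_unipotentLog hunip
  have hXy : Commute (X * C y) (derivative (X * C y)) := by
    rw [derivative_X_mul_C]
    exact (commute_X (C y)).mul_left (Commute.refl _)
  have hderiv : derivative (IsNilpotent.exp (bchPath x y)) =
      C y * IsNilpotent.exp (bchPath x y) := by
    rw [hexp, derivative_mul, ← IsNilpotent.map_exp (isNilpotent_of_mem hn hx), derivative_C,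
      mul_zero, add_zero, derivative_exp_of_commute (isNilpotent_X_mul_C
        (isNilpotent_of_mem hn hy)) hXy, derivative_X_mul_C, mul_assoc]
  rw [derivative_exp hnil] at hderiv
  exact (IsNilpotent.isUnit_exp hnil).mul_right_cancel hderiv

theorem derivative_bchPath_mem (hU : U * U ≤ U) (hn : IsNilpotent U) (hkU : k ≤ U) (hk' : k' ≤ k)
    (hlie : ∀ a ∈ k, ∀ b ∈ k, ⁅a, b⁆ ∈ k') (hx : x ∈ k) (hy : y ∈ k) {j : ℕ∞}
    (hj : bchPath x y ∈ coeffLE k j) :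
    derivative (bchPath x y) ∈ coeffLE k j ∧ derivative (bchPath x y) - C y ∈ coeffLE k' j := by
  have hy_eq := expSubOneDiv_ad_bchPath hU hn (hkU hx) (hkU hy)
  have had : IsNilpotent (LieAlgebra.ad ℚ A[X] (bchPath x y)) :=
    LieAlgebra.ad_nilpotent_of_nilpotent
      (isNilpotent_unipotentLog (isNilpotent_exp_X_mul_exp_sub_one hU hn (hkU hx) (hkU hy)))
  have hmap : ∀ w ∈ coeffLE k j, LieAlgebra.ad ℚ A[X] (bchPath x y) w ∈ coeffLE k' j :=
    fun w hw => lie_mem_coeffLE hlie hj hw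
  have hmem : derivative (bchPath x y) ∈ coeffLE k j :=
    mem_of_expSubOneDiv_apply_mem (fun w hw => coeffLE_mono hk' j (hmap w hw)) had
      (hy_eq ▸ C_mem_coeffLE hy j)
  have hsub := expSubOneDiv_apply_sub_mem (coeffLE_mono hk' j) hmap had hmem
  rw [hy_eq, ← neg_sub, Submodule.neg_mem_iff] at hsub
  exact ⟨hmem, hsub⟩

theorem bchPath_mem_coeffLE (hU : U * U ≤ U) (hn : IsNilpotent U) (hkU : k ≤ U) (hk' : k' ≤ k)
    (hlie : ∀ a ∈ k, ∀ b ∈ k, ⁅a, b⁆ ∈ k') (hx : x ∈ k) (hy : y ∈ k) :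
    bchPath x y ∈ coeffLE k ⊤ := by
  have hconst : constantCoeff (bchPath x y) ∈ k := by
    rwa [constantCoeff_bchPath hU hn (hkU hx) (hkU hy)]
  have hfin (j : ℕ) : bchPath x y ∈ coeffLE k j := by
    induction j with
    | zero =>
      intro i hi
      obtain rfl : i = 0 := by simpa using hi
      exact hconst
    | succ j ih =>
      exact mem_coeffLE_succ hconst (derivative_bchPath_mem hU hn hkU hk' hlie hx hy ih).1
  exact fun i _ => hfin i i le_rfl

theorem unipotentLog_exp_mul_exp_sub_add_mem (hU : U * U ≤ U) (hn : IsNilpotent U) (hkU : k ≤ U)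
    (hk' : k' ≤ k) (hlie : ∀ a ∈ k, ∀ b ∈ k, ⁅a, b⁆ ∈ k') (hx : x ∈ k) (hy : y ∈ k) :
    unipotentLog (IsNilpotent.exp y * IsNilpotent.exp x) - (x + y) ∈ k' := by
  have hdiff : bchPath x y - (C x + X * C y) ∈ coeffLE k' ⊤ := by
    refine mem_coeffLE_succ (j := ⊤) ?_ ?_
    · rw [map_sub, constantCoeff_bchPath hU hn (hkU hx) (hkU hy)]
      simp
    · rw [derivative_sub, derivative_add, derivative_C, zero_add, derivative_X_mul_C]
      exact (derivative_bchPath_mem hU hn hkU hk' hlie hx hy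
        (bchPath_mem_coeffLE hU hn hkU hk' hlie hx hy)).2
  have heval := evalOne_mem hdiff
  rwa [map_sub, map_add, evalOne_bchPath hU hn (hkU hx) (hkU hy), evalOne_C, evalOne_X_mul_C]
    at heval

end BakerCampbellHausdorff

section MatrixGroup

open Finset

theorem matrix_pow_card_eq_zero {R ι : Type*} [CommRing R] [IsDomain R] [Fintype ι]
    [DecidableEq ι] {M : Matrix ι ι R} (hM : IsNilpotent M) : M ^ Fintype.card ι = 0 := by
  have hchar : M.charpoly = Polynomial.X ^ Fintype.card ι :=
    sub_eq_zero.1 (Matrix.isNilpotent_charpoly_sub_pow_of_isNilpotent hM).eq_zero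
  simpa [hchar] using Matrix.aeval_self_charpoly M

theorem exp_eq_nilpotent_exp {m : ℕ} {a : Matrix (Fin m) (Fin m) ℝ} (ha : IsNilpotent a) :
    NormedSpace.exp a = IsNilpotent.exp a := by
  obtain ⟨K, hK⟩ := ha
  rw [NormedSpace.exp_eq_tsum ℚ, IsNilpotent.exp_eq_sum hK]
  refine tsum_eq_sum fun i hi => ?_
  rw [pow_eq_zero_of_le (by simpa using hi) hK, smul_zero]

variable {m : ℕ} {𝔫 : LieSubalgebra ℝ (Matrix (Fin m) (Fin m) ℝ)}

/-- A Lie algebra of nilpotent matrices. -/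
class IsNilMatrixAlgebra (𝔫 : LieSubalgebra ℝ (Matrix (Fin m) (Fin m) ℝ)) : Prop where
  isNilpotent_of_mem : ∀ X ∈ 𝔫, IsNilpotent X

/-- The matrices that lower by `j` steps the lower central series `V₀ ⊇ V₁ ⊇ ⋯` of `ℝᵐ` as an
`𝔫`-module. Those with `j = 1` form an associative algebra containing `𝔫`, nilpotent by Engel's
theorem, in which the exponentials of `𝔫` can be multiplied and their logarithms taken. -/
def loweringMatrices (𝔫 : LieSubalgebra ℝ (Matrix (Fin m) (Fin m) ℝ)) (j : ℕ) :
    Submodule ℝ (Matrix (Fin m) (Fin m) ℝ) where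
  carrier := {M | ∀ i, ∀ v ∈ LieModule.lowerCentralSeries ℝ 𝔫 (Fin m → ℝ) i,
    M.mulVec v ∈ LieModule.lowerCentralSeries ℝ 𝔫 (Fin m → ℝ) (i + j)}
  zero_mem' := fun i v _ => by simp
  add_mem' := fun ha hb i v hv => by
    rw [Matrix.add_mulVec]
    exact add_mem (ha i v hv) (hb i v hv)
  smul_mem' := fun c M hM i v hv => by
    rw [Matrix.smul_mulVec]
    exact (LieModule.lowerCentralSeries ℝ 𝔫 (Fin m → ℝ) (i + j)).smul_mem c (hM i v hv)

theorem mem_loweringMatrices_one (Y : 𝔫) :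
    (Y : Matrix (Fin m) (Fin m) ℝ) ∈ loweringMatrices 𝔫 1 := fun i v hv => by
  rw [LieModule.lowerCentralSeries_succ]
  exact LieSubmodule.lie_mem_lie (x := Y) (LieSubmodule.mem_top Y) hv

theorem loweringMatrices_mul_le (𝔫 : LieSubalgebra ℝ (Matrix (Fin m) (Fin m) ℝ)) (i j : ℕ) :
    loweringMatrices 𝔫 i * loweringMatrices 𝔫 j ≤ loweringMatrices 𝔫 (i + j) :=
  Submodule.mul_le.2 fun M hM M' hM' k v hv => by
    rw [← Matrix.mulVec_mulVec, add_comm i j, ← add_assoc]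
    exact hM _ _ (hM' k v hv)

theorem loweringMatrices_anti {i j : ℕ} (hij : i ≤ j) :
    loweringMatrices 𝔫 j ≤ loweringMatrices 𝔫 i := fun _ hM k v hv =>
  LieModule.antitone_lowerCentralSeries ℝ 𝔫 (Fin m → ℝ) (Nat.add_le_add_left hij k) (hM k v hv)

theorem loweringMatrices_one_pow_succ_le (j : ℕ) :
    loweringMatrices 𝔫 1 ^ (j + 1) ≤ loweringMatrices 𝔫 (j + 1) := by
  induction j with
  | zero => simp
  | succ j ih =>
    rw [pow_succ]
    exact (mul_le_mul_left ih _).trans (loweringMatrices_mul_le 𝔫 (j + 1) 1)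

theorem isNilpotent_loweringMatrices_one [h𝔫 : IsNilMatrixAlgebra 𝔫] :
    IsNilpotent (loweringMatrices 𝔫 1) := by
  have hnil : LieModule.IsNilpotent 𝔫 (Fin m → ℝ) := by
    refine (LieModule.isNilpotent_iff_forall' (R := ℝ)).2 fun Y => ?_
    have hY : LieModule.toEnd ℝ 𝔫 (Fin m → ℝ) Y = Matrix.toLinAlgEquiv' Y.1 := rfl
    rw [hY]
    exact (h𝔫.isNilpotent_of_mem Y Y.2).map Matrix.toLinAlgEquiv'
  obtain ⟨K, hK⟩ := (LieModule.isNilpotent_iff ℝ 𝔫 (Fin m → ℝ)).1 hnil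
  refine ⟨K + 1, eq_bot_iff.2 fun M hM => ?_⟩
  have hzero (v : Fin m → ℝ) : M.mulVec v = 0 := by
    have hv := loweringMatrices_anti K.le_succ (loweringMatrices_one_pow_succ_le K hM) 0 v (by simp)
    rwa [zero_add, hK, LieSubmodule.mem_bot] at hv
  exact Matrix.ext_of_mulVec_single fun i => by rw [hzero, Matrix.zero_mulVec]

/-- `loweringMatrices 𝔫 1` over the rational numbers, the field over which the
Baker–Campbell–Hausdorff series is written. -/
abbrev ratLowering (𝔫 : LieSubalgebra ℝ (Matrix (Fin m) (Fin m) ℝ)) :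
    Submodule ℚ (Matrix (Fin m) (Fin m) ℝ) :=
  (loweringMatrices 𝔫 1).restrictScalars ℚ

theorem ratLowering_mul_le (𝔫 : LieSubalgebra ℝ (Matrix (Fin m) (Fin m) ℝ)) :
    ratLowering 𝔫 * ratLowering 𝔫 ≤ ratLowering 𝔫 := by
  refine Submodule.mul_le.2 fun M hM M' hM' => ?_
  exact (loweringMatrices_mul_le 𝔫 1 1).trans (loweringMatrices_anti one_le_two)
    (Submodule.mul_mem_mul hM hM')

theorem isNilpotent_ratLowering [IsNilMatrixAlgebra 𝔫] : IsNilpotent (ratLowering 𝔫) := by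
  obtain ⟨K, hK⟩ := isNilpotent_loweringMatrices_one (𝔫 := 𝔫)
  refine ⟨K + 1, ?_⟩
  rw [ratLowering, ← Submodule.restrictScalars_pow K.succ_ne_zero, pow_succ, hK]
  simp

theorem coe_expN [h𝔫 : IsNilMatrixAlgebra 𝔫] (Y : 𝔫) :
    ((expN Y : GL (Fin m) ℝ) : Matrix (Fin m) (Fin m) ℝ) =
      IsNilpotent.exp (Y : Matrix (Fin m) (Fin m) ℝ) :=
  exp_eq_nilpotent_exp (h𝔫.isNilpotent_of_mem Y Y.2)

theorem lieGroup_ext {x y : lieGroup 𝔫} (h : ((x : GL (Fin m) ℝ) : Matrix (Fin m) (Fin m) ℝ) =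
    ((y : GL (Fin m) ℝ) : Matrix (Fin m) (Fin m) ℝ)) : x = y :=
  Subtype.ext (Units.ext h)

theorem expN_zero : expN (0 : 𝔫) = 1 :=
  lieGroup_ext (NormedSpace.exp_zero (𝔸 := Matrix (Fin m) (Fin m) ℝ))

theorem expN_neg (Y : 𝔫) : expN (-Y) = (expN Y)⁻¹ :=
  eq_inv_of_mul_eq_one_left (lieGroup_ext (expGL (Y : Matrix (Fin m) (Fin m) ℝ)).inv_val)

theorem expN_add_smul (s t : ℝ) (Y : 𝔫) : expN ((s + t) • Y) = expN (s • Y) * expN (t • Y) := by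
  have hcomm : Commute (s • Y : Matrix (Fin m) (Fin m) ℝ) (t • Y : Matrix (Fin m) (Fin m) ℝ) :=
    ((Commute.refl _).smul_left s).smul_right t
  refine lieGroup_ext (Eq.trans ?_ (Matrix.exp_add_of_commute _ _ hcomm))
  exact congrArg (fun Z : 𝔫 => NormedSpace.exp (Z : Matrix (Fin m) (Fin m) ℝ)) (add_smul s t Y)

variable [IsNilMatrixAlgebra 𝔫]

theorem exp_mul_exp_sub_one_mem_ratLowering (x y : 𝔫) :
    IsNilpotent.exp (x : Matrix (Fin m) (Fin m) ℝ) * IsNilpotent.exp (y : Matrix (Fin m) (Fin m) ℝ)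
      - 1 ∈ ratLowering 𝔫 :=
  exp_mul_exp_sub_one_mem (ratLowering_mul_le 𝔫) isNilpotent_ratLowering
    (mem_loweringMatrices_one x) (mem_loweringMatrices_one y)

theorem exists_expN_mul_expN {k k' : Submodule ℝ 𝔫} (hk' : k' ≤ k)
    (hlie : ∀ a ∈ k, ∀ b ∈ k, ⁅a, b⁆ ∈ k') {x y : 𝔫} (hx : x ∈ k) (hy : y ∈ k) :
    ∃ z ∈ k, z - (x + y) ∈ k' ∧ expN z = expN x * expN y := by
  let ratMatrices (E : Submodule ℝ 𝔫) : Submodule ℚ (Matrix (Fin m) (Fin m) ℝ) :=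
    (E.map 𝔫.toSubmodule.subtype).restrictScalars ℚ
  obtain ⟨w, hw, hw_eq⟩ := unipotentLog_exp_mul_exp_sub_add_mem (k := ratMatrices k)
    (k' := ratMatrices k') (ratLowering_mul_le 𝔫) isNilpotent_ratLowering
    (by rintro _ ⟨a, -, rfl⟩; exact mem_loweringMatrices_one a)
    (Submodule.map_mono hk')
    (by rintro _ ⟨a, ha, rfl⟩ _ ⟨b, hb, rfl⟩; exact ⟨_, hlie a ha b hb, rfl⟩)
    ⟨y, hy, rfl⟩ ⟨x, hx, rfl⟩
  have hlog : ((w + (x + y) : 𝔫) : Matrix (Fin m) (Fin m) ℝ) =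
      unipotentLog (IsNilpotent.exp (x : Matrix (Fin m) (Fin m) ℝ) *
        IsNilpotent.exp (y : Matrix (Fin m) (Fin m) ℝ)) := by
    rw [add_comm x y]
    exact eq_sub_iff_add_eq.1 hw_eq
  refine ⟨w + (x + y), add_mem (hk' hw) (add_mem hx hy), by rwa [add_sub_cancel_right], ?_⟩
  refine lieGroup_ext ?_
  rw [coe_expN, hlog, exp_unipotentLog (isNilpotent_of_mem isNilpotent_ratLowering
    (exp_mul_exp_sub_one_mem_ratLowering x y)), ← coe_expN, ← coe_expN]
  rfl

theorem expN_surjective (x : lieGroup 𝔫) : ∃ Y : 𝔫, expN Y = x := by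
  let expRange : Subgroup (lieGroup 𝔫) :=
    { carrier := Set.range expN
      one_mem' := ⟨0, expN_zero⟩
      mul_mem' := by
        rintro _ _ ⟨Y, rfl⟩ ⟨Z, rfl⟩
        obtain ⟨W, -, -, hW⟩ := exists_expN_mul_expN (𝔫 := 𝔫) (k := ⊤) (k' := ⊤) le_rfl
          (fun _ _ _ _ => trivial) (x := Y) (y := Z) trivial trivial
        exact ⟨W, hW⟩
      inv_mem' := by
        rintro _ ⟨Y, rfl⟩
        exact ⟨-Y, expN_neg Y⟩ }
  have hle : lieGroup 𝔫 ≤ expRange.map (lieGroup 𝔫).subtype :=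
    (Subgroup.closure_le _).2 (by rintro _ ⟨Y, rfl⟩; exact ⟨expN Y, ⟨Y, rfl⟩, rfl⟩)
  obtain ⟨_, ⟨Y, rfl⟩, hY⟩ := hle x.2
  exact ⟨Y, Subtype.ext hY⟩

/-- The logarithm `N → 𝔫`. -/
def logN (x : lieGroup 𝔫) : 𝔫 := (expN_surjective x).choose

theorem expN_logN (x : lieGroup 𝔫) : expN (logN x) = x := (expN_surjective x).choose_spec

theorem coe_eq_exp_logN (x : lieGroup 𝔫) : ((x : GL (Fin m) ℝ) : Matrix (Fin m) (Fin m) ℝ) =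
    IsNilpotent.exp (logN x : Matrix (Fin m) (Fin m) ℝ) := by
  rw [← coe_expN, expN_logN]

theorem coe_logN (x : lieGroup 𝔫) : (logN x : Matrix (Fin m) (Fin m) ℝ) =
    unipotentLog ((x : GL (Fin m) ℝ) : Matrix (Fin m) (Fin m) ℝ) := by
  rw [coe_eq_exp_logN, unipotentLog_exp (IsNilMatrixAlgebra.isNilpotent_of_mem _ (logN x).2)]

theorem logN_expN (Y : 𝔫) : logN (expN Y) = Y := by
  refine Subtype.ext ?_
  rw [coe_logN, coe_expN, unipotentLog_exp (IsNilMatrixAlgebra.isNilpotent_of_mem _ Y.2)]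

theorem logN_one : logN (1 : lieGroup 𝔫) = 0 := by rw [← expN_zero, logN_expN]

theorem logN_inv (x : lieGroup 𝔫) : logN x⁻¹ = -logN x := by
  conv_lhs => rw [← expN_logN x, ← expN_neg, logN_expN]

theorem logN_mul_mem {k k' : Submodule ℝ 𝔫} (hk' : k' ≤ k)
    (hlie : ∀ a ∈ k, ∀ b ∈ k, ⁅a, b⁆ ∈ k') {x y : lieGroup 𝔫} (hx : logN x ∈ k)
    (hy : logN y ∈ k) :
    logN (x * y) ∈ k ∧ logN (x * y) - (logN x + logN y) ∈ k' := by
  obtain ⟨z, hz, hz', hz_exp⟩ := exists_expN_mul_expN hk' hlie hx hy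
  rw [expN_logN, expN_logN] at hz_exp
  rw [← hz_exp, logN_expN]
  exact ⟨hz, hz'⟩

theorem continuous_logN : Continuous (logN : lieGroup 𝔫 → 𝔫) := by
  refine continuous_induced_rng.2 ?_
  have hlog (x : lieGroup 𝔫) : (logN x : Matrix (Fin m) (Fin m) ℝ) =
      ∑ i ∈ range (Fintype.card (Fin m)),
        ((-1) ^ i / (i + 1) : ℚ) •
          (((x : GL (Fin m) ℝ) : Matrix (Fin m) (Fin m) ℝ) - 1) ^ (i + 1) := by
    have hx := IsNilpotent.isNilpotent_exp_sub_one
      (IsNilMatrixAlgebra.isNilpotent_of_mem _ (logN x).2)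
    rw [← coe_eq_exp_logN] at hx
    rw [coe_logN, unipotentLog_eq_sum (matrix_pow_card_eq_zero hx)]
  refine Continuous.congr ?_ fun x => (hlog x).symm
  have : Continuous fun x : lieGroup 𝔫 => ((x : GL (Fin m) ℝ) : Matrix (Fin m) (Fin m) ℝ) :=
    Units.continuous_val.comp continuous_subtype_val
  fun_prop

theorem continuous_expN : Continuous (expN : 𝔫 → lieGroup 𝔫) := by
  have hexp : Continuous fun Y : 𝔫 => NormedSpace.exp (Y : Matrix (Fin m) (Fin m) ℝ) := by
    have hsum (Y : 𝔫) : NormedSpace.exp (Y : Matrix (Fin m) (Fin m) ℝ) =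
        ∑ i ∈ range (Fintype.card (Fin m)),
          (i.factorial : ℚ)⁻¹ • (Y : Matrix (Fin m) (Fin m) ℝ) ^ i := by
      have hY := IsNilMatrixAlgebra.isNilpotent_of_mem _ Y.2
      rw [exp_eq_nilpotent_exp hY, IsNilpotent.exp_eq_sum (matrix_pow_card_eq_zero hY)]
    refine Continuous.congr ?_ fun Y => (hsum Y).symm
    fun_prop
  have hexp_neg : Continuous fun Y : 𝔫 => NormedSpace.exp (-(Y : Matrix (Fin m) (Fin m) ℝ)) :=
    hexp.comp (continuous_subtype_val.neg.subtype_mk fun Y => (-Y).2)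
  exact (Units.continuous_iff.2 ⟨hexp, hexp_neg⟩).subtype_mk _

/-- The exponential map is a homeomorphism of `𝔫` onto `N`. -/
def expHomeo : 𝔫 ≃ₜ lieGroup 𝔫 where
  toFun := expN
  invFun := logN
  left_inv := logN_expN
  right_inv := expN_logN
  continuous_toFun := continuous_expN
  continuous_invFun := continuous_logN

/-- `e^{ad Z}`, the adjoint action of `exp Z` on `𝔫`. -/
def adExp (Z : 𝔫) : Module.End ℝ 𝔫 := IsNilpotent.exp (LieAlgebra.ad ℝ 𝔫 Z)

theorem isNilpotent_ad (Z : 𝔫) : IsNilpotent (LieAlgebra.ad ℝ 𝔫 Z) :=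
  LieSubalgebra.isNilpotent_ad_of_isNilpotent_ad 𝔫
    (LieAlgebra.ad_nilpotent_of_nilpotent (IsNilMatrixAlgebra.isNilpotent_of_mem _ Z.2))

theorem adExp_sub_mem {E : Submodule ℝ 𝔫} {Z Y : 𝔫} (hE : ∀ V ∈ E, ⁅Z, V⁆ ∈ E)
    (hY : ⁅Z, Y⁆ ∈ E) : adExp Z Y - Y ∈ E := by
  rw [adExp, exp_apply_sub_self (isNilpotent_ad Z), ← E.sub_mem_iff_left hY]
  exact expSubOneDiv_apply_sub_mem le_rfl hE (isNilpotent_ad Z) hY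

theorem adExp_mem {E : Submodule ℝ 𝔫} {Z Y : 𝔫} (hE : ∀ V ∈ E, ⁅Z, V⁆ ∈ E) (hY : Y ∈ E) :
    adExp Z Y ∈ E :=
  (E.sub_mem_iff_left hY).1 (adExp_sub_mem hE (hE Y hY))

theorem adExp_sub_sub_mem {E E' : Submodule ℝ 𝔫} {Z Y : 𝔫} (hE' : E' ≤ E)
    (hE : ∀ V ∈ E, ⁅Z, V⁆ ∈ E') (hY : ⁅Z, Y⁆ ∈ E) : adExp Z Y - Y - ⁅Z, Y⁆ ∈ E' := by
  rw [adExp, exp_apply_sub_self (isNilpotent_ad Z)]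
  exact expSubOneDiv_apply_sub_mem hE' hE (isNilpotent_ad Z) hY

theorem coe_adExp (Z Y : 𝔫) : (adExp Z Y : Matrix (Fin m) (Fin m) ℝ) =
    IsNilpotent.exp (Z : Matrix (Fin m) (Fin m) ℝ) * Y *
      IsNilpotent.exp (-(Z : Matrix (Fin m) (Fin m) ℝ)) := by
  have hZ := IsNilMatrixAlgebra.isNilpotent_of_mem _ Z.2
  rw [← exp_ad_apply ℝ hZ]
  exact (exp_comp_of_comp_eq (f := 𝔫.toSubmodule.subtype)
    (LieAlgebra.ad_nilpotent_of_nilpotent hZ) (isNilpotent_ad Z) rfl Y).symm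

theorem conj_expN (g : lieGroup 𝔫) (Y : 𝔫) : g * expN Y * g⁻¹ = expN (adExp (logN g) Y) := by
  have hconj : (adExp (logN g) Y : Matrix (Fin m) (Fin m) ℝ) =
      ((g : GL (Fin m) ℝ) : Matrix (Fin m) (Fin m) ℝ) * Y *
        ((g : GL (Fin m) ℝ)⁻¹ : GL (Fin m) ℝ) := by
    rw [coe_adExp, ← coe_eq_exp_logN, ← NegMemClass.coe_neg, ← logN_inv, ← coe_eq_exp_logN]
    rfl
  refine lieGroup_ext (Eq.trans ?_ (congrArg NormedSpace.exp hconj).symm)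
  exact (Matrix.exp_units_conj (g : GL (Fin m) ℝ) _).symm

theorem logN_conj (g x : lieGroup 𝔫) : logN (g * x * g⁻¹) = adExp (logN g) (logN x) := by
  conv_lhs => rw [← expN_logN x, conj_expN, logN_expN]

end MatrixGroup

theorem eq_zero_of_apply_sub_smul_mem {K M : Type*} [Field K] [AddCommGroup M] [Module K M]
    {T : Module.End K M} (hT : IsNilpotent T) {E : Submodule K M} (hE : E ≤ E.comap T) {v : M}
    (hv : v ∉ E) {d : K} (hd : T v - d • v ∈ E) : d = 0 := by
  let S : Module.End K (M ⧸ E) := E.mapQ E T hE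
  have heigen : S.HasEigenvector d (E.mkQ v) := by
    refine Module.End.hasEigenvector_iff.2
      ⟨Module.End.mem_eigenspace_iff.2 ?_, (Submodule.Quotient.mk_eq_zero E).not.2 hv⟩
    exact (Submodule.Quotient.eq E).2 hd
  exact ((Module.End.hasEigenvalue_of_hasEigenvector heigen).isNilpotent_of_isNilpotent
    (Module.End.IsNilpotent.mapQ hE hT)).eq_zero

theorem exists_mem_forall_apply_eq {K V W : Type*} [Field K] [AddCommGroup V] [Module K V]
    [AddCommGroup W] [Module K W] [FiniteDimensional K W] (b : V →ₗ[K] Module.Dual K W)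
    (L : Submodule K V) (E : Submodule K W) {φ : Module.Dual K W}
    (h : ∀ w ∈ E, (∀ z ∈ L, b z w = 0) → φ w = 0) : ∃ z ∈ L, ∀ w ∈ E, φ w = b z w := by
  have hφ : φ ∈ L.map b ⊔ E.dualAnnihilator := by
    rw [← Subspace.dualCoannihilator_dualAnnihilator_eq (W := L.map b ⊔ E.dualAnnihilator),
      Submodule.mem_dualAnnihilator]
    intro w hw
    rw [Submodule.mem_dualCoannihilator] at hw
    refine h w ?_ fun z hz => hw (b z) (Submodule.mem_sup_left ⟨z, hz, rfl⟩)
    rw [← Subspace.dualAnnihilator_dualCoannihilator_eq (W := E),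
      Submodule.mem_dualCoannihilator]
    exact fun ψ hψ => hw ψ (Submodule.mem_sup_right hψ)
  obtain ⟨_, ⟨z, hz, rfl⟩, ψ, hψ, rfl⟩ := Submodule.mem_sup.1 hφ
  refine ⟨z, hz, fun w hw => ?_⟩
  rw [LinearMap.add_apply, (Submodule.mem_dualAnnihilator ψ).1 hψ w hw, add_zero]

theorem exists_lt_not_succ_of_not {P : ℕ → Prop} {n : ℕ} (h0 : P 0) (hn : ¬P n) :
    ∃ i < n, P i ∧ ¬P (i + 1) := by
  by_contra! h
  have hall (i : ℕ) (hi : i ≤ n) : P i := by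
    induction i with
    | zero => exact h0
    | succ i ih => exact h i hi (ih (Nat.le_of_succ_le hi))
  exact hn (hall n le_rfl)

section Polarization

variable {m n : ℕ} {𝔫 : LieSubalgebra ℝ (Matrix (Fin m) (Fin m) ℝ)}
  {X : Module.Basis (Fin n) ℝ 𝔫} {l : Module.Dual ℝ 𝔫}

theorem mem_flag_iff {i : ℕ} {Y : 𝔫} : Y ∈ flag X i ↔ ∀ k : Fin n, i ≤ k → X.repr Y k = 0 := by
  rw [flag, Module.Basis.mem_span_image]
  constructor
  · intro h k hk
    by_contra hYk
    have hki := h (Finsupp.mem_support_iff.2 hYk)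
    simp only [Set.mem_ofPred_eq] at hki
    omega
  · intro h k hk
    by_contra hYk
    simp only [Set.mem_ofPred_eq, not_lt] at hYk
    exact Finsupp.mem_support_iff.1 hk (h k hYk)

theorem flag_mono {i j : ℕ} (h : i ≤ j) : flag X i ≤ flag X j := fun _ hY =>
  mem_flag_iff.2 fun k hk => mem_flag_iff.1 hY k (h.trans hk)

theorem flag_zero : flag X 0 = ⊥ := by
  simp [flag]

theorem flag_eq_top {i : ℕ} (h : n ≤ i) : flag X i = ⊤ := by
  rw [eq_top_iff]
  intro Y _
  exact mem_flag_iff.2 fun k hk => by have := k.2; omega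

theorem basis_mem_flag (k : Fin n) : X k ∈ flag X (k + 1) :=
  Submodule.subset_span ⟨k, by simp, rfl⟩

theorem sub_smul_mem_flag {k : Fin n} {Y : 𝔫} (hY : Y ∈ flag X (k + 1)) :
    Y - X.repr Y k • X k ∈ flag X k := by
  refine mem_flag_iff.2 fun j hj => ?_
  rw [map_sub, map_smul, Module.Basis.repr_self, Finsupp.sub_apply, Finsupp.smul_apply,
    Finsupp.single_apply]
  split_ifs with h
  · subst h; simp
  · have : (k : ℕ) + 1 ≤ j := by
      have : (k : ℕ) ≠ j := fun h' => h (Fin.ext h')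
      omega
    simp [mem_flag_iff.1 hY j this]

theorem repr_eq_zero_iff_mem_flag {k : Fin n} {Y : 𝔫} (hY : Y ∈ flag X (k + 1)) :
    X.repr Y k = 0 ↔ Y ∈ flag X k := by
  constructor
  · intro h
    have := sub_smul_mem_flag hY
    rwa [h, zero_smul, sub_zero] at this
  · intro h
    exact mem_flag_iff.1 h k le_rfl

theorem exists_sub_smul_mem_flag {k : Fin n} {Y Z : 𝔫} (hY : Y ∈ flag X (k + 1))
    (hY' : Y ∉ flag X k) (hZ : Z ∈ flag X (k + 1)) : ∃ c : ℝ, Z - c • Y ∈ flag X k := by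
  have h0 : X.repr Y k ≠ 0 := fun h => hY' ((repr_eq_zero_iff_mem_flag hY).1 h)
  refine ⟨X.repr Z k / X.repr Y k, ?_⟩
  rw [← repr_eq_zero_iff_mem_flag (sub_mem hZ (Submodule.smul_mem _ _ hY)), map_sub, map_smul,
    Finsupp.sub_apply, Finsupp.smul_apply, smul_eq_mul, div_mul_cancel₀ _ h0, sub_self]

theorem repr_lie_basis_self [IsNilMatrixAlgebra 𝔫] (hX : IsStrongMalcev X) (Z : 𝔫) (k : Fin n) :
    X.repr ⁅Z, X k⁆ k = 0 := by
  refine eq_zero_of_apply_sub_smul_mem (isNilpotent_ad Z) (E := flag X k) (fun Y hY => hX k Z Y hY)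
    (fun hk => ?_) (sub_smul_mem_flag (hX (k + 1) Z (X k) (basis_mem_flag k)))
  simpa using mem_flag_iff.1 hk k le_rfl

theorem lie_mem_flag [IsNilMatrixAlgebra 𝔫] (hX : IsStrongMalcev X) {i : ℕ} (Z : 𝔫) {Y : 𝔫}
    (hY : Y ∈ flag X (i + 1)) : ⁅Z, Y⁆ ∈ flag X i := by
  rcases le_or_gt n i with hi | hi
  · rw [flag_eq_top hi]
    trivial
  let k : Fin n := ⟨i, hi⟩
  have hbasis : ⁅Z, X k⁆ ∈ flag X k :=
    (repr_eq_zero_iff_mem_flag (hX (k + 1) Z _ (basis_mem_flag k))).1 (repr_lie_basis_self hX Z k)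
  have hrest : ⁅Z, Y - X.repr Y k • X k⁆ ∈ flag X k := hX k Z _ (sub_smul_mem_flag (k := k) hY)
  rw [lie_sub, lie_smul] at hrest
  exact (Submodule.sub_mem_iff_left _ (Submodule.smul_mem _ _ hbasis)).1 hrest

theorem form_swap (l : Module.Dual ℝ 𝔫) (Y Z : 𝔫) : l ⁅Y, Z⁆ = -l ⁅Z, Y⁆ := by
  rw [← lie_skew, map_neg]

/-- The chain `𝔫 = 𝔥₀ ⊇ 𝔥₁ ⊇ ⋯ ⊇ 𝔥ₙ = 𝔭(λ)` of subalgebras: `𝔥ᵢ₊₁` is the set of vectors of `𝔥ᵢ`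
orthogonal to `𝔥ᵢ ∩ 𝔫ᵢ₊₁` with respect to `(Y, Z) ↦ λ[Y, Z]`. -/
def orthChain (X : Module.Basis (Fin n) ℝ 𝔫) (l : Module.Dual ℝ 𝔫) : ℕ → Submodule ℝ 𝔫
  | 0 => ⊤
  | i + 1 =>
    { carrier := {Z | Z ∈ orthChain X l i ∧ ∀ Y ∈ orthChain X l i ⊓ flag X (i + 1), l ⁅Z, Y⁆ = 0}
      zero_mem' := ⟨Submodule.zero_mem _, fun Y _ => by simp⟩
      add_mem' := fun {a b} ha hb => ⟨add_mem ha.1 hb.1, fun Y hY => by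
        rw [add_lie, map_add, ha.2 Y hY, hb.2 Y hY, add_zero]⟩
      smul_mem' := fun c a ha => ⟨Submodule.smul_mem _ c ha.1, fun Y hY => by
        rw [smul_lie, map_smul, ha.2 Y hY, smul_zero]⟩ }

theorem orthChain_succ_le (i : ℕ) : orthChain X l (i + 1) ≤ orthChain X l i := fun _ h => h.1

theorem orthChain_antitone : Antitone (orthChain X l) := antitone_nat_of_succ_le orthChain_succ_le

theorem orthChain_orth {i : ℕ} {Z Y : 𝔫} (hZ : Z ∈ orthChain X l i)
    (hY : Y ∈ orthChain X l i ⊓ flag X i) : l ⁅Z, Y⁆ = 0 := by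
  rcases i with _ | i
  · rw [flag_zero, inf_bot_eq, Submodule.mem_bot] at hY
    simp [hY]
  · exact hZ.2 Y ⟨hY.1.1, hY.2⟩

theorem lie_mem_orthChain_succ [IsNilMatrixAlgebra 𝔫] (hX : IsStrongMalcev X) {i : ℕ} {Z W : 𝔫}
    (hZ : Z ∈ orthChain X l i) (hW : W ∈ orthChain X l i) : ⁅Z, W⁆ ∈ orthChain X l (i + 1) := by
  have hlie : ∀ i, (∀ Z ∈ orthChain X l i, ∀ W ∈ orthChain X l i, ⁅Z, W⁆ ∈ orthChain X l i) →
      ∀ Z ∈ orthChain X l i, ∀ W ∈ orthChain X l i, ⁅Z, W⁆ ∈ orthChain X l (i + 1) := by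
    intro i hi Z hZ W hW
    refine ⟨hi Z hZ W hW, fun Y hY => ?_⟩
    rw [lie_lie, map_sub,
      orthChain_orth hZ ⟨hi W hW Y hY.1, lie_mem_flag hX W hY.2⟩,
      orthChain_orth hW ⟨hi Z hZ Y hY.1, lie_mem_flag hX Z hY.2⟩, sub_zero]
  refine hlie i ?_ Z hZ W hW
  clear hZ hW
  induction i with
  | zero => intro _ _ _ _; trivial
  | succ i ih =>
    intro Z hZ W hW
    exact hlie i ih Z hZ.1 W hW.1

theorem lie_mem_orthChain [IsNilMatrixAlgebra 𝔫] (hX : IsStrongMalcev X) {i : ℕ} {Z W : 𝔫}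
    (hZ : Z ∈ orthChain X l i) (hW : W ∈ orthChain X l i) : ⁅Z, W⁆ ∈ orthChain X l i :=
  (lie_mem_orthChain_succ hX hZ hW).1

theorem orthChain_inf_flag_le (i : ℕ) : orthChain X l i ⊓ flag X i ≤ orthChain X l (i + 1) :=
  fun Y hY => ⟨hY.1, fun Z hZ => by rw [form_swap, orthChain_orth hZ.1 hY, neg_zero]⟩

theorem orthChain_inf_flag_succ_le {i : ℕ} (hi : i < n) :
    orthChain X l i ⊓ flag X (i + 1) ≤ orthChain X l (i + 1) := by
  intro Y hY
  refine ⟨hY.1, fun Z hZ => ?_⟩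
  by_cases h : Z ∈ flag X i
  · exact orthChain_orth hY.1 ⟨hZ.1, h⟩
  · obtain ⟨c, hc⟩ := exists_sub_smul_mem_flag (k := ⟨i, hi⟩) hZ.2 h hY.2
    have := orthChain_orth hZ.1 ⟨sub_mem hY.1 (Submodule.smul_mem _ c hZ.1), hc⟩
    rw [lie_sub, lie_smul, lie_self, smul_zero, sub_zero, form_swap, neg_eq_zero] at this
    exact this

theorem mem_orthChain_succ_of_form_eq_zero {i : ℕ} (hi : i < n) {W Y Z : 𝔫}
    (hW : W ∈ orthChain X l i) (hY : Y ∈ orthChain X l i ⊓ flag X (i + 1)) (hWY : l ⁅W, Y⁆ ≠ 0)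
    (hZ : Z ∈ orthChain X l i) (hZY : l ⁅Z, Y⁆ = 0) : Z ∈ orthChain X l (i + 1) := by
  refine ⟨hZ, fun Y' hY' => ?_⟩
  have h : Y ∉ flag X i := fun h => hWY (orthChain_orth hW ⟨hY.1, h⟩)
  obtain ⟨c, hc⟩ := exists_sub_smul_mem_flag (k := ⟨i, hi⟩) hY.2 h hY'.2
  have := orthChain_orth hZ ⟨sub_mem hY'.1 (Submodule.smul_mem _ c hY.1), hc⟩
  rw [lie_sub, lie_smul, map_sub, map_smul, hZY, smul_zero, sub_zero] at this
  exact this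

theorem exists_form_ne_zero {i : ℕ} {W : 𝔫} (hW : W ∈ orthChain X l i)
    (hW' : W ∉ orthChain X l (i + 1)) : ∃ Y ∈ orthChain X l i ⊓ flag X (i + 1), l ⁅W, Y⁆ ≠ 0 := by
  by_contra! h
  exact hW' ⟨hW, h⟩

theorem orthChain_inf_flag_le_of_le {i j : ℕ} (hij : i ≤ j) :
    orthChain X l i ⊓ flag X i ≤ orthChain X l j ⊓ flag X j := by
  induction j, hij using Nat.le_induction with
  | base => exact le_rfl
  | succ j _ ih =>
    exact fun Y hY => ⟨orthChain_inf_flag_le j (ih hY), flag_mono (Nat.le_succ j) (ih hY).2⟩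

theorem mem_orthChain_of_orth {i : ℕ} (hi : i ≤ n) {W : 𝔫}
    (hW : ∀ Y ∈ orthChain X l i ⊓ flag X i, l ⁅W, Y⁆ = 0) : W ∈ orthChain X l i := by
  have hmem : ∀ j ≤ i, W ∈ orthChain X l j := by
    intro j
    induction j with
    | zero => intro _; trivial
    | succ j ih =>
      intro hj
      refine ⟨ih (by omega), fun Y hY => hW Y ?_⟩
      exact orthChain_inf_flag_le_of_le hj
        ⟨orthChain_inf_flag_succ_le (by omega) hY, hY.2⟩
  exact hmem i le_rfl

theorem polarization_le_orthChain {i : ℕ} : polarization X l ≤ orthChain X l i := by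
  refine iSup_le fun k => ?_
  intro Y hY
  induction i with
  | zero => trivial
  | succ i ih =>
    by_cases h : i + 1 ≤ k + 1
    · refine ⟨ih, fun Z hZ => ?_⟩
      rw [form_swap, hY.2 Z (flag_mono h hZ.2), neg_zero]
    · exact orthChain_inf_flag_le i ⟨ih, flag_mono (by omega) hY.1⟩

theorem exists_forall_form_sub_eq_zero {i : ℕ} (hi : i ≤ n) {Y : 𝔫} (hY : Y ∈ orthChain X l i) :
    ∃ e ∈ orthChain X l i ⊓ flag X i, ∀ Z ∈ flag X i, l ⁅Y - e, Z⁆ = 0 := by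
  have : FiniteDimensional ℝ 𝔫 := X.finiteDimensional_of_finite
  let form : 𝔫 →ₗ[ℝ] Module.Dual ℝ 𝔫 := (LieAlgebra.ad ℝ 𝔫).toLinearMap.compr₂ l
  obtain ⟨e, he, hYe⟩ := exists_mem_forall_apply_eq form (orthChain X l i ⊓ flag X i) (flag X i)
    (φ := form Y) fun Z hZ horth => orthChain_orth hY ⟨mem_orthChain_of_orth hi fun V hV => by
      rw [form_swap, show l ⁅V, Z⁆ = 0 from horth V hV, neg_zero], hZ⟩
  refine ⟨e, he, fun Z hZ => ?_⟩
  rw [sub_lie, map_sub, sub_eq_zero]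
  exact hYe Z hZ

/-- A vector `Y` of `𝔥ᵢ ∩ 𝔫ᵢ₊₁` outside `𝔫ᵢ` is corrected by an element of `𝔥ᵢ ∩ 𝔫ᵢ` so as to
become orthogonal to `𝔫ᵢ`; being orthogonal to itself, it is then in the radical `𝔫ᵢ₊₁(λ)`. -/
theorem orthChain_inf_flag_le_polarization {i : ℕ} (hi : i ≤ n) :
    orthChain X l i ⊓ flag X i ≤ polarization X l := by
  induction i with
  | zero => rw [flag_zero, inf_bot_eq]; exact bot_le
  | succ i ih =>
    intro Y hY
    have hi' : i ≤ n := Nat.le_of_succ_le hi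
    have hYi : Y ∈ orthChain X l i := hY.1.1
    by_cases hYf : Y ∈ flag X i
    · exact ih hi' ⟨hYi, hYf⟩
    obtain ⟨e, he, horth⟩ := exists_forall_form_sub_eq_zero hi' hYi
    have hself : l ⁅Y - e, Y⁆ = 0 := by
      rw [sub_lie, lie_self, zero_sub, map_neg, form_swap, orthChain_orth hYi he, neg_zero,
        neg_zero]
    have hrad : Y - e ∈ radical X l (i + 1) := by
      refine ⟨sub_mem hY.2 (flag_mono (Nat.le_succ i) he.2), fun Z hZ => ?_⟩
      obtain ⟨c, hc⟩ := exists_sub_smul_mem_flag (k := ⟨i, hi⟩) hY.2 hYf hZ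
      have hZc := horth _ hc
      rw [lie_sub, lie_smul, map_sub, map_smul, hself, smul_zero, sub_zero] at hZc
      rw [form_swap, hZc, neg_zero]
    have hpol : Y - e ∈ polarization X l :=
      le_iSup (fun k : Fin n => radical X l ((k : ℕ) + 1)) ⟨i, hi⟩ hrad
    exact (Submodule.sub_mem_iff_left _ (ih hi' he)).1 hpol

theorem orthChain_eq_polarization : orthChain X l n = polarization X l := by
  refine le_antisymm ?_ polarization_le_orthChain
  have := orthChain_inf_flag_le_polarization (X := X) (l := l) le_rfl
  rwa [flag_eq_top le_rfl, inf_top_eq] at this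

theorem lie_mem_polarization [IsNilMatrixAlgebra 𝔫] (hX : IsStrongMalcev X) {Z W : 𝔫}
    (hZ : Z ∈ polarization X l) (hW : W ∈ polarization X l) : ⁅Z, W⁆ ∈ polarization X l := by
  rw [← orthChain_eq_polarization] at *
  exact lie_mem_orthChain hX hZ hW

theorem form_eq_zero_of_mem_polarization {Z W : 𝔫} (hZ : Z ∈ polarization X l)
    (hW : W ∈ polarization X l) : l ⁅Z, W⁆ = 0 := by
  rw [← orthChain_eq_polarization] at *
  exact orthChain_orth hZ ⟨hW, by rw [flag_eq_top le_rfl]; trivial⟩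

/-- `W` spans `𝔥ᵢ` modulo `𝔥ᵢ₊₁`, and its leading term `X_j` is the least possible among the
vectors of `𝔥ᵢ` outside `𝔥ᵢ₊₁`. -/
structure IsAdapted (X : Module.Basis (Fin n) ℝ 𝔫) (l : Module.Dual ℝ 𝔫) (i : ℕ) (j : Fin n)
    (W : 𝔫) : Prop where
  mem : W ∈ orthChain X l i
  notMem : W ∉ orthChain X l (i + 1)
  sub_basis_mem : W - X j ∈ flag X j
  flag_inf_le : flag X j ⊓ orthChain X l i ≤ orthChain X l (i + 1)

theorem IsAdapted.mem_flag {i : ℕ} {j : Fin n} {W : 𝔫} (h : IsAdapted X l i j W) :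
    W ∈ flag X (j + 1) :=
  (Submodule.sub_mem_iff_left _ (basis_mem_flag j)).1
    (flag_mono (Nat.le_succ j) h.sub_basis_mem)

theorem IsAdapted.notMem_of_sub_mem {i : ℕ} {j : Fin n} {W p : 𝔫} (h : IsAdapted X l i j W)
    (hp : p - X j ∈ flag X j) : p ∉ orthChain X l (i + 1) := fun hp' => by
  have hWp : W - p ∈ flag X j := by
    simpa only [sub_sub_sub_cancel_right] using sub_mem h.sub_basis_mem hp
  exact h.notMem ((Submodule.sub_mem_iff_left _ hp').1
    (h.flag_inf_le ⟨hWp, sub_mem h.mem hp'.1⟩))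

theorem mem_jumpSet {k : Fin n} : k ∈ jumpSet X l ↔ X k ∉ flag X k ⊔ polarization X l := by
  simp [jumpSet]

theorem IsAdapted.mem_jumpSet {i : ℕ} {j : Fin n} {W : 𝔫} (h : IsAdapted X l i j W) :
    j ∈ jumpSet X l := WaveletRep.mem_jumpSet.2 fun hmem => by
  obtain ⟨v, hv, p, hp, hvp⟩ := Submodule.mem_sup.1 hmem
  refine h.notMem_of_sub_mem ?_ (polarization_le_orthChain hp)
  rw [← hvp, sub_add_cancel_right]
  exact neg_mem hv

theorem exists_isAdapted_of_not_le {i : ℕ} (h : ¬orthChain X l i ≤ orthChain X l (i + 1)) :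
    ∃ j W, IsAdapted X l i j W := by
  have htop : ¬flag X n ⊓ orthChain X l i ≤ orthChain X l (i + 1) := by
    rwa [flag_eq_top le_rfl, top_inf_eq]
  obtain ⟨j, hj, hmin, hjump⟩ := exists_lt_not_succ_of_not (n := n)
    (P := fun j => flag X j ⊓ orthChain X l i ≤ orthChain X l (i + 1))
    (by rw [flag_zero, bot_inf_eq]; exact bot_le) htop
  let k : Fin n := ⟨j, hj⟩
  obtain ⟨V, hV, hV'⟩ := SetLike.not_le_iff_exists.1 hjump
  have hc : X.repr V k ≠ 0 := fun h0 =>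
    hV' (hmin ⟨(repr_eq_zero_iff_mem_flag (k := k) hV.1).1 h0, hV.2⟩)
  refine ⟨k, (X.repr V k)⁻¹ • V, Submodule.smul_mem _ _ hV.2, fun h0 => hV' ?_, ?_, hmin⟩
  · exact (Submodule.smul_mem_iff _ (inv_ne_zero hc)).1 h0
  · have hsub := Submodule.smul_mem _ (X.repr V k)⁻¹ (sub_smul_mem_flag (k := k) hV.1)
    rwa [smul_sub, smul_smul, inv_mul_cancel₀ hc, one_smul] at hsub

theorem exists_isAdapted_of_mem_jumpSet {j : Fin n} (hj : j ∈ jumpSet X l) :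
    ∃ i < n, ∃ W, IsAdapted X l i j W := by
  have hn : ¬∃ W ∈ orthChain X l n, W - X j ∈ flag X j := by
    rintro ⟨W, hW, hWj⟩
    rw [orthChain_eq_polarization] at hW
    refine mem_jumpSet.1 hj ?_
    have hsum := Submodule.add_mem_sup (neg_mem hWj) hW
    rwa [neg_sub, sub_add_cancel] at hsum
  obtain ⟨i, hi, ⟨W, hW, hWj⟩, hjump⟩ := exists_lt_not_succ_of_not (n := n)
    (P := fun i => ∃ W ∈ orthChain X l i, W - X j ∈ flag X j) ⟨X j, trivial, by simp⟩ hn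
  have hW' : W ∉ orthChain X l (i + 1) := fun h => hjump ⟨W, h, hWj⟩
  refine ⟨i, hi, W, hW, hW', hWj, fun v hv => ?_⟩
  by_contra hv'
  obtain ⟨Y, hY, hWY⟩ := exists_form_ne_zero hW hW'
  have hvY : l ⁅v, Y⁆ ≠ 0 := fun h =>
    hv' (mem_orthChain_succ_of_form_eq_zero hi hW hY hWY hv.2 h)
  refine hjump ⟨W - (l ⁅W, Y⁆ / l ⁅v, Y⁆) • v, ?_, ?_⟩
  · refine mem_orthChain_succ_of_form_eq_zero hi hW hY hWY
      (sub_mem hW (Submodule.smul_mem _ _ hv.2)) ?_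
    rw [sub_lie, smul_lie, map_sub, map_smul, smul_eq_mul, div_mul_cancel₀ _ hvY, sub_self]
  · rw [sub_right_comm]
    exact sub_mem hWj (Submodule.smul_mem _ _ hv.1)

theorem IsAdapted.index_le {i : ℕ} {j j' : Fin n} {W W' : 𝔫} (h : IsAdapted X l i j W)
    (h' : IsAdapted X l i j' W') : j' ≤ j :=
  not_lt.1 fun hlt => h.notMem
    (h'.flag_inf_le ⟨flag_mono (Nat.succ_le_of_lt hlt) h.mem_flag, h.mem⟩)

theorem IsAdapted.index_unique {i : ℕ} {j j' : Fin n} {W W' : 𝔫} (h : IsAdapted X l i j W)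
    (h' : IsAdapted X l i j' W') : j = j' :=
  le_antisymm (h'.index_le h) (h.index_le h')

theorem IsAdapted.level_le {i i' : ℕ} {j : Fin n} {W W' : 𝔫} (h : IsAdapted X l i j W)
    (h' : IsAdapted X l i' j W') : i' ≤ i :=
  not_lt.1 fun hlt => h.notMem_of_sub_mem h'.sub_basis_mem (orthChain_antitone hlt h'.mem)

theorem IsAdapted.level_unique {i i' : ℕ} {j : Fin n} {W W' : 𝔫} (h : IsAdapted X l i j W)
    (h' : IsAdapted X l i' j W') : i = i' :=
  le_antisymm (h'.level_le h) (h.level_le h')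

end Polarization

section Coordinates

variable {m n : ℕ} {𝔫 : LieSubalgebra ℝ (Matrix (Fin m) (Fin m) ℝ)}
  {X : Module.Basis (Fin n) ℝ 𝔫} {l : Module.Dual ℝ 𝔫}

/-- `exp (t_k X_k) ⋯ exp (t_n X_n)`: the factors of `malcevCoord X t` from the index `k` on. -/
def tailProd (X : Module.Basis (Fin n) ℝ 𝔫) (t : Fin n → ℝ) (k : ℕ) : lieGroup 𝔫 :=
  (((List.finRange n).drop k).map fun i => expN (t i • X i)).prod

theorem tailProd_of_le (t : Fin n → ℝ) {k : ℕ} (hk : n ≤ k) : tailProd X t k = 1 := by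
  rw [tailProd, List.drop_eq_nil_of_le (by simpa using hk)]
  rfl

theorem tailProd_eq_mul (t : Fin n → ℝ) (k : Fin n) :
    tailProd X t k = expN (t k • X k) * tailProd X t (k + 1) := by
  rw [tailProd, List.drop_eq_getElem_cons (by simp)]
  simp [tailProd]

theorem descending_induction {P : ℕ → Prop} (hn : ∀ k, n ≤ k → P k)
    (hs : ∀ k : Fin n, P (k + 1) → P k) (k : ℕ) : P k := by
  by_cases hk : n ≤ k
  · exact hn k hk
  · exact Nat.decreasingInduction (motive := fun k _ => P k) (n := n)
      (fun k hk h => hs ⟨k, hk⟩ h) (hn n le_rfl) (by omega)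

theorem tailProd_congr {t t' : Fin n → ℝ} (k : ℕ) (h : ∀ i : Fin n, k ≤ i → t i = t' i) :
    tailProd X t k = tailProd X t' k := by
  induction k using descending_induction (n := n) with
  | hn k hk => rw [tailProd_of_le t hk, tailProd_of_le t' hk]
  | hs k ih =>
    rw [tailProd_eq_mul, tailProd_eq_mul, h k le_rfl, ih fun i hi => h i (by omega)]

theorem tailProd_update (t : Fin n → ℝ) (k : Fin n) (s : ℝ) :
    tailProd X (Function.update t k s) k = expN (s • X k) * tailProd X t (k + 1) := by
  rw [tailProd_eq_mul, Function.update_self]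
  congr 1
  refine tailProd_congr _ fun i hi => Function.update_of_ne ?_ _ _
  rintro rfl
  omega

theorem polarization_inf_flag_le {k : Fin n} (hk : k ∈ jumpSet X l) {Y : 𝔫}
    (hY : Y ∈ polarization X l) (hYk : Y ∈ flag X (k + 1)) : Y ∈ flag X k := by
  by_contra h
  obtain ⟨c, hc⟩ := exists_sub_smul_mem_flag hYk h (basis_mem_flag k)
  refine mem_jumpSet.1 hk ?_
  have := Submodule.add_mem_sup hc (Submodule.smul_mem _ c hY)
  rwa [sub_add_cancel] at this

theorem exists_mem_polarization_of_notMem_jumpSet {k : Fin n} (hk : k ∉ jumpSet X l) :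
    ∃ q ∈ polarization X l, q ∈ flag X (k + 1) ∧ X.repr q k = 1 := by
  rw [mem_jumpSet, not_not] at hk
  obtain ⟨v, hv, q, hq, hvq⟩ := Submodule.mem_sup.1 hk
  obtain rfl : q = X k - v := eq_sub_of_add_eq' hvq
  refine ⟨_, hq, sub_mem (basis_mem_flag k) (flag_mono (Nat.le_succ k) hv), ?_⟩
  simp [mem_flag_iff.1 hv k le_rfl]

open Classical in
/-- The extension by zero of a vector of coordinates indexed by the jump set. -/
def extendJump (X : Module.Basis (Fin n) ℝ 𝔫) (l : Module.Dual ℝ 𝔫) (t : jumpSet X l → ℝ) :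
    Fin n → ℝ := fun k => if h : k ∈ jumpSet X l then t ⟨k, h⟩ else 0

theorem crossSection_eq (t : jumpSet X l → ℝ) :
    crossSection X l t = malcevCoord X (extendJump X l t) := rfl

theorem extendJump_apply (t : jumpSet X l → ℝ) (k : jumpSet X l) : extendJump X l t k = t k := by
  simp [extendJump]

theorem extendJump_of_notMem (t : jumpSet X l → ℝ) : ∀ i ∉ jumpSet X l, extendJump X l t i = 0 :=
  fun i hi => by simp [extendJump, hi]

theorem extendJump_restrict {t : Fin n → ℝ} (ht : ∀ i ∉ jumpSet X l, t i = 0) :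
    extendJump X l (fun k => t k) = t := by
  ext k
  by_cases hk : k ∈ jumpSet X l
  · simp [extendJump, hk]
  · simp [extendJump, hk, ht k hk]

theorem continuous_dual (f : Module.Dual ℝ 𝔫) : Continuous f :=
  LinearMap.continuous_of_finiteDimensional (E := 𝔫.toSubmodule) f

variable [IsNilMatrixAlgebra 𝔫]

theorem continuous_expN_smul (Y : 𝔫) : Continuous fun s : ℝ => expN (s • Y) := by
  refine continuous_expN.comp ?_
  exact (continuous_id.smul continuous_const).subtype_mk fun s => (s • Y).2

theorem continuous_tailProd (k : ℕ) : Continuous fun t : Fin n → ℝ => tailProd X t k := by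
  induction k using descending_induction (n := n) with
  | hn k hk => simp only [tailProd_of_le _ hk]; exact continuous_const
  | hs k ih =>
    simp only [tailProd_eq_mul]
    exact ((continuous_expN_smul (X k)).comp (continuous_apply k)).mul ih

theorem continuous_crossSection : Continuous (crossSection X l) := by
  refine (continuous_tailProd (X := X) 0).comp (continuous_pi fun k => ?_)
  by_cases h : k ∈ jumpSet X l
  · simpa [h] using continuous_apply _
  · simpa [h] using continuous_const

/-- The coefficient of `X_k` in the logarithm. -/
def lead (X : Module.Basis (Fin n) ℝ 𝔫) (k : Fin n) (x : lieGroup 𝔫) : ℝ := X.repr (logN x) k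

theorem continuous_lead (k : Fin n) : Continuous (lead X k) :=
  (continuous_dual (X.coord k)).comp continuous_logN

/-- The normal subgroup `exp 𝔫ᵢ`, as a set. -/
def level (X : Module.Basis (Fin n) ℝ 𝔫) (i : ℕ) : Set (lieGroup 𝔫) := {x | logN x ∈ flag X i}

theorem level_mono {i j : ℕ} (h : i ≤ j) : level X i ⊆ level X j := fun _ hx => flag_mono h hx

theorem one_mem_level (i : ℕ) : (1 : lieGroup 𝔫) ∈ level X i := by
  change logN 1 ∈ flag X i
  rw [logN_one]
  exact zero_mem _

theorem eq_one_of_mem_level_zero {x : lieGroup 𝔫} (hx : x ∈ level X 0) : x = 1 := by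
  change logN x ∈ flag X 0 at hx
  rw [flag_zero, Submodule.mem_bot] at hx
  rw [← expN_logN x, hx, expN_zero]

theorem mem_level_of_le {i : ℕ} (hi : n ≤ i) (x : lieGroup 𝔫) : x ∈ level X i := by
  change logN x ∈ flag X i
  rw [flag_eq_top hi]
  trivial

theorem expN_mem_level {i : ℕ} {Y : 𝔫} (hY : Y ∈ flag X i) : expN Y ∈ level X i := by
  change logN (expN Y) ∈ flag X i
  rwa [logN_expN]

theorem lead_expN (k : Fin n) (Y : 𝔫) : lead X k (expN Y) = X.repr Y k := by rw [lead, logN_expN]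

theorem lead_expN_smul_basis (k : Fin n) (s : ℝ) : lead X k (expN (s • X k)) = s := by
  rw [lead_expN, map_smul, Module.Basis.repr_self]
  simp

theorem inv_mem_level {i : ℕ} {x : lieGroup 𝔫} (hx : x ∈ level X i) : x⁻¹ ∈ level X i := by
  change logN x⁻¹ ∈ flag X i
  rw [logN_inv]
  exact neg_mem hx

theorem lead_inv (k : Fin n) (x : lieGroup 𝔫) : lead X k x⁻¹ = -lead X k x := by
  rw [lead, logN_inv, map_neg]
  rfl

theorem mem_level_iff_lead_eq_zero {k : Fin n} {x : lieGroup 𝔫} (hx : x ∈ level X (k + 1)) :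
    x ∈ level X k ↔ lead X k x = 0 := (repr_eq_zero_iff_mem_flag hx).symm

theorem lead_eq_zero {k : Fin n} {x : lieGroup 𝔫} (hx : x ∈ level X k) : lead X k x = 0 :=
  mem_flag_iff.1 hx k le_rfl

theorem mul_mem_level (hX : IsStrongMalcev X) {i : ℕ} {x y : lieGroup 𝔫} (hx : x ∈ level X i)
    (hy : y ∈ level X i) : x * y ∈ level X i :=
  (logN_mul_mem (k := flag X i) le_rfl (fun a _ b hb => hX i a b hb) hx hy).1

theorem lead_mul (hX : IsStrongMalcev X) {k : Fin n} {x y : lieGroup 𝔫}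
    (hx : x ∈ level X (k + 1)) (hy : y ∈ level X (k + 1)) :
    lead X k (x * y) = lead X k x + lead X k y := by
  have := (logN_mul_mem (k := flag X (k + 1)) (k' := flag X k) (flag_mono (Nat.le_succ k))
    (fun a _ b hb => lie_mem_flag hX a hb) hx hy).2
  have := mem_flag_iff.1 this k le_rfl
  rw [map_sub, map_add, Finsupp.sub_apply, Finsupp.add_apply, sub_eq_zero] at this
  exact this

theorem mul_expN_mem_level (hX : IsStrongMalcev X) {k : Fin n} {x : lieGroup 𝔫}
    (hx : x ∈ level X k) (s : ℝ) : x * expN (s • X k) ∈ level X (k + 1) :=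
  mul_mem_level hX (level_mono (Nat.le_succ k) hx)
    (expN_mem_level (Submodule.smul_mem _ _ (basis_mem_flag k)))

theorem lead_mul_expN (hX : IsStrongMalcev X) {k : Fin n} {x : lieGroup 𝔫} (hx : x ∈ level X k)
    (s : ℝ) : lead X k (x * expN (s • X k)) = s := by
  rw [lead_mul hX (level_mono (Nat.le_succ k) hx)
    (expN_mem_level (Submodule.smul_mem _ _ (basis_mem_flag k))), lead_eq_zero hx,
    lead_expN_smul_basis, zero_add]

theorem mul_mem_level_of_lead_eq_neg (hX : IsStrongMalcev X) {k : Fin n} {x y : lieGroup 𝔫}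
    (hx : x ∈ level X (k + 1)) (hy : y ∈ level X (k + 1)) (h : lead X k y = -lead X k x) :
    x * y ∈ level X k := by
  rw [mem_level_iff_lead_eq_zero (mul_mem_level hX hx hy), lead_mul hX hx hy, h, add_neg_cancel]

theorem conj_mem_level (hX : IsStrongMalcev X) {i : ℕ} (g : lieGroup 𝔫) {x : lieGroup 𝔫}
    (hx : x ∈ level X i) : g * x * g⁻¹ ∈ level X i := by
  change logN _ ∈ flag X i
  rw [logN_conj]
  exact adExp_mem (fun V hV => hX i _ V hV) hx

theorem lead_conj (hX : IsStrongMalcev X) {k : Fin n} (g : lieGroup 𝔫) {x : lieGroup 𝔫}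
    (hx : x ∈ level X (k + 1)) : lead X k (g * x * g⁻¹) = lead X k x := by
  have := adExp_sub_mem (E := flag X k) (Z := logN g) (Y := logN x) (fun V hV => hX k _ V hV)
    (lie_mem_flag hX _ hx)
  have := mem_flag_iff.1 this k le_rfl
  rw [map_sub, Finsupp.sub_apply, sub_eq_zero] at this
  rw [lead, logN_conj, this, lead]

/-- The group `P(λ) = exp 𝔭(λ)`. -/
def polGroup (hX : IsStrongMalcev X) (l : Module.Dual ℝ 𝔫) : Subgroup (lieGroup 𝔫) where
  carrier := {x | logN x ∈ polarization X l}
  one_mem' := by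
    change logN (1 : lieGroup 𝔫) ∈ polarization X l
    rw [logN_one]
    exact zero_mem _
  mul_mem' := fun {x y} hx hy => (logN_mul_mem (k := polarization X l) le_rfl
    (fun a ha b hb => lie_mem_polarization hX ha hb) hx hy).1
  inv_mem' := fun {x} hx => by
    change logN x⁻¹ ∈ polarization X l
    rw [logN_inv]
    exact neg_mem hx

theorem mem_polGroup {hX : IsStrongMalcev X} {x : lieGroup 𝔫} :
    x ∈ polGroup hX l ↔ logN x ∈ polarization X l := Iff.rfl

theorem expN_mem_polGroup (hX : IsStrongMalcev X) {Y : 𝔫} (hY : Y ∈ polarization X l) :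
    expN Y ∈ polGroup hX l := by rwa [mem_polGroup, logN_expN]

theorem form_logN_mul (hX : IsStrongMalcev X) {x y : lieGroup 𝔫} (hx : x ∈ polGroup hX l)
    (hy : y ∈ polGroup hX l) : l (logN (x * y)) = l (logN x) + l (logN y) := by
  have := (logN_mul_mem (k := polarization X l) (k' := polarization X l ⊓ LinearMap.ker l)
    inf_le_left (fun a ha b hb => ⟨lie_mem_polarization hX ha hb,
      LinearMap.mem_ker.2 (form_eq_zero_of_mem_polarization ha hb)⟩) hx hy).2.2
  have := LinearMap.mem_ker.1 this
  rwa [map_sub, map_add, sub_eq_zero] at this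

theorem malcevCoord_eq_mul_tailProd (hX : IsStrongMalcev X) (t : Fin n → ℝ) (k : ℕ) (hk : k ≤ n) :
    ∃ a ∈ level X k, malcevCoord X t = a * tailProd X t k := by
  induction k with
  | zero => exact ⟨1, one_mem_level 0, by rw [one_mul]; rfl⟩
  | succ k ih =>
    obtain ⟨a, ha, h⟩ := ih (by omega)
    refine ⟨a * expN (t ⟨k, hk⟩ • X ⟨k, hk⟩), mul_mem_level hX (level_mono (Nat.le_succ k) ha)
      (expN_mem_level (Submodule.smul_mem _ _ (basis_mem_flag ⟨k, hk⟩))), ?_⟩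
    rw [h, mul_assoc, tailProd_eq_mul t ⟨k, hk⟩]

theorem coord_unique_of_mem_jumpSet (hX : IsStrongMalcev X) {k : Fin n} (hk : k ∈ jumpSet X l)
    {a a' p p' C : lieGroup 𝔫} {s s' : ℝ} (ha : a ∈ level X k) (ha' : a' ∈ level X k)
    (hp : p ∈ polGroup hX l) (hp' : p' ∈ polGroup hX l)
    (h : a * expN (s • X k) * C * p = a' * expN (s' • X k) * C * p') : s = s' := by
  set b := (a' * expN (s' • X k))⁻¹ * (a * expN (s • X k)) with hb
  have hconj : C⁻¹ * b * C⁻¹⁻¹ = p' * p⁻¹ := by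
    rw [eq_mul_inv_iff_mul_eq, hb, inv_inv, ← mul_right_inj (a' * expN (s' • X k) * C)]
    calc a' * expN (s' • X k) * C * (C⁻¹ * ((a' * expN (s' • X k))⁻¹ * (a * expN (s • X k))) * C *
          p) = a * expN (s • X k) * C * p := by group
      _ = a' * expN (s' • X k) * C * p' := h
  have hinv := inv_mem_level (mul_expN_mem_level hX ha' s')
  have hb_mem : b ∈ level X (k + 1) := mul_mem_level hX hinv (mul_expN_mem_level hX ha s)
  have hconj_mem : C⁻¹ * b * C⁻¹⁻¹ ∈ level X k := by
    refine polarization_inf_flag_le hk ?_ (conj_mem_level hX _ hb_mem)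
    rw [hconj]
    exact mem_polGroup.1 (mul_mem hp' (inv_mem hp))
  have hlead := lead_eq_zero hconj_mem
  rw [lead_conj hX _ hb_mem, lead_mul hX hinv (mul_expN_mem_level hX ha s), lead_inv,
    lead_mul_expN hX ha, lead_mul_expN hX ha'] at hlead
  linarith

theorem tail_unique (hX : IsStrongMalcev X) (k : ℕ) {a a' p p' : lieGroup 𝔫} {t t' : Fin n → ℝ}
    (ht : ∀ i ∉ jumpSet X l, t i = 0) (ht' : ∀ i ∉ jumpSet X l, t' i = 0)
    (ha : a ∈ level X k) (ha' : a' ∈ level X k) (hp : p ∈ polGroup hX l) (hp' : p' ∈ polGroup hX l)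
    (h : a * tailProd X t k * p = a' * tailProd X t' k * p') :
    ∀ i : Fin n, k ≤ i → t i = t' i := by
  induction k using descending_induction (n := n) generalizing a a' with
  | hn k hk => exact fun i hi => absurd i.2 (hk.trans hi).not_gt
  | hs k ih =>
    rw [tailProd_eq_mul, tailProd_eq_mul, ← mul_assoc, ← mul_assoc] at h
    have htail := ih (mul_expN_mem_level hX ha _) (mul_expN_mem_level hX ha' _) h
    have hk : t k = t' k := by
      by_cases hkJ : k ∈ jumpSet X l
      · rw [tailProd_congr (X := X) (k + 1) htail] at h
        exact coord_unique_of_mem_jumpSet hX hkJ ha ha' hp hp' h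
      · rw [ht k hkJ, ht' k hkJ]
    intro i hi
    rcases hi.eq_or_lt with hik | hik
    · rwa [← Fin.ext hik]
    · exact htail i hik

/-- A continuous choice of factorizations `x = a(x) exp (T_k X_k) ⋯ exp (T_n X_n) p(x)` with `a(x)`
in `exp 𝔫_k`, `p(x)` in `P(λ)` and `T = T(x)` supported on the jump set. -/
structure IsFactorization (hX : IsStrongMalcev X) (l : Module.Dual ℝ 𝔫) (k : ℕ)
    (a p : lieGroup 𝔫 → lieGroup 𝔫) (T : lieGroup 𝔫 → Fin n → ℝ) : Prop where
  continuous_left : Continuous a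
  continuous_right : Continuous p
  continuous_coord : Continuous T
  left_mem : ∀ x, a x ∈ level X k
  right_mem : ∀ x, p x ∈ polGroup hX l
  coord_eq_zero : ∀ x, ∀ i ∉ jumpSet X l, T x i = 0
  mul_eq : ∀ x, a x * tailProd X (T x) k * p x = x

theorem IsFactorization.of_mem_jumpSet {hX : IsStrongMalcev X} {k : Fin n}
    {a p : lieGroup 𝔫 → lieGroup 𝔫} {T : lieGroup 𝔫 → Fin n → ℝ}
    (h : IsFactorization hX l (k + 1) a p T) (hk : k ∈ jumpSet X l) :
    IsFactorization hX l k (fun x => a x * expN (-lead X k (a x) • X k)) p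
      fun x => Function.update (T x) k (lead X k (a x)) where
  continuous_left := h.continuous_left.mul
    ((continuous_expN_smul _).comp ((continuous_lead k).comp h.continuous_left).neg)
  continuous_right := h.continuous_right
  continuous_coord := h.continuous_coord.update k ((continuous_lead k).comp h.continuous_left)
  left_mem x := mul_mem_level_of_lead_eq_neg hX (h.left_mem x)
    (expN_mem_level (Submodule.smul_mem _ _ (basis_mem_flag k))) (lead_expN_smul_basis k _)
  right_mem := h.right_mem
  coord_eq_zero x i hi := by
    rw [Function.update_of_ne (ne_of_mem_of_not_mem hk hi).symm]
    exact h.coord_eq_zero x i hi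
  mul_eq x := by
    rw [tailProd_update, neg_smul, expN_neg, mul_assoc (a x), inv_mul_cancel_left]
    exact h.mul_eq x

theorem IsFactorization.of_notMem_jumpSet {hX : IsStrongMalcev X} {k : Fin n}
    {a p : lieGroup 𝔫 → lieGroup 𝔫} {T : lieGroup 𝔫 → Fin n → ℝ}
    (h : IsFactorization hX l (k + 1) a p T) {q : 𝔫} (hq : q ∈ polarization X l)
    (hqk : q ∈ flag X (k + 1)) (hqk' : X.repr q k = 1) :
    IsFactorization hX l k
      (fun x => a x * (tailProd X (T x) (k + 1) * expN (-lead X k (a x) • q) *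
        (tailProd X (T x) (k + 1))⁻¹))
      (fun x => expN (lead X k (a x) • q) * p x) (fun x => Function.update (T x) k 0) where
  continuous_left := by
    have htail := (continuous_tailProd (X := X) (k + 1)).comp h.continuous_coord
    exact h.continuous_left.mul ((htail.mul ((continuous_expN_smul q).comp
      ((continuous_lead k).comp h.continuous_left).neg)).mul htail.inv)
  continuous_right := ((continuous_expN_smul q).comp
    ((continuous_lead k).comp h.continuous_left)).mul h.continuous_right
  continuous_coord := h.continuous_coord.update k continuous_const
  left_mem x := by
    have hexp : expN (-lead X k (a x) • q) ∈ level X (k + 1) :=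
      expN_mem_level (Submodule.smul_mem _ _ hqk)
    refine mul_mem_level_of_lead_eq_neg hX (h.left_mem x) (conj_mem_level hX _ hexp) ?_
    rw [lead_conj hX _ hexp, lead_expN, map_smul, Finsupp.smul_apply, hqk', smul_eq_mul, mul_one]
  right_mem x := mul_mem (expN_mem_polGroup hX (Submodule.smul_mem _ _ hq)) (h.right_mem x)
  coord_eq_zero x i hi := by
    rcases eq_or_ne i k with rfl | hik
    · exact Function.update_self ..
    · rw [Function.update_of_ne hik]
      exact h.coord_eq_zero x i hi
  mul_eq x := by
    rw [tailProd_update, neg_smul, expN_neg, zero_smul, expN_zero, one_mul]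
    calc _ = a x * tailProd X (T x) (k + 1) * p x := by group
      _ = x := h.mul_eq x

theorem exists_isFactorization (hX : IsStrongMalcev X) (l : Module.Dual ℝ 𝔫) (k : ℕ) :
    ∃ a p T, IsFactorization hX l k a p T := by
  induction k using descending_induction (n := n) with
  | hn k hk =>
    exact ⟨id, fun _ => 1, fun _ => 0, continuous_id, continuous_const, continuous_const,
      mem_level_of_le hk, fun _ => one_mem _, fun _ _ _ => rfl,
      fun x => by rw [tailProd_of_le _ hk, mul_one, mul_one, id]⟩
  | hs k ih =>
    obtain ⟨a, p, T, h⟩ := ih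
    by_cases hk : k ∈ jumpSet X l
    · exact ⟨_, _, _, h.of_mem_jumpSet hk⟩
    · obtain ⟨q, hq, hqk, hqk'⟩ := exists_mem_polarization_of_notMem_jumpSet hk
      exact ⟨_, _, _, h.of_notMem_jumpSet hq hqk hqk'⟩

theorem exists_continuous_section (hX : IsStrongMalcev X) (l : Module.Dual ℝ 𝔫) :
    ∃ (τ : lieGroup 𝔫 → jumpSet X l → ℝ) (p : lieGroup 𝔫 → lieGroup 𝔫), Continuous τ ∧
      Continuous p ∧ ∀ x, p x ∈ polGroup hX l ∧ x = crossSection X l (τ x) * p x := by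
  obtain ⟨a, p, T, h⟩ := exists_isFactorization hX l 0
  refine ⟨fun x k => T x k, p, continuous_pi fun k => (continuous_apply _).comp h.continuous_coord,
    h.continuous_right, fun x => ⟨h.right_mem x, ?_⟩⟩
  rw [crossSection_eq, extendJump_restrict (h.coord_eq_zero x)]
  have hx := h.mul_eq x
  rw [eq_one_of_mem_level_zero (h.left_mem x), one_mul] at hx
  exact hx.symm

/-- The coordinates of the coset `x P(λ)`. -/
def secCoord (hX : IsStrongMalcev X) (l : Module.Dual ℝ 𝔫) : lieGroup 𝔫 → jumpSet X l → ℝ :=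
  (exists_continuous_section hX l).choose

/-- The component of `x` in `P(λ)`. -/
def polPart (hX : IsStrongMalcev X) (l : Module.Dual ℝ 𝔫) : lieGroup 𝔫 → lieGroup 𝔫 :=
  (exists_continuous_section hX l).choose_spec.choose

theorem continuous_secCoord (hX : IsStrongMalcev X) : Continuous (secCoord hX l) :=
  (exists_continuous_section hX l).choose_spec.choose_spec.1

theorem continuous_polPart (hX : IsStrongMalcev X) : Continuous (polPart hX l) :=
  (exists_continuous_section hX l).choose_spec.choose_spec.2.1

theorem polPart_mem (hX : IsStrongMalcev X) (x : lieGroup 𝔫) : polPart hX l x ∈ polGroup hX l :=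
  ((exists_continuous_section hX l).choose_spec.choose_spec.2.2 x).1

theorem crossSection_mul_polPart (hX : IsStrongMalcev X) (x : lieGroup 𝔫) :
    crossSection X l (secCoord hX l x) * polPart hX l x = x :=
  ((exists_continuous_section hX l).choose_spec.choose_spec.2.2 x).2.symm

theorem secCoord_eq_of_eq (hX : IsStrongMalcev X) {k : ℕ} (hk : k ≤ n) {x a p : lieGroup 𝔫}
    {t : Fin n → ℝ} (ht : ∀ i ∉ jumpSet X l, t i = 0) (ha : a ∈ level X k)
    (hp : p ∈ polGroup hX l) (h : x = a * tailProd X t k * p) (i : jumpSet X l) (hi : k ≤ i) :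
    secCoord hX l x i = t i := by
  obtain ⟨b, hb, hb'⟩ :=
    malcevCoord_eq_mul_tailProd hX (extendJump X l (secCoord hX l x)) k hk
  have hfac := crossSection_mul_polPart (l := l) hX x
  rw [crossSection_eq, hb'] at hfac
  have := tail_unique hX k (extendJump_of_notMem _) ht hb ha (polPart_mem hX x) hp
    (hfac.trans h) i hi
  rwa [extendJump_apply] at this

theorem secCoord_crossSection_mul (hX : IsStrongMalcev X) (t : jumpSet X l → ℝ) {p : lieGroup 𝔫}
    (hp : p ∈ polGroup hX l) : secCoord hX l (crossSection X l t * p) = t := by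
  ext i
  rw [secCoord_eq_of_eq hX (Nat.zero_le n) (extendJump_of_notMem t) (one_mem_level 0) hp
    (x := crossSection X l t * p) (by rw [one_mul]; rfl) i (Nat.zero_le _), extendJump_apply]

theorem polPart_crossSection_mul (hX : IsStrongMalcev X) (t : jumpSet X l → ℝ) {p : lieGroup 𝔫}
    (hp : p ∈ polGroup hX l) : polPart hX l (crossSection X l t * p) = p := by
  have := crossSection_mul_polPart (l := l) hX (crossSection X l t * p)
  rwa [secCoord_crossSection_mul hX t hp, mul_left_cancel_iff] at this

theorem secCoord_crossSection (hX : IsStrongMalcev X) (t : jumpSet X l → ℝ) :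
    secCoord hX l (crossSection X l t) = t := by
  simpa using secCoord_crossSection_mul hX t (one_mem _)

theorem polPart_crossSection (hX : IsStrongMalcev X) (t : jumpSet X l → ℝ) :
    polPart hX l (crossSection X l t) = 1 := by
  simpa using polPart_crossSection_mul hX t (one_mem _)

theorem secCoord_mul (hX : IsStrongMalcev X) (x : lieGroup 𝔫) {p : lieGroup 𝔫}
    (hp : p ∈ polGroup hX l) : secCoord hX l (x * p) = secCoord hX l x := by
  conv_lhs => rw [← crossSection_mul_polPart (l := l) hX x, mul_assoc]
  exact secCoord_crossSection_mul hX _ (mul_mem (polPart_mem hX x) hp)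

theorem polPart_mul (hX : IsStrongMalcev X) (x : lieGroup 𝔫) {p : lieGroup 𝔫}
    (hp : p ∈ polGroup hX l) : polPart hX l (x * p) = polPart hX l x * p := by
  conv_lhs => rw [← crossSection_mul_polPart (l := l) hX x, mul_assoc]
  exact polPart_crossSection_mul hX _ (mul_mem (polPart_mem hX x) hp)

theorem secCoord_level_mul (hX : IsStrongMalcev X) (e : jumpSet X l) {z : lieGroup 𝔫}
    (hz : z ∈ level X ((e : Fin n) + 1)) (x : lieGroup 𝔫) :
    secCoord hX l (z * x) e = secCoord hX l x e + lead X e z := by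
  have hen : (e : ℕ) ≤ n := (e : Fin n).2.le
  set t := extendJump X l (secCoord hX l x) with ht
  set s := t e + lead X e z with hs
  obtain ⟨b, hb, hbt⟩ := malcevCoord_eq_mul_tailProd hX t e hen
  have hx : b * tailProd X t e * polPart hX l x = x := by
    rw [← hbt]
    exact crossSection_mul_polPart hX x
  set y := z * (b * expN (t e • X e)) with hy
  have hbe := mul_expN_mem_level hX hb (t e)
  have hylead : lead X e y = s := by
    rw [hy, lead_mul hX hz hbe, lead_mul_expN hX hb, add_comm]
  have hylevel : y * expN (-s • X e) ∈ level X e :=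
    mul_mem_level_of_lead_eq_neg hX (mul_mem_level hX hz hbe)
      (expN_mem_level (Submodule.smul_mem _ _ (basis_mem_flag _)))
      (by rw [lead_expN_smul_basis, hylead])
  have hzx : z * x = y * expN (-s • X e) * tailProd X (Function.update t e s) e *
      polPart hX l x := by
    rw [tailProd_update, neg_smul, expN_neg, mul_assoc y, inv_mul_cancel_left, hy, mul_assoc z,
      mul_assoc b, ← tailProd_eq_mul, mul_assoc z, hx]
  have hsupp : ∀ i ∉ jumpSet X l, Function.update t e s i = 0 := fun i hi => by
    rw [Function.update_of_ne (ne_of_mem_of_not_mem e.2 hi).symm]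
    exact extendJump_of_notMem _ i hi
  rw [secCoord_eq_of_eq hX hen hsupp hylevel (polPart_mem hX x) hzx e le_rfl,
    Function.update_self, hs, ht, extendJump_apply]

/-- `y = z x` for some `z` in `exp 𝔫_{k+1}` whose leading coefficient is `δ`. -/
def LevelRel (X : Module.Basis (Fin n) ℝ 𝔫) (k : Fin n) (δ : ℝ) (x y : lieGroup 𝔫) : Prop :=
  ∃ z ∈ level X ((k : ℕ) + 1), lead X k z = δ ∧ y = z * x

theorem LevelRel.refl (k : Fin n) (x : lieGroup 𝔫) : LevelRel X k 0 x x :=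
  ⟨1, one_mem_level _, lead_eq_zero (one_mem_level _), (one_mul x).symm⟩

theorem LevelRel.mul (hX : IsStrongMalcev X) {k : Fin n} {δ δ' : ℝ} {x y x' y' : lieGroup 𝔫}
    (h : LevelRel X k δ x y) (h' : LevelRel X k δ' x' y') :
    LevelRel X k (δ + δ') (x * x') (y * y') := by
  obtain ⟨z, hz, hzδ, rfl⟩ := h
  obtain ⟨z', hz', hzδ', rfl⟩ := h'
  refine ⟨z * (x * z' * x⁻¹), mul_mem_level hX hz (conj_mem_level hX x hz'), ?_, by group⟩
  rw [lead_mul hX hz (conj_mem_level hX x hz'), lead_conj hX x hz', hzδ, hzδ']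

theorem levelRel_expN_smul {k : Fin n} {Y : 𝔫} (hY : Y ∈ flag X (k + 1)) (s s' : ℝ) :
    LevelRel X k ((s' - s) * X.repr Y k) (expN (s • Y)) (expN (s' • Y)) := by
  refine ⟨expN ((s' - s) • Y), expN_mem_level (Submodule.smul_mem _ _ hY), ?_, ?_⟩
  · rw [lead_expN, map_smul]
    rfl
  · rw [← expN_add_smul, sub_add_cancel]

theorem LevelRel.secCoord (hX : IsStrongMalcev X) {k : jumpSet X l} {δ : ℝ} {x y : lieGroup 𝔫}
    (h : LevelRel X k δ x y) : secCoord hX l y k = WaveletRep.secCoord hX l x k + δ := by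
  obtain ⟨z, hz, hzδ, rfl⟩ := h
  rw [secCoord_level_mul hX k hz, hzδ]

theorem levelRel_tailProd (hX : IsStrongMalcev X) {k : Fin n} {t t' : Fin n → ℝ}
    (h : ∀ j, k < j → t j = t' j) {i : ℕ} (hi : i ≤ k) :
    LevelRel X k (t' k - t k) (tailProd X t i) (tailProd X t' i) := by
  induction hi using Nat.decreasingInduction with
  | self =>
    have hmul := (levelRel_expN_smul (basis_mem_flag k) (t k) (t' k)).mul hX
      (LevelRel.refl k (tailProd X t (k + 1)))
    rw [Module.Basis.repr_self, Finsupp.single_eq_same, mul_one, add_zero,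
      ← tailProd_eq_mul] at hmul
    rwa [tailProd_eq_mul t', ← tailProd_congr (k + 1) fun j hj => h j hj]
  | of_succ i hi ih =>
    let j : Fin n := ⟨i, hi.trans k.2⟩
    have hmul := (levelRel_expN_smul (X := X) (k := k) (flag_mono (Nat.succ_le_succ hi.le)
      (basis_mem_flag j)) (t j) (t' j)).mul hX ih
    rwa [Module.Basis.repr_self, Finsupp.single_eq_of_ne (Fin.ne_of_gt hi), mul_zero, zero_add,
      ← tailProd_eq_mul t j, ← tailProd_eq_mul t' j] at hmul

theorem levelRel_crossSection (hX : IsStrongMalcev X) (k : jumpSet X l) {t t' : jumpSet X l → ℝ}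
    (h : ∀ j, k < j → t j = t' j) :
    LevelRel X k (t' k - t k) (crossSection X l t) (crossSection X l t') := by
  rw [← extendJump_apply t, ← extendJump_apply t']
  refine levelRel_tailProd hX (fun j hj => ?_) (Nat.zero_le k)
  by_cases hjJ : j ∈ jumpSet X l
  · simpa [extendJump, hjJ] using h ⟨j, hjJ⟩ hj
  · rw [extendJump_of_notMem t j hjJ, extendJump_of_notMem t' j hjJ]

end Coordinates

section Triangular

variable {G : Type*} [AddCommGroup G] [MeasurableSpace G] [MeasurableAdd₂ G] {μ : Measure G}
  [SigmaFinite μ] [μ.IsAddRightInvariant]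

theorem measurePreserving_pi_of_triangular_fin {d : ℕ} {Φ : (Fin d → G) → Fin d → G}
    (hΦ : Measurable Φ)
    (h : ∀ i t t', (∀ j, i < j → t j = t' j) → Φ t i - t i = Φ t' i - t' i) :
    MeasurePreserving Φ (.pi fun _ => μ) (.pi fun _ => μ) := by
  induction d with
  | zero =>
    rw [Subsingleton.elim Φ id]
    exact MeasurePreserving.id _
  | succ d ih =>
    let e := MeasurableEquiv.piFinSuccAbove (fun _ : Fin (d + 1) => G) (Fin.last d)
    have he := measurePreserving_piFinSuccAbove (fun _ : Fin (d + 1) => μ) (Fin.last d)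
    let g (a : G) (v : Fin d → G) : Fin d → G := (e (Φ (e.symm (a, v)))).2
    have hg : Measurable (Function.uncurry g) :=
      measurable_snd.comp (e.measurable.comp (hΦ.comp e.symm.measurable))
    have hgμ (a : G) : MeasurePreserving (g a) (.pi fun _ => μ) (.pi fun _ => μ) := by
      refine ih (hg.comp measurable_prodMk_left) fun i v v' hv => ?_
      have hi := h i.castSucc (e.symm (a, v)) (e.symm (a, v')) fun j hj => by
        induction j using Fin.lastCases with
        | last => simp [e]
        | cast j => simpa [e] using hv j (by simpa using hj)
      simpa [g, e, Fin.init] using hi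
    have hlast (t : Fin (d + 1) → G) : Φ t (Fin.last d) = t (Fin.last d) + Φ 0 (Fin.last d) := by
      have hsub := h (Fin.last d) t 0 fun j hj => absurd hj (Fin.le_last j).not_gt
      rwa [Pi.zero_apply, sub_zero, sub_eq_iff_eq_add'] at hsub
    have hskew := (measurePreserving_add_right μ (Φ 0 (Fin.last d))).skew_product hg
      (Filter.Eventually.of_forall fun a => (hgμ a).map_eq)
    convert! (he.symm e).comp (hskew.comp he) using 1
    funext t
    exact e.eq_symm_apply.2 (Prod.ext (hlast t)
      (congrArg (fun s => (e (Φ s)).2) (e.symm_apply_apply t).symm))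

theorem measurePreserving_pi_of_triangular {ι : Type*} [Fintype ι] [LinearOrder ι]
    {Φ : (ι → G) → ι → G} (hΦ : Measurable Φ)
    (h : ∀ i t t', (∀ j, i < j → t j = t' j) → Φ t i - t i = Φ t' i - t' i) :
    MeasurePreserving Φ (.pi fun _ => μ) (.pi fun _ => μ) := by
  let σ : Fin (Fintype.card ι) ≃o ι := Fintype.orderIsoFinOfCardEq ι rfl
  let e : (Fin (Fintype.card ι) → G) ≃ᵐ (ι → G) :=
    MeasurableEquiv.arrowCongr' σ.toEquiv (MeasurableEquiv.refl G)
  have he : MeasurePreserving e (.pi fun _ => μ) (.pi fun _ => μ) :=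
    measurePreserving_arrowCongr' _ _ _ _ fun _ => MeasurePreserving.id μ
  have hfin : MeasurePreserving (e.symm ∘ Φ ∘ e) (.pi fun _ => μ) (.pi fun _ => μ) := by
    refine measurePreserving_pi_of_triangular_fin
      (e.symm.measurable.comp (hΦ.comp e.measurable)) fun i t t' htt' => ?_
    have hi := h (σ i) (e t) (e t') fun j hj => htt' (σ.symm j) (σ.lt_symm_apply.2 hj)
    have he_apply (s) : e s (σ i) = s i := congrArg s (σ.symm_apply_apply i)
    rwa [he_apply, he_apply] at hi
  convert! he.comp (hfin.comp (he.symm e)) using 1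
  funext t
  simp

end Triangular

section Action

variable {m n : ℕ} {𝔫 : LieSubalgebra ℝ (Matrix (Fin m) (Fin m) ℝ)}
  {X : Module.Basis (Fin n) ℝ 𝔫} {l : Module.Dual ℝ 𝔫} [IsNilMatrixAlgebra 𝔫]

theorem measurePreserving_secCoord (hX : IsStrongMalcev X) (y : lieGroup 𝔫) :
    MeasurePreserving (fun t => secCoord hX l (y * crossSection X l t)) volume volume := by
  refine measurePreserving_pi_of_triangular ((continuous_secCoord hX).comp
    (continuous_const.mul continuous_crossSection)).measurable fun e t t' h => ?_
  rw [((LevelRel.refl (e : Fin n) y).mul hX (levelRel_crossSection hX e h)).secCoord hX]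
  ring

/-- `λ (log p)`, where `p` is the component of `x` in `P(λ)`: the value at `x` of an equivariant
function is `unitChar (phase x)` times its value on the cross-section. -/
def phase (hX : IsStrongMalcev X) (l : Module.Dual ℝ 𝔫) (x : lieGroup 𝔫) : ℝ :=
  l (logN (polPart hX l x))

theorem continuous_phase (hX : IsStrongMalcev X) : Continuous (phase hX l) :=
  (continuous_dual l).comp (continuous_logN.comp (continuous_polPart hX))

theorem phase_mul (hX : IsStrongMalcev X) (x : lieGroup 𝔫) {p : lieGroup 𝔫}
    (hp : p ∈ polGroup hX l) : phase hX l (x * p) = phase hX l x + l (logN p) := by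
  rw [phase, polPart_mul hX x hp, form_logN_mul hX (polPart_mem hX x) hp, phase]

theorem phase_crossSection (hX : IsStrongMalcev X) (t : jumpSet X l → ℝ) :
    phase hX l (crossSection X l t) = 0 := by
  rw [phase, polPart_crossSection, logN_one, map_zero]

/-- The character `e^{-2πi s}`. -/
def unitChar (s : ℝ) : ℂ := Complex.exp (-(2 * Real.pi * Complex.I * (s : ℂ)))

theorem unitChar_add (s t : ℝ) : unitChar (s + t) = unitChar s * unitChar t := by
  rw [unitChar, unitChar, unitChar, ← Complex.exp_add]
  push_cast
  ring_nf

theorem unitChar_zero : unitChar 0 = 1 := by simp [unitChar]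

theorem norm_unitChar (s : ℝ) : ‖unitChar s‖ = 1 := by
  rw [unitChar, show -(2 * Real.pi * Complex.I * (s : ℂ)) = ((-(2 * Real.pi * s) : ℝ) : ℂ) *
    Complex.I by push_cast; ring]
  exact Complex.norm_exp_ofReal_mul_I _

theorem continuous_unitChar : Continuous unitChar := by
  unfold unitChar
  fun_prop

theorem unitChar_neg_mul_self (s : ℝ) : unitChar (-s) * unitChar s = 1 := by
  rw [← unitChar_add, neg_add_cancel, unitChar_zero]

theorem star_unitChar (s : ℝ) : (starRingEnd ℂ) (unitChar s) = unitChar (-s) := by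
  rw [unitChar, unitChar, ← Complex.exp_conj]
  simp [map_ofNat]

/-- The equivariant function on `N` whose restriction to the cross-section is `F`. -/
def lift (hX : IsStrongMalcev X) (l : Module.Dual ℝ 𝔫) (F : (jumpSet X l → ℝ) → ℂ)
    (x : lieGroup 𝔫) : ℂ := unitChar (phase hX l x) * F (secCoord hX l x)

theorem lift_mul (hX : IsStrongMalcev X) (F : (jumpSet X l → ℝ) → ℂ) (x : lieGroup 𝔫)
    {p : lieGroup 𝔫} (hp : p ∈ polGroup hX l) :
    lift hX l F (x * p) = unitChar (l (logN p)) * lift hX l F x := by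
  rw [lift, phase_mul hX x hp, secCoord_mul hX x hp, unitChar_add, lift]
  ring

theorem isEquivariant_lift (hX : IsStrongMalcev X) (F : (jumpSet X l → ℝ) → ℂ) :
    IsEquivariant X l (lift hX l F) := fun x Y hY => by
  rw [lift_mul hX F x (expN_mem_polGroup hX hY), logN_expN]
  rfl

theorem lift_crossSection (hX : IsStrongMalcev X) (F : (jumpSet X l → ℝ) → ℂ)
    (t : jumpSet X l → ℝ) : lift hX l F (crossSection X l t) = F t := by
  rw [lift, phase_crossSection, secCoord_crossSection, unitChar_zero, one_mul]

theorem eq_lift_of_isEquivariant (hX : IsStrongMalcev X) {g : lieGroup 𝔫 → ℂ}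
    (hg : IsEquivariant X l g) : g = lift hX l fun t => g (crossSection X l t) := by
  ext x
  have hequiv := hg (crossSection X l (secCoord hX l x)) (logN (polPart hX l x)) (polPart_mem hX x)
  rw [expN_logN, crossSection_mul_polPart] at hequiv
  exact hequiv

theorem norm_lift (hX : IsStrongMalcev X) (F : (jumpSet X l → ℝ) → ℂ) (x : lieGroup 𝔫) :
    ‖lift hX l F x‖ = ‖F (secCoord hX l x)‖ := by
  rw [lift, norm_mul, norm_unitChar, one_mul]

/-- The restriction to the cross-section of the translate of an equivariant function. -/
def translate (hX : IsStrongMalcev X) (l : Module.Dual ℝ 𝔫) (y : lieGroup 𝔫)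
    (F : (jumpSet X l → ℝ) → ℂ) (t : jumpSet X l → ℝ) : ℂ := lift hX l F (y⁻¹ * crossSection X l t)

theorem lift_translate (hX : IsStrongMalcev X) (y : lieGroup 𝔫) (F : (jumpSet X l → ℝ) → ℂ)
    (x : lieGroup 𝔫) : lift hX l (translate hX l y F) x = lift hX l F (y⁻¹ * x) := by
  conv_rhs => rw [← crossSection_mul_polPart (l := l) hX x, ← mul_assoc,
    lift_mul hX F _ (polPart_mem hX x)]
  rfl

theorem translate_mul (hX : IsStrongMalcev X) (y y' : lieGroup 𝔫) (F : (jumpSet X l → ℝ) → ℂ) :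
    translate hX l (y * y') F = translate hX l y (translate hX l y' F) := by
  ext t
  rw [translate, translate, lift_translate, mul_inv_rev, mul_assoc]

theorem translate_one (hX : IsStrongMalcev X) (F : (jumpSet X l → ℝ) → ℂ) :
    translate hX l 1 F = F := by
  ext t
  rw [translate, inv_one, one_mul, lift_crossSection]

theorem translate_ae (hX : IsStrongMalcev X) (y : lieGroup 𝔫) {F F' : (jumpSet X l → ℝ) → ℂ}
    (h : F =ᵐ[volume] F') : translate hX l y F =ᵐ[volume] translate hX l y F' := by
  filter_upwards [(measurePreserving_secCoord (l := l) hX y⁻¹).quasiMeasurePreserving.ae h]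
    with t ht
  rw [translate, translate, lift, lift, ht]

theorem memLp_translate (hX : IsStrongMalcev X) (y : lieGroup 𝔫) {F : (jumpSet X l → ℝ) → ℂ}
    (hF : MemLp F 2 volume) : MemLp (translate hX l y F) 2 volume := by
  have hcomp := hF.comp_measurePreserving (measurePreserving_secCoord (l := l) hX y⁻¹)
  refine hcomp.congr_norm ?_ (Filter.Eventually.of_forall fun t => (norm_lift hX F _).symm)
  exact ((continuous_unitChar.comp ((continuous_phase hX).comp
    (continuous_const.mul continuous_crossSection))).aestronglyMeasurable).mul hcomp.1

theorem eLpNorm_translate (hX : IsStrongMalcev X) (y : lieGroup 𝔫) {F : (jumpSet X l → ℝ) → ℂ}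
    (hF : AEStronglyMeasurable F volume) :
    eLpNorm (translate hX l y F) 2 volume = eLpNorm F 2 volume := by
  rw [← eLpNorm_comp_measurePreserving hF (measurePreserving_secCoord (l := l) hX y⁻¹)]
  exact eLpNorm_congr_norm_ae (Filter.Eventually.of_forall fun t => norm_lift hX F _)

/-- The operator of translation by `y` on `L²`, an isometry. -/
def transOp (hX : IsStrongMalcev X) (l : Module.Dual ℝ 𝔫) (y : lieGroup 𝔫) :
    L2 X l →ₗᵢ[ℂ] L2 X l where
  toFun f := (memLp_translate hX y (Lp.memLp f)).toLp _
  map_add' f g := by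
    rw [← MemLp.toLp_add]
    refine MemLp.toLp_congr _ _ ?_
    filter_upwards [translate_ae hX y (Lp.coeFn_add f g)] with t ht
    rw [ht]
    simp only [translate, lift, Pi.add_apply, mul_add]
  map_smul' c f := by
    rw [RingHom.id_apply, ← MemLp.toLp_const_smul]
    refine MemLp.toLp_congr _ _ ?_
    filter_upwards [translate_ae hX y (Lp.coeFn_smul c f)] with t ht
    rw [ht]
    simp only [translate, lift, Pi.smul_apply, smul_eq_mul]
    ring
  norm_map' f := by
    change ‖(memLp_translate hX y (Lp.memLp f)).toLp _‖ = ‖f‖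
    rw [Lp.norm_toLp, eLpNorm_translate hX y (Lp.aestronglyMeasurable f), Lp.norm_def]

theorem transOp_toLp (hX : IsStrongMalcev X) (y : lieGroup 𝔫) {F : (jumpSet X l → ℝ) → ℂ}
    (hF : MemLp F 2 volume) :
    transOp hX l y (hF.toLp F) = (memLp_translate hX y hF).toLp _ :=
  MemLp.toLp_congr (memLp_translate hX y (Lp.memLp _)) (memLp_translate hX y hF)
    (translate_ae hX y hF.coeFn_toLp)

theorem transOp_mul (hX : IsStrongMalcev X) (y y' : lieGroup 𝔫) (f : L2 X l) :
    transOp hX l (y * y') f = transOp hX l y (transOp hX l y' f) := by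
  change _ = transOp hX l y ((memLp_translate hX y' (Lp.memLp f)).toLp _)
  rw [transOp_toLp]
  exact MemLp.toLp_congr (memLp_translate hX (y * y') (Lp.memLp f)) _ (by rw [translate_mul])

theorem transOp_one (hX : IsStrongMalcev X) (f : L2 X l) : transOp hX l 1 f = f := by
  conv_rhs => rw [← Lp.toLp_coeFn f (Lp.memLp f)]
  exact MemLp.toLp_congr (memLp_translate hX 1 (Lp.memLp f)) _ (by rw [translate_one])

/-- The representation of `N` on `L²(ℝᵈ)` induced from `P(λ)` by `χ_λ`. -/
def inducedRep (hX : IsStrongMalcev X) (l : Module.Dual ℝ 𝔫) :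
    lieGroup 𝔫 →* (L2 X l ≃ₗᵢ[ℂ] L2 X l) where
  toFun y :=
    { toLinearEquiv := LinearEquiv.ofLinearMap (transOp hX l y).toLinearMap
        (transOp hX l y⁻¹).toLinearMap
        (by ext1 f; simp [← transOp_mul, transOp_one])
        (by ext1 f; simp [← transOp_mul, transOp_one])
      norm_map' := (transOp hX l y).norm_map }
  map_one' := by
    ext1 f
    exact transOp_one hX f
  map_mul' y y' := by
    ext1 f
    exact transOp_mul hX y y' f

theorem inducedRep_apply (hX : IsStrongMalcev X) (y : lieGroup 𝔫) (f : L2 X l) :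
    inducedRep hX l y f = transOp hX l y f := rfl

theorem isInducedRep_inducedRep (hX : IsStrongMalcev X) (l : Module.Dual ℝ 𝔫) :
    IsInducedRep X l (inducedRep hX l) := by
  intro y g hg hgL
  rw [inducedRep_apply, transOp_toLp]
  refine (MemLp.coeFn_toLp _).trans (Filter.Eventually.of_forall fun t => ?_)
  change lift hX l _ (y⁻¹ * crossSection X l t) = _
  rw [← eq_lift_of_isEquivariant hX hg]

theorem eq_inducedRep (hX : IsStrongMalcev X) {π : lieGroup 𝔫 →* (L2 X l ≃ₗᵢ[ℂ] L2 X l)}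
    (hπ : IsInducedRep X l π) : π = inducedRep hX l := by
  ext y f : 2
  have hmem : MemLp (fun t => lift hX l f (crossSection X l t)) 2 volume := by
    simp only [lift_crossSection]
    exact Lp.memLp f
  have hf : hmem.toLp _ = f := by
    conv_rhs => rw [← Lp.toLp_coeFn f (Lp.memLp f)]
    exact MemLp.toLp_congr _ _ (Filter.Eventually.of_forall fun t => lift_crossSection hX f t)
  have hπf := hπ y (lift hX l f) (isEquivariant_lift hX f) hmem
  have hind := isInducedRep_inducedRep hX l y (lift hX l f) (isEquivariant_lift hX f) hmem
  rw [hf] at hπf hind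
  exact Lp.ext (hπf.trans hind.symm)

end Action

section StrongContinuity

open Topology

theorem tendsto_eLpNorm_sub {Y T E : Type*} [TopologicalSpace Y] [TopologicalSpace T]
    [MeasurableSpace T] [OpensMeasurableSpace T] {μ : Measure T} [IsFiniteMeasureOnCompacts μ]
    [NormedAddCommGroup E] {p : ENNReal} (hp0 : p ≠ 0) (hp : p ≠ ⊤) {H : Y → T → E}
    (hH : Continuous fun q : Y × T => H q.1 q.2) {y₀ : Y} {Q : Set Y} (hQ : Q ∈ 𝓝 y₀)
    {K : Set T} (hK : IsCompact K) (hHK : ∀ y ∈ Q, ∀ t ∉ K, H y t = 0)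
    (hL : ∀ y, MemLp (H y) p μ) :
    Filter.Tendsto (fun y => eLpNorm (H y - H y₀) p μ) (𝓝 y₀) (𝓝 0) := by
  have hpos : 0 < p.toReal := ENNReal.toReal_pos hp0 hp
  have hcont : ContinuousOn (fun y => ∫ t, ‖H y t - H y₀ t‖ ^ p.toReal ∂μ) Q := by
    refine continuousOn_integral_of_compact_support hK (Continuous.continuousOn ?_)
      fun y t hy ht => ?_
    · exact (hH.sub (hH.comp (continuous_const.prodMk continuous_snd))).norm.rpow_const
        fun _ => Or.inr hpos.le
    · rw [hHK y hy t ht, hHK y₀ (mem_of_mem_nhds hQ) t ht, sub_zero, norm_zero,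
        Real.zero_rpow hpos.ne']
  have hlim := ENNReal.tendsto_ofReal
    ((hcont.continuousAt hQ).tendsto.rpow_const (p := p.toReal⁻¹) (Or.inr (by positivity)))
  simp only [sub_self, norm_zero, Real.zero_rpow hpos.ne', integral_zero,
    Real.zero_rpow (inv_ne_zero hpos.ne'), ENNReal.ofReal_zero] at hlim
  exact hlim.congr fun y => (((hL y).sub (hL y₀)).eLpNorm_eq_integral_rpow_norm hp0 hp).symm

variable {m n : ℕ} {𝔫 : LieSubalgebra ℝ (Matrix (Fin m) (Fin m) ℝ)}
  {X : Module.Basis (Fin n) ℝ 𝔫} {l : Module.Dual ℝ 𝔫} [IsNilMatrixAlgebra 𝔫]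

/-- The coordinates of the logarithm with respect to a basis, as a homeomorphism: `N` is a real
vector space as a topological space. -/
def logHomeo (X : Module.Basis (Fin n) ℝ 𝔫) : lieGroup 𝔫 ≃ₜ (Fin n → ℝ) :=
  expHomeo.symm.trans
    { toEquiv := X.equivFun.toEquiv
      continuous_toFun := continuous_pi fun k => continuous_dual (X.coord k)
      continuous_invFun := LinearMap.continuous_of_finiteDimensional (F' := 𝔫.toSubmodule)
        X.equivFun.symm.toLinearMap }

instance : SecondCountableTopology (lieGroup 𝔫) :=
  (logHomeo (Module.finBasis ℝ 𝔫)).secondCountableTopology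

instance : LocallyCompactSpace (lieGroup 𝔫) :=
  (logHomeo (Module.finBasis ℝ 𝔫)).isClosedEmbedding.locallyCompactSpace

theorem continuous_translate (hX : IsStrongMalcev X) {F : (jumpSet X l → ℝ) → ℂ}
    (hF : Continuous F) : Continuous fun q : lieGroup 𝔫 × (jumpSet X l → ℝ) =>
      translate hX l q.1 F q.2 := by
  have h : Continuous fun q : lieGroup 𝔫 × (jumpSet X l → ℝ) => q.1⁻¹ * crossSection X l q.2 :=
    continuous_fst.inv.mul (continuous_crossSection.comp continuous_snd)
  exact (continuous_unitChar.comp ((continuous_phase hX).comp h)).mul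
    (hF.comp ((continuous_secCoord hX).comp h))

theorem translate_eq_zero (hX : IsStrongMalcev X) {F : (jumpSet X l → ℝ) → ℂ}
    {Q : Set (lieGroup 𝔫)} {y : lieGroup 𝔫} (hy : y ∈ Q) {t : jumpSet X l → ℝ}
    (ht : t ∉ (fun q : lieGroup 𝔫 × (jumpSet X l → ℝ) => secCoord hX l (q.1 * crossSection X l q.2))
      '' (Q ×ˢ tsupport F)) : translate hX l y F t = 0 := by
  have hFt : F (secCoord hX l (y⁻¹ * crossSection X l t)) = 0 := by
    by_contra hF
    refine ht ⟨(y, secCoord hX l (y⁻¹ * crossSection X l t)), ⟨hy, subset_tsupport F hF⟩, ?_⟩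
    change secCoord hX l (y * crossSection X l (secCoord hX l (y⁻¹ * crossSection X l t))) = t
    rw [← secCoord_mul hX _ (polPart_mem hX (y⁻¹ * crossSection X l t)), mul_assoc,
      crossSection_mul_polPart, mul_inv_cancel_left, secCoord_crossSection]
  rw [translate, lift, hFt, mul_zero]

theorem continuous_transOp_of_hasCompactSupport (hX : IsStrongMalcev X)
    {F : (jumpSet X l → ℝ) → ℂ} (hF : Continuous F) (hFc : HasCompactSupport F)
    (hFL : MemLp F 2 volume) : Continuous fun y => transOp hX l y (hFL.toLp F) := by
  rw [continuous_iff_continuousAt]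
  intro y₀
  simp only [transOp_toLp]
  rw [ContinuousAt, Lp.tendsto_Lp_iff_tendsto_eLpNorm'']
  obtain ⟨Q, hQ, hQy⟩ := exists_compact_mem_nhds y₀
  exact tendsto_eLpNorm_sub two_ne_zero ENNReal.ofNat_ne_top (H := fun y => translate hX l y F)
    (continuous_translate hX hF) hQy
    ((hQ.prod hFc).image ((continuous_secCoord hX).comp
      (continuous_fst.mul (continuous_crossSection.comp continuous_snd))))
    (fun y hy t ht => translate_eq_zero hX hy ht) (fun y => memLp_translate hX y hFL)

theorem isStronglyContinuous_inducedRep (hX : IsStrongMalcev X) (l : Module.Dual ℝ 𝔫) :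
    IsStronglyContinuous (inducedRep hX l) := by
  intro f
  change Continuous fun y => transOp hX l y f
  refine continuous_of_uniform_approx_of_continuous fun u hu => ?_
  obtain ⟨ε, hε, hεu⟩ := Metric.mem_uniformity_dist.1 hu
  obtain ⟨F, hFc, hFε, hF, hFL⟩ := (Lp.memLp f).exists_hasCompactSupport_eLpNorm_sub_le
    (by norm_num) (ε := ENNReal.ofReal (ε / 2)) (by simpa using hε)
  refine ⟨fun y => transOp hX l y (hFL.toLp F),
    continuous_transOp_of_hasCompactSupport hX hF hFc hFL, fun y => hεu ?_⟩
  rw [(transOp hX l y).isometry.dist_eq, dist_eq_norm]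
  have hsub : f - hFL.toLp F = ((Lp.memLp f).sub hFL).toLp _ := by
    rw [MemLp.toLp_sub (Lp.memLp f) hFL, Lp.toLp_coeFn]
  rw [hsub, Lp.norm_toLp]
  refine lt_of_le_of_lt (ENNReal.toReal_mono ENNReal.ofReal_ne_top hFε) ?_
  rw [ENNReal.toReal_ofReal (by positivity)]
  linarith

end StrongContinuity

section Fourier

open FourierTransform

theorem unitChar_eq_exp (s r : ℝ) :
    unitChar (s * r) = Complex.exp ((-2 * Real.pi * r * s : ℝ) * Complex.I) := by
  rw [unitChar]
  congr 1
  push_cast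
  ring

theorem integrable_unitChar_mul {φ : ℝ → ℂ} (hφ : Integrable φ) (s : ℝ) :
    Integrable fun r => unitChar (s * r) * φ r :=
  hφ.bdd_mul (c := 1)
    (continuous_unitChar.comp (continuous_const.mul continuous_id)).aestronglyMeasurable
    (Filter.Eventually.of_forall fun _ => (norm_unitChar _).le)

theorem ae_eq_zero_of_fourier_eq_zero {V E : Type*} [NormedAddCommGroup V]
    [InnerProductSpace ℝ V] [FiniteDimensional ℝ V] [MeasurableSpace V] [BorelSpace V]
    [NormedAddCommGroup E] [NormedSpace ℂ E] [CompleteSpace E]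
    {φ : V → E} (hφ : Integrable φ) (h : 𝓕 φ = 0) : ∀ᵐ r, φ r = 0 := by
  refine ae_eq_zero_of_integral_contDiff_smul_eq_zero hφ.locallyIntegrable fun g hg hgc => ?_
  have hG : ContDiff ℝ (⊤ : ℕ∞) fun x => (g x : ℂ) := Complex.ofRealCLM.contDiff.comp hg
  have hGc : HasCompactSupport fun x => (g x : ℂ) := hgc.comp_left Complex.ofReal_zero
  let T : SchwartzMap V ℂ := 𝓕⁻ (hGc.toSchwartzMap hG)
  have hT : 𝓕 (T : V → ℂ) = fun x => (g x : ℂ) := by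
    rw [← SchwartzMap.fourier_coe, fourier_fourierInv_eq]
    rfl
  have hflip : ∫ ξ, 𝓕 (T : V → ℂ) ξ • φ ξ = ∫ x, T x • 𝓕 φ x := by
    simpa using! VectorFourier.integral_fourierIntegral_smul_eq_flip (L := innerₗ V)
      (μ := volume) (ν := volume) Real.continuous_fourierChar continuous_inner T.integrable hφ
  simpa [hT, h] using hflip

theorem ae_eq_zero_of_integral_unitChar_mul {φ : ℝ → ℂ} (hφ : Integrable φ)
    (h : ∀ s : ℚ, ∫ r, unitChar (s * r) * φ r = 0) : ∀ᵐ r, φ r = 0 := by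
  refine ae_eq_zero_of_fourier_eq_zero hφ ?_
  have hcont : Continuous fun s : ℝ => ∫ r, unitChar (s * r) * φ r := by
    refine continuous_of_dominated (bound := fun r => ‖φ r‖)
      (fun s => (integrable_unitChar_mul hφ s).aestronglyMeasurable)
      (fun s => Filter.Eventually.of_forall fun r => ?_) hφ.norm
      (Filter.Eventually.of_forall fun r => ?_)
    · rw [norm_mul, norm_unitChar, one_mul]
    · exact (continuous_unitChar.comp (continuous_id.mul continuous_const)).mul continuous_const
  have hzero : (fun s : ℝ => ∫ r, unitChar (s * r) * φ r) = fun _ => 0 :=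
    Rat.denseRange_cast.equalizer hcont continuous_const (funext h)
  funext s
  rw [Real.fourier_real_eq_integral_exp_smul]
  simpa only [unitChar_eq_exp, smul_eq_mul, Pi.zero_apply] using congrFun hzero s

theorem ae_integral_eq_zero_of_integral_unitChar_mul {T : Type*} [MeasurableSpace T]
    {ν : Measure T} [SFinite ν] {ψ : ℝ × T → ℂ} (hψ : Integrable ψ (volume.prod ν))
    (h : ∀ s : ℚ, ∫ p, unitChar (s * p.1) * ψ p ∂volume.prod ν = 0) :
    ∀ᵐ r, ∫ t, ψ (r, t) ∂ν = 0 := by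
  refine ae_eq_zero_of_integral_unitChar_mul hψ.integral_prod_left fun s => ?_
  have hint : Integrable (fun p => unitChar (s * p.1) * ψ p) (volume.prod ν) :=
    hψ.bdd_mul (c := 1)
      (continuous_unitChar.measurable.comp (measurable_fst.const_mul _)).aestronglyMeasurable
      (Filter.Eventually.of_forall fun _ => (norm_unitChar _).le)
  rw [← h s, integral_prod _ hint]
  simp only [integral_const_mul]

end Fourier

section PartialMeasure

theorem measurePreserving_update_pi {ι : Type*} [Fintype ι] [DecidableEq ι] {α : ι → Type*}
    [∀ i, MeasurableSpace (α i)] {μ : ∀ i, Measure (α i)} [∀ i, SigmaFinite (μ i)] (j : ι)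
    [IsProbabilityMeasure (μ j)] (ν : Measure (α j)) [SigmaFinite ν] :
    MeasurePreserving (fun q : α j × ∀ i, α i => Function.update q.2 j q.1)
      (ν.prod (.pi μ)) (.pi (Function.update μ j ν)) := by
  have hm : Measurable fun q : α j × ∀ i, α i => Function.update q.2 j q.1 :=
    measurable_update'.comp measurable_swap
  have (i : ι) : SigmaFinite (Function.update μ j ν i) := by
    rcases eq_or_ne i j with rfl | hi
    · rwa [Function.update_self]
    · rw [Function.update_of_ne hi]
      infer_instance
  refine ⟨hm, (Measure.pi_eq fun s hs => ?_).symm⟩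
  have hpre : (fun q : α j × ∀ i, α i => Function.update q.2 j q.1) ⁻¹' Set.univ.pi s =
      s j ×ˢ Set.univ.pi (Function.update s j Set.univ) := by
    ext q
    simp only [Set.mem_preimage, Set.mem_univ_pi, Set.mem_prod]
    rw [Function.forall_update_iff q.2 fun i x => x ∈ s i,
      Function.forall_update_iff s fun i S => q.2 i ∈ S]
    simp
  rw [Measure.map_apply hm (.univ_pi hs), hpre, Measure.prod_prod, Measure.pi_pi,
    ← Finset.mul_prod_erase _ _ (Finset.mem_univ j),
    ← Finset.mul_prod_erase _ _ (Finset.mem_univ j), Function.update_self, Function.update_self,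
    measure_univ, one_mul]
  congr 1
  refine Finset.prod_congr rfl fun i hi => ?_
  rw [Function.update_of_ne (Finset.ne_of_mem_erase hi),
    Function.update_of_ne (Finset.ne_of_mem_erase hi)]

variable {ι : Type*}

open Classical in
/-- Lebesgue measure if `j ∈ J`, and the point mass at `0` otherwise. -/
def coordMeasure (J : Finset ι) (j : ι) : Measure ℝ :=
  if j ∈ J then volume else Measure.dirac 0

theorem coordMeasure_of_mem {J : Finset ι} {j : ι} (h : j ∈ J) : coordMeasure J j = volume :=
  if_pos h

theorem coordMeasure_of_notMem {J : Finset ι} {j : ι} (h : j ∉ J) :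
    coordMeasure J j = Measure.dirac 0 :=
  if_neg h

theorem coordMeasure_insert [DecidableEq ι] (J : Finset ι) (j : ι) :
    coordMeasure (insert j J) = Function.update (coordMeasure J) j volume := by
  ext1 i
  rcases eq_or_ne i j with rfl | hij
  · rw [coordMeasure_of_mem (Finset.mem_insert_self i J), Function.update_self]
  · rw [Function.update_of_ne hij]
    by_cases hiJ : i ∈ J
    · rw [coordMeasure_of_mem hiJ, coordMeasure_of_mem (Finset.mem_insert_of_mem hiJ)]
    · rw [coordMeasure_of_notMem hiJ,
        coordMeasure_of_notMem fun h => (Finset.mem_insert.1 h).elim hij hiJ]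

instance (J : Finset ι) (j : ι) : SigmaFinite (coordMeasure J j) := by
  unfold coordMeasure
  split_ifs <;> infer_instance

variable [Fintype ι]

/-- Lebesgue measure in the coordinates of `J`, point mass at `0` in the others. -/
def partialVolume (J : Finset ι) : Measure (ι → ℝ) := Measure.pi (coordMeasure J)

instance (J : Finset ι) : SigmaFinite (partialVolume J) := by
  unfold partialVolume
  infer_instance

theorem partialVolume_univ : partialVolume (Finset.univ : Finset ι) = volume := by
  exact congrArg Measure.pi (funext fun j => coordMeasure_of_mem (Finset.mem_univ j))

instance : IsProbabilityMeasure (partialVolume (∅ : Finset ι)) := by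
  have h : coordMeasure (∅ : Finset ι) = fun _ => Measure.dirac 0 :=
    funext fun j => coordMeasure_of_notMem (Finset.notMem_empty j)
  rw [partialVolume, h]
  infer_instance

theorem measurePreserving_update [DecidableEq ι] {J : Finset ι} {j : ι} (hj : j ∉ J) :
    MeasurePreserving (fun q : ℝ × (ι → ℝ) => Function.update q.2 j q.1)
      (volume.prod (partialVolume J)) (partialVolume (insert j J)) := by
  have : IsProbabilityMeasure (coordMeasure J j) := by
    rw [coordMeasure_of_notMem hj]
    infer_instance
  rw [partialVolume, partialVolume, coordMeasure_insert]
  exact measurePreserving_update_pi (α := fun _ => ℝ) j volume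

end PartialMeasure

section Orthogonality

variable {m n : ℕ} {𝔫 : LieSubalgebra ℝ (Matrix (Fin m) (Fin m) ℝ)}
  {X : Module.Basis (Fin n) ℝ 𝔫} {l : Module.Dual ℝ 𝔫}

instance : MeasurableSpace (lieGroup 𝔫) := borel _

instance : BorelSpace (lieGroup 𝔫) := ⟨rfl⟩

/-- The elements of `𝐣` at which the members `i`, `i + 1`, … of the chain `orthChain X l` drop. -/
def laterJumps (X : Module.Basis (Fin n) ℝ 𝔫) (l : Module.Dual ℝ 𝔫) (i : ℕ) :
    Finset (jumpSet X l) :=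
  open Classical in Finset.univ.filter fun j => ∃ i', i ≤ i' ∧ i' < n ∧ ∃ W, IsAdapted X l i' j W

theorem mem_laterJumps {i : ℕ} {j : jumpSet X l} :
    j ∈ laterJumps X l i ↔ ∃ i', i ≤ i' ∧ i' < n ∧ ∃ W, IsAdapted X l i' j W := by
  simp [laterJumps]

theorem laterJumps_zero : laterJumps X l 0 = Finset.univ := by
  ext j
  obtain ⟨i, hi, W, hW⟩ := exists_isAdapted_of_mem_jumpSet j.2
  exact iff_of_true (mem_laterJumps.2 ⟨i, i.zero_le, hi, W, hW⟩) (Finset.mem_univ j)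

theorem laterJumps_eq_empty {i : ℕ} (hi : n ≤ i) : laterJumps X l i = ∅ := by
  ext j
  simp only [mem_laterJumps, Finset.notMem_empty, iff_false]
  rintro ⟨i', hii', hi', -⟩
  omega

theorem laterJumps_eq_succ {i : ℕ} (h : orthChain X l i ≤ orthChain X l (i + 1)) :
    laterJumps X l i = laterJumps X l (i + 1) := by
  ext j
  simp only [mem_laterJumps]
  refine ⟨?_, fun ⟨i', hii', hW⟩ => ⟨i', by omega, hW⟩⟩
  rintro ⟨i', hii', hi', W, hW⟩
  rcases hii'.eq_or_lt with rfl | hlt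
  · exact (hW.notMem (h hW.mem)).elim
  · exact ⟨i', hlt, hi', W, hW⟩

theorem laterJumps_eq_insert [DecidableEq (jumpSet X l)] {i : ℕ} (hi : i < n) {j : jumpSet X l}
    {W : 𝔫} (hW : IsAdapted X l i j W) :
    laterJumps X l i = insert j (laterJumps X l (i + 1)) := by
  ext k
  simp only [mem_laterJumps, Finset.mem_insert]
  constructor
  · rintro ⟨i', hii', hi', W', hW'⟩
    rcases hii'.eq_or_lt with rfl | hlt
    · exact Or.inl (Subtype.ext (hW'.index_unique hW))
    · exact Or.inr ⟨i', hlt, hi', W', hW'⟩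
  · rintro (rfl | ⟨i', hii', hW'⟩)
    · exact ⟨i, le_rfl, hi, W, hW⟩
    · exact ⟨i', by omega, hW'⟩

theorem notMem_laterJumps_succ {i : ℕ} {j : jumpSet X l} {W : 𝔫} (hW : IsAdapted X l i j W) :
    j ∉ laterJumps X l (i + 1) := by
  rw [mem_laterJumps]
  rintro ⟨i', hii', -, W', hW'⟩
  exact absurd (hW.level_unique hW') (by omega)

variable [IsNilMatrixAlgebra 𝔫]

/-- A right Haar measure on `N`. -/
def rightHaar (𝔫 : LieSubalgebra ℝ (Matrix (Fin m) (Fin m) ℝ)) [IsNilMatrixAlgebra 𝔫] :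
    Measure (lieGroup 𝔫) := (Measure.haar : Measure (lieGroup 𝔫)).inv

instance : SigmaFinite (rightHaar 𝔫) := by unfold rightHaar; infer_instance

instance : (rightHaar 𝔫).IsMulRightInvariant := by unfold rightHaar; infer_instance

instance : (rightHaar 𝔫).IsOpenPosMeasure := by unfold rightHaar; infer_instance

/-- `w` parametrizes a section of `N → N / P(λ)` over the `i`-th group of the chain
`exp (orthChain X l i)`, by the coordinates in `laterJumps X l i`. -/
structure IsChainCoord (X : Module.Basis (Fin n) ℝ 𝔫) (l : Module.Dual ℝ 𝔫) (i : ℕ)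
    (w : (jumpSet X l → ℝ) → lieGroup 𝔫) : Prop where
  continuous : Continuous w
  logN_mem : ∀ t, logN (w t) ∈ orthChain X l i
  congr : ∀ t t', (∀ j ∈ laterJumps X l i, t j = t' j) → w t = w t'
  levelRel : ∀ (e : jumpSet X l) (t t' : jumpSet X l → ℝ), (∀ j, e < j → t j = t' j) →
    LevelRel X e (open Classical in if e ∈ laterJumps X l i then t' e - t e else 0) (w t) (w t')

theorem isChainCoord_one {i : ℕ} (hi : n ≤ i) : IsChainCoord X l i fun _ => 1 where
  continuous := continuous_const
  logN_mem _ := by rw [logN_one]; exact zero_mem _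
  congr _ _ _ := rfl
  levelRel e t t' _ := by
    rw [laterJumps_eq_empty hi, if_neg (Finset.notMem_empty _)]
    exact LevelRel.refl _ _

theorem IsChainCoord.of_le {i : ℕ} {w : (jumpSet X l → ℝ) → lieGroup 𝔫}
    (hw : IsChainCoord X l (i + 1) w) (h : orthChain X l i ≤ orthChain X l (i + 1)) :
    IsChainCoord X l i w where
  continuous := hw.continuous
  logN_mem t := orthChain_succ_le i (hw.logN_mem t)
  congr := by rw [laterJumps_eq_succ h]; exact hw.congr
  levelRel := by rw [laterJumps_eq_succ h]; exact hw.levelRel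

theorem IsAdapted.levelRel {i : ℕ} {j : jumpSet X l} {W : 𝔫}
    (hW : IsAdapted X l i j W) (e : jumpSet X l) {t t' : jumpSet X l → ℝ}
    (h : ∀ j, e < j → t j = t' j) :
    LevelRel X e (open Classical in if e = j then t' e - t e else 0) (expN (t j • W))
      (expN (t' j • W)) := by
  split_ifs with hej
  · subst hej
    have hrepr : X.repr W e = 1 := by
      have hsub : X.repr (W - X e) e = 0 := mem_flag_iff.1 hW.sub_basis_mem _ le_rfl
      simpa [sub_eq_zero] using hsub
    simpa only [hrepr, mul_one] using levelRel_expN_smul hW.mem_flag (t e) (t' e)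
  · rcases lt_or_gt_of_ne hej with hlt | hgt
    · rw [h j hlt]
      exact LevelRel.refl _ _
    · have hWe : W ∈ flag X (e : Fin n) := flag_mono (Nat.succ_le_of_lt hgt) hW.mem_flag
      simpa only [mem_flag_iff.1 hWe _ le_rfl, mul_zero] using
        levelRel_expN_smul (k := (e : Fin n)) (flag_mono (Nat.le_succ _) hWe) (t j) (t' j)

theorem IsChainCoord.cons (hX : IsStrongMalcev X) {i : ℕ} (hi : i < n)
    {w : (jumpSet X l → ℝ) → lieGroup 𝔫} (hw : IsChainCoord X l (i + 1) w) {j : jumpSet X l}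
    {W : 𝔫} (hW : IsAdapted X l i j W) : IsChainCoord X l i fun t => expN (t j • W) * w t where
  continuous := ((continuous_expN_smul W).comp (continuous_apply j)).mul hw.continuous
  logN_mem t := by
    refine (logN_mul_mem le_rfl (fun a ha b hb => lie_mem_orthChain hX ha hb) ?_
      (orthChain_succ_le i (hw.logN_mem t))).1
    rw [logN_expN]
    exact Submodule.smul_mem _ _ hW.mem
  congr t t' h := by
    classical
    rw [laterJumps_eq_insert hi hW] at h
    rw [h j (Finset.mem_insert_self _ _),
      hw.congr t t' fun k hk => h k (Finset.mem_insert_of_mem hk)]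
  levelRel e t t' h := by
    classical
    convert (hW.levelRel e h).mul hX (hw.levelRel e t t' h) using 1
    rw [laterJumps_eq_insert hi hW]
    have hj := notMem_laterJumps_succ hW
    by_cases hej : e = j
    · subst hej
      simp [hj]
    · simp [hej]

theorem IsChainCoord.update_eq [DecidableEq (jumpSet X l)] {i : ℕ}
    {w : (jumpSet X l → ℝ) → lieGroup 𝔫} (hw : IsChainCoord X l i w) {j : jumpSet X l}
    (hj : j ∉ laterJumps X l i) (t : jumpSet X l → ℝ) (r : ℝ) : w (Function.update t j r) = w t :=
  hw.congr _ _ fun _ hk => Function.update_of_ne (ne_of_mem_of_not_mem hk hj) _ _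

theorem adExp_neg_mem_polarization (hX : IsStrongMalcev X) {i : ℕ} (hi : i < n) {Z Y : 𝔫}
    (hZ : Z ∈ orthChain X l i) (hY : Y ∈ orthChain X l i ⊓ flag X (i + 1)) :
    adExp (-Z) Y ∈ polarization X l := by
  have hmem : adExp (-Z) Y ∈ orthChain X l i ⊓ flag X (i + 1) :=
    adExp_mem (fun V hV => ⟨lie_mem_orthChain hX (neg_mem hZ) hV.1, hX _ _ _ hV.2⟩) hY
  exact orthChain_inf_flag_le_polarization (i := i + 1) hi
    ⟨orthChain_inf_flag_succ_le hi hmem, hmem.2⟩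

theorem form_adExp_neg (hX : IsStrongMalcev X) {i : ℕ} {Z Y : 𝔫}
    (hZ : Z ∈ orthChain X l i) (hY : Y ∈ orthChain X l i ⊓ flag X (i + 1)) :
    l (adExp (-Z) Y) = l Y - l ⁅Z, Y⁆ := by
  have hlie (V : 𝔫) (hV : V ∈ orthChain X l i ⊓ flag X i) :
      ⁅-Z, V⁆ ∈ orthChain X l i ⊓ flag X i ⊓ LinearMap.ker l :=
    ⟨⟨lie_mem_orthChain hX (neg_mem hZ) hV.1, hX _ _ _ hV.2⟩, orthChain_orth (neg_mem hZ) hV⟩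
  have hmem := adExp_sub_sub_mem inf_le_left hlie
    ⟨lie_mem_orthChain hX (neg_mem hZ) hY.1, lie_mem_flag hX _ hY.2⟩
  have hzero : l (adExp (-Z) Y - Y - ⁅-Z, Y⁆) = 0 := hmem.2
  rw [map_sub, map_sub, neg_lie, map_neg] at hzero
  linarith

-- Right translation by `exp sY` acts on the equivariant functions through a character in `log h`.
theorem lift_mul_expN_mul (hX : IsStrongMalcev X) (F : (jumpSet X l → ℝ) → ℂ) {i : ℕ} (hi : i < n)
    {Y : 𝔫} (hY : Y ∈ orthChain X l i ⊓ flag X (i + 1)) (s : ℝ) (z : lieGroup 𝔫) {h : lieGroup 𝔫}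
    (hh : logN h ∈ orthChain X l i) :
    lift hX l F (z * expN (s • Y) * h) =
      unitChar (s * (l Y - l ⁅logN h, Y⁆)) * lift hX l F (z * h) := by
  rw [show z * expN (s • Y) * h = z * h * (h⁻¹ * expN (s • Y) * h⁻¹⁻¹) by group, conj_expN,
    logN_inv, map_smul, lift_mul hX F _ (expN_mem_polGroup hX
      (Submodule.smul_mem _ s (adExp_neg_mem_polarization hX hi hh hY))),
    logN_expN, map_smul, form_adExp_neg hX hh hY, smul_eq_mul]

theorem form_logN_expN_mul (hX : IsStrongMalcev X) {i : ℕ} {W Y : 𝔫}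
    (hW : W ∈ orthChain X l i) (hY : Y ∈ orthChain X l i ⊓ flag X (i + 1)) (r : ℝ)
    {h : lieGroup 𝔫} (hh : logN h ∈ orthChain X l (i + 1)) :
    l ⁅logN (expN (r • W) * h), Y⁆ = r * l ⁅W, Y⁆ := by
  have hmem := (logN_mul_mem (orthChain_succ_le (X := X) (l := l) i)
    (fun a ha b hb => lie_mem_orthChain_succ hX ha hb) (x := expN (r • W)) (y := h)
    (by rw [logN_expN]; exact Submodule.smul_mem _ _ hW) (orthChain_succ_le i hh)).2
  have hzero := hmem.2 Y hY
  rwa [logN_expN, sub_lie, add_lie, smul_lie, map_sub, map_add, map_smul, hh.2 Y hY, add_zero,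
    smul_eq_mul, sub_eq_zero] at hzero

/-- The integrand, in the coordinates `w` on `N / P(λ)`, of the matrix coefficient of the
translates by `q.1⁻¹` and `q.2⁻¹` of two equivariant functions. -/
def coeffIntegrand (hX : IsStrongMalcev X) (F G : (jumpSet X l → ℝ) → ℂ)
    (w : (jumpSet X l → ℝ) → lieGroup 𝔫) (q : lieGroup 𝔫 × lieGroup 𝔫) (t : jumpSet X l → ℝ) : ℂ :=
  lift hX l F (q.1 * w t) * (starRingEnd ℂ) (lift hX l G (q.2 * w t))

/-- The matrix coefficient of two equivariant functions over the coordinates in `J` exists and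
vanishes. -/
def IsNullCoeff (hX : IsStrongMalcev X) (F G : (jumpSet X l → ℝ) → ℂ) (J : Finset (jumpSet X l))
    (w : (jumpSet X l → ℝ) → lieGroup 𝔫) (q : lieGroup 𝔫 × lieGroup 𝔫) : Prop :=
  Integrable (coeffIntegrand hX F G w q) (partialVolume J) ∧
    ∫ t, coeffIntegrand hX F G w q t ∂partialVolume J = 0

theorem stronglyMeasurable_lift (hX : IsStrongMalcev X) {F : (jumpSet X l → ℝ) → ℂ}
    (hF : StronglyMeasurable F) : StronglyMeasurable (lift hX l F) :=
  ((continuous_unitChar.comp (continuous_phase hX)).stronglyMeasurable).mul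
    (hF.comp_measurable (continuous_secCoord hX).measurable)

theorem stronglyMeasurable_coeffIntegrand (hX : IsStrongMalcev X)
    {F G : (jumpSet X l → ℝ) → ℂ} (hF : StronglyMeasurable F) (hG : StronglyMeasurable G)
    {w : (jumpSet X l → ℝ) → lieGroup 𝔫} (hw : Continuous w) :
    StronglyMeasurable (Function.uncurry (coeffIntegrand hX F G w)) := by
  refine ((stronglyMeasurable_lift hX hF).comp_measurable ?_).mul
    (Complex.continuous_conj.comp_stronglyMeasurable
      ((stronglyMeasurable_lift hX hG).comp_measurable ?_))
  · exact ((continuous_fst.comp continuous_fst).mul (hw.comp continuous_snd)).measurable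
  · exact ((continuous_snd.comp continuous_fst).mul (hw.comp continuous_snd)).measurable

theorem measurableSet_isNullCoeff (hX : IsStrongMalcev X) {F G : (jumpSet X l → ℝ) → ℂ}
    (hF : StronglyMeasurable F) (hG : StronglyMeasurable G) (J : Finset (jumpSet X l))
    {w : (jumpSet X l → ℝ) → lieGroup 𝔫} (hw : Continuous w) :
    MeasurableSet {q | IsNullCoeff hX F G J w q} :=
  have hmeas := stronglyMeasurable_coeffIntegrand hX hF hG hw
  (measurableSet_integrable hmeas).inter
    (hmeas.integral_prod_right.measurable (measurableSet_singleton 0))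

theorem isNullCoeff_insert_iff [DecidableEq (jumpSet X l)] (hX : IsStrongMalcev X)
    {F G : (jumpSet X l → ℝ) → ℂ} (hF : StronglyMeasurable F) (hG : StronglyMeasurable G)
    {J : Finset (jumpSet X l)} {j : jumpSet X l} (hj : j ∉ J)
    {w : (jumpSet X l → ℝ) → lieGroup 𝔫} (hw : Continuous w) (q : lieGroup 𝔫 × lieGroup 𝔫) :
    IsNullCoeff hX F G (insert j J) w q ↔
      Integrable (fun p : ℝ × (jumpSet X l → ℝ) =>
          coeffIntegrand hX F G w q (Function.update p.2 j p.1))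
        (volume.prod (partialVolume J)) ∧
      ∫ p : ℝ × (jumpSet X l → ℝ), coeffIntegrand hX F G w q (Function.update p.2 j p.1)
        ∂volume.prod (partialVolume J) = 0 := by
  have hupd := measurePreserving_update hj
  have hmeas : StronglyMeasurable (coeffIntegrand hX F G w q) :=
    (stronglyMeasurable_coeffIntegrand hX hF hG hw).of_uncurry_left
  refine and_congr (hupd.integrable_comp hmeas.aestronglyMeasurable).symm ?_
  rw [← integral_map hupd.measurable.aemeasurable hmeas.aestronglyMeasurable, hupd.map_eq]

theorem coeffIntegrand_expN_mul_update [DecidableEq (jumpSet X l)] (hX : IsStrongMalcev X)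
    (F G : (jumpSet X l → ℝ) → ℂ) {i : ℕ} {w : (jumpSet X l → ℝ) → lieGroup 𝔫}
    (hw : IsChainCoord X l (i + 1) w) {j : jumpSet X l} {W : 𝔫} (hW : IsAdapted X l i j W)
    (q : lieGroup 𝔫 × lieGroup 𝔫) (r : ℝ) (t : jumpSet X l → ℝ) :
    coeffIntegrand hX F G (fun t => expN (t j • W) * w t) q (Function.update t j r) =
      coeffIntegrand hX F G w (q * (expN (r • W), expN (r • W))) t := by
  simp only [coeffIntegrand, Function.update_self, hw.update_eq (notMem_laterJumps_succ hW),
    Prod.fst_mul, Prod.snd_mul, mul_assoc]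

theorem coeffIntegrand_mul_expN (hX : IsStrongMalcev X) (F G : (jumpSet X l → ℝ) → ℂ) {i : ℕ}
    (hi : i < n) {w : (jumpSet X l → ℝ) → lieGroup 𝔫} (hw : IsChainCoord X l (i + 1) w) {W Y : 𝔫}
    (hW : W ∈ orthChain X l i) (hY : Y ∈ orthChain X l i ⊓ flag X (i + 1))
    (q : lieGroup 𝔫 × lieGroup 𝔫) (s r : ℝ) (t : jumpSet X l → ℝ) :
    coeffIntegrand hX F G w (q * (expN (s • Y), 1) * (expN (r • W), expN (r • W))) t =
      unitChar (s * (l Y - r * l ⁅W, Y⁆)) *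
        coeffIntegrand hX F G w (q * (expN (r • W), expN (r • W))) t := by
  have hmem : logN (expN (r • W) * w t) ∈ orthChain X l i :=
    (logN_mul_mem le_rfl (fun a ha b hb => lie_mem_orthChain hX ha hb)
      (by rw [logN_expN]; exact Submodule.smul_mem _ _ hW)
      (orthChain_succ_le i (hw.logN_mem t))).1
  have hlift := lift_mul_expN_mul hX F hi hY s q.1 hmem
  rw [form_logN_expN_mul hX hW hY r (hw.logN_mem t)] at hlift
  simp only [coeffIntegrand, Prod.fst_mul, Prod.snd_mul, one_mul, mul_assoc] at hlift ⊢
  rw [hlift, mul_assoc]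

-- The translates of `q.1` by `exp sY` are the Fourier coefficients of the coefficient over `w`,
-- as a function of the coordinate `r` of `exp rW`.
theorem ae_isNullCoeff_mul_expN (hX : IsStrongMalcev X) {F G : (jumpSet X l → ℝ) → ℂ}
    (hF : StronglyMeasurable F) (hG : StronglyMeasurable G) {i : ℕ} (hi : i < n)
    {w : (jumpSet X l → ℝ) → lieGroup 𝔫} (hw : IsChainCoord X l (i + 1) w) {j : jumpSet X l}
    {W Y : 𝔫} (hW : IsAdapted X l i j W) (hY : Y ∈ orthChain X l i ⊓ flag X (i + 1))
    (hWY : l ⁅W, Y⁆ = -1) {q : lieGroup 𝔫 × lieGroup 𝔫}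
    (h : ∀ s : ℚ, IsNullCoeff hX F G (laterJumps X l i) (fun t => expN (t j • W) * w t)
      (q * (expN ((s : ℝ) • Y), 1))) :
    ∀ᵐ r : ℝ, IsNullCoeff hX F G (laterJumps X l (i + 1)) w
      (q * (expN (r • W), expN (r • W))) := by
  classical
  simp only [laterJumps_eq_insert hi hW, isNullCoeff_insert_iff hX hF hG
    (notMem_laterJumps_succ hW) (hw.cons hX hi hW).continuous,
    coeffIntegrand_expN_mul_update hX F G hw hW] at h
  have hint : Integrable (fun p : ℝ × (jumpSet X l → ℝ) =>
      coeffIntegrand hX F G w (q * (expN (p.1 • W), expN (p.1 • W))) p.2)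
      (volume.prod (partialVolume (laterJumps X l (i + 1)))) := by
    have hone : q * (expN (((0 : ℚ) : ℝ) • Y), 1) = q := by
      rw [Rat.cast_zero, zero_smul, expN_zero, Prod.mk_one_one, mul_one]
    simpa only [hone] using (h 0).1
  have hzero := ae_integral_eq_zero_of_integral_unitChar_mul hint fun s => by
    have hs := (h s).2
    simp only [coeffIntegrand_mul_expN hX F G hi hw hW.mem hY, hWY, mul_neg_one, sub_neg_eq_add,
      mul_add, unitChar_add] at hs
    simp only [mul_assoc, integral_const_mul] at hs
    refine (mul_eq_zero.1 hs).resolve_left (norm_ne_zero_iff.1 ?_)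
    rw [norm_unitChar]
    exact one_ne_zero
  filter_upwards [hint.prod_right_ae, hzero] with r hr_int hr_zero
  exact ⟨hr_int, hr_zero⟩

theorem ae_isNullCoeff_of_cons (hX : IsStrongMalcev X) {F G : (jumpSet X l → ℝ) → ℂ}
    (hF : StronglyMeasurable F) (hG : StronglyMeasurable G) {i : ℕ} (hi : i < n)
    {w : (jumpSet X l → ℝ) → lieGroup 𝔫} (hw : IsChainCoord X l (i + 1) w) {j : jumpSet X l}
    {W : 𝔫} (hW : IsAdapted X l i j W)
    (h : ∀ᵐ q ∂(rightHaar 𝔫).prod (rightHaar 𝔫),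
      IsNullCoeff hX F G (laterJumps X l i) (fun t => expN (t j • W) * w t) q) :
    ∀ᵐ q ∂(rightHaar 𝔫).prod (rightHaar 𝔫),
      IsNullCoeff hX F G (laterJumps X l (i + 1)) w q := by
  have hmul (p : lieGroup 𝔫 × lieGroup 𝔫) := (measurePreserving_mul_right
    ((rightHaar 𝔫).prod (rightHaar 𝔫)) p).quasiMeasurePreserving
  obtain ⟨Y, hY, hWY⟩ : ∃ Y ∈ orthChain X l i ⊓ flag X (i + 1), l ⁅W, Y⁆ = -1 := by
    obtain ⟨Y, hY, hWY⟩ := exists_form_ne_zero hW.mem hW.notMem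
    refine ⟨-(l ⁅W, Y⁆)⁻¹ • Y, Submodule.smul_mem _ _ hY, ?_⟩
    rw [lie_smul, map_smul, smul_eq_mul, neg_mul, inv_mul_cancel₀ hWY]
  have hae : ∀ᵐ q ∂(rightHaar 𝔫).prod (rightHaar 𝔫), ∀ᵐ r : ℝ,
      IsNullCoeff hX F G (laterJumps X l (i + 1)) w (q * (expN (r • W), expN (r • W))) := by
    filter_upwards [ae_all_iff.2 fun s : ℚ => (hmul (expN ((s : ℝ) • Y), 1)).ae h] with q hq
    exact ae_isNullCoeff_mul_expN hX hF hG hi hw hW hY hWY hq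
  have hmeas : MeasurableSet {p : (lieGroup 𝔫 × lieGroup 𝔫) × ℝ |
      IsNullCoeff hX F G (laterJumps X l (i + 1)) w
        (p.1 * (expN (p.2 • W), expN (p.2 • W)))} := by
    have hexp := (continuous_expN_smul W).comp (continuous_snd (X := lieGroup 𝔫 × lieGroup 𝔫))
    exact (measurableSet_isNullCoeff hX hF hG _ hw.continuous).preimage
      (continuous_fst.mul (hexp.prodMk hexp)).measurable
  rw [Measure.ae_ae_comm hmeas] at hae
  obtain ⟨r, hr⟩ := hae.exists
  simpa only [inv_mul_cancel_right] using (hmul (expN (r • W), expN (r • W))⁻¹).ae hr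

theorem exists_isChainCoord (hX : IsStrongMalcev X) (l : Module.Dual ℝ 𝔫) (i : ℕ) :
    ∃ w, IsChainCoord X l i w ∧ ∀ F G : (jumpSet X l → ℝ) → ℂ, StronglyMeasurable F →
      StronglyMeasurable G → (∀ᵐ q ∂(rightHaar 𝔫).prod (rightHaar 𝔫),
        IsNullCoeff hX F G (laterJumps X l i) w q) →
      ∀ᵐ q ∂(rightHaar 𝔫).prod (rightHaar 𝔫), lift hX l F q.1 = 0 ∨ lift hX l G q.2 = 0 := by
  induction i using descending_induction (n := n) with
  | hn i hi =>
    refine ⟨fun _ => 1, isChainCoord_one hi, fun F G _ _ h => ?_⟩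
    rw [laterJumps_eq_empty hi] at h
    filter_upwards [h] with q hq
    simpa [coeffIntegrand] using hq.2
  | hs i ih =>
    obtain ⟨w, hw, hFG⟩ := ih
    by_cases hle : orthChain X l i ≤ orthChain X l (i + 1)
    · refine ⟨w, hw.of_le hle, ?_⟩
      rw [laterJumps_eq_succ hle]
      exact hFG
    · obtain ⟨j, W, hW⟩ := exists_isAdapted_of_not_le hle
      let j' : jumpSet X l := ⟨j, hW.mem_jumpSet⟩
      exact ⟨_, hw.cons hX i.2 (j := j') hW, fun F G hF hG h =>
        hFG F G hF hG (ae_isNullCoeff_of_cons hX hF hG i.2 hw (j := j') hW h)⟩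

theorem IsChainCoord.measurePreserving (hX : IsStrongMalcev X)
    {w : (jumpSet X l → ℝ) → lieGroup 𝔫} (hw : IsChainCoord X l 0 w) :
    MeasurePreserving (fun t => secCoord hX l (w t)) volume volume := by
  refine measurePreserving_pi_of_triangular
    ((continuous_secCoord hX).comp hw.continuous).measurable fun e t t' h => ?_
  have hrel := hw.levelRel e t t' h
  rw [laterJumps_zero, if_pos (Finset.mem_univ _)] at hrel
  rw [hrel.secCoord hX]
  ring

theorem lift_mul_conj_lift (hX : IsStrongMalcev X) (F G : (jumpSet X l → ℝ) → ℂ)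
    (z x h : lieGroup 𝔫) :
    lift hX l F (z * h) * (starRingEnd ℂ) (lift hX l G (x * h)) =
      lift hX l F (z * crossSection X l (secCoord hX l h)) *
        (starRingEnd ℂ) (lift hX l G (x * crossSection X l (secCoord hX l h))) := by
  conv_lhs => rw [← crossSection_mul_polPart (l := l) hX h, ← mul_assoc, ← mul_assoc,
    lift_mul hX F _ (polPart_mem hX h), lift_mul hX G _ (polPart_mem hX h), map_mul, star_unitChar]
  linear_combination (lift hX l F (z * crossSection X l (secCoord hX l h)) *
    (starRingEnd ℂ) (lift hX l G (x * crossSection X l (secCoord hX l h)))) *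
    unitChar_neg_mul_self (l (logN (polPart hX l h)))

theorem isNullCoeff_of_integral_eq_zero (hX : IsStrongMalcev X) {F G : (jumpSet X l → ℝ) → ℂ}
    {w : (jumpSet X l → ℝ) → lieGroup 𝔫} (hw : IsChainCoord X l 0 w)
    (hF : MemLp F 2 volume) (hG : MemLp G 2 volume) (z x : lieGroup 𝔫)
    (h : ∫ t, translate hX l z⁻¹ F t * (starRingEnd ℂ) (translate hX l x⁻¹ G t) = 0) :
    IsNullCoeff hX F G (laterJumps X l 0) w (z, x) := by
  have hint : Integrable fun t => translate hX l z⁻¹ F t *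
      (starRingEnd ℂ) (translate hX l x⁻¹ G t) :=
    (memLp_translate hX z⁻¹ hF).integrable_mul (memLp_translate hX x⁻¹ hG).star
  have hmp := hw.measurePreserving hX
  have hcoeff : coeffIntegrand hX F G w (z, x) = (fun t => translate hX l z⁻¹ F t *
      (starRingEnd ℂ) (translate hX l x⁻¹ G t)) ∘ fun t => secCoord hX l (w t) := by
    ext t
    rw [coeffIntegrand, lift_mul_conj_lift, Function.comp_apply, translate, translate, inv_inv,
      inv_inv]
  rw [IsNullCoeff, laterJumps_zero, partialVolume_univ, hcoeff]
  refine ⟨hmp.integrable_comp_of_integrable hint, ?_⟩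
  rw [← hmp.map_eq] at h hint
  rwa [integral_map hmp.measurable.aemeasurable hint.aestronglyMeasurable] at h

theorem ae_eq_zero_of_lift_ae_eq_zero (hX : IsStrongMalcev X) {F : (jumpSet X l → ℝ) → ℂ}
    (hF : StronglyMeasurable F) (h : ∀ᵐ z ∂rightHaar 𝔫, lift hX l F z = 0) :
    ∀ᵐ t, F t = 0 := by
  have hzero : MeasurableSet ({0} : Set ℂ) := measurableSet_singleton 0
  have hae : ∀ᵐ t : jumpSet X l → ℝ, ∀ᵐ z ∂rightHaar 𝔫,
      lift hX l F (z * crossSection X l t) = 0 := Filter.Eventually.of_forall fun t =>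
    (measurePreserving_mul_right (rightHaar 𝔫) (crossSection X l t)).quasiMeasurePreserving.ae h
  have hmeas : MeasurableSet {p : (jumpSet X l → ℝ) × lieGroup 𝔫 |
      lift hX l F (p.2 * crossSection X l p.1) = 0} :=
    ((stronglyMeasurable_lift hX hF).measurable hzero).preimage
      (continuous_snd.mul (continuous_crossSection.comp continuous_fst)).measurable
  rw [Measure.ae_ae_comm hmeas] at hae
  obtain ⟨z, hz⟩ := hae.exists
  have hmp := measurePreserving_secCoord (l := l) hX z
  rw [← hmp.map_eq]
  refine (ae_map_iff hmp.measurable.aemeasurable (hF.measurable hzero)).2 ?_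
  filter_upwards [hz] with t ht
  rwa [← norm_eq_zero, norm_lift, norm_eq_zero] at ht

open scoped InnerProductSpace

theorem integral_translate_mul_conj_eq_zero (hX : IsStrongMalcev X) {f g : L2 X l}
    (h : ∀ y : lieGroup 𝔫, ⟪g, transOp hX l y f⟫_ℂ = 0) (z x : lieGroup 𝔫) :
    ∫ t, translate hX l z⁻¹ f t * (starRingEnd ℂ) (translate hX l x⁻¹ g t) = 0 := by
  have hinner : ⟪transOp hX l x⁻¹ g, transOp hX l z⁻¹ f⟫_ℂ = 0 := by
    rw [← inv_mul_cancel_left x z⁻¹, transOp_mul, (transOp hX l x⁻¹).inner_map_map, h]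
  rw [L2.inner_def] at hinner
  rw [← hinner]
  refine integral_congr_ae ?_
  filter_upwards [(memLp_translate hX x⁻¹ (Lp.memLp g)).coeFn_toLp,
    (memLp_translate hX z⁻¹ (Lp.memLp f)).coeFn_toLp] with t hg hf
  change _ = ⟪(memLp_translate hX x⁻¹ (Lp.memLp g)).toLp _ t,
    (memLp_translate hX z⁻¹ (Lp.memLp f)).toLp _ t⟫_ℂ
  rw [hg, hf, RCLike.inner_apply]

theorem eq_zero_or_eq_zero_of_inner (hX : IsStrongMalcev X) (f g : L2 X l)
    (h : ∀ y : lieGroup 𝔫, ⟪g, transOp hX l y f⟫_ℂ = 0) : f = 0 ∨ g = 0 := by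
  obtain ⟨w, hw, hFG⟩ := exists_isChainCoord hX l 0
  have hf := Lp.stronglyMeasurable f
  have hg := Lp.stronglyMeasurable g
  have hae := Measure.ae_ae_of_ae_prod <| hFG f g hf hg <| .of_forall fun q =>
    isNullCoeff_of_integral_eq_zero hX hw (Lp.memLp f) (Lp.memLp g) q.1 q.2
      (integral_translate_mul_conj_eq_zero hX h q.1 q.2)
  by_cases hg0 : ∀ᵐ x ∂rightHaar 𝔫, lift hX l g x = 0
  · exact Or.inr (Lp.eq_zero_iff_ae_eq_zero.2 (ae_eq_zero_of_lift_ae_eq_zero hX hg hg0))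
  · refine Or.inl (Lp.eq_zero_iff_ae_eq_zero.2 (ae_eq_zero_of_lift_ae_eq_zero hX hf ?_))
    filter_upwards [hae] with z hz
    by_contra hne
    exact hg0 (hz.mono fun x hx => hx.resolve_left hne)

instance : Nontrivial (L2 X l) := by
  have hv : volume (Set.Icc (0 : jumpSet X l → ℝ) 1) = 1 := by simp [Real.volume_Icc_pi]
  refine ⟨indicatorConstLp 2 (measurableSet_Icc (a := (0 : jumpSet X l → ℝ)) (b := 1))
    (by rw [hv]; exact ENNReal.one_ne_top) (1 : ℂ), 0, fun h => ?_⟩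
  have hnorm := congrArg norm h
  rw [norm_indicatorConstLp (by norm_num) (by norm_num), Measure.real, hv] at hnorm
  norm_num at hnorm

theorem isIrreducibleRep_inducedRep (hX : IsStrongMalcev X) (l : Module.Dual ℝ 𝔫) :
    IsIrreducibleRep (inducedRep hX l) := by
  refine ⟨inferInstance, fun V hV hinv => ?_⟩
  by_contra! hne
  have : CompleteSpace V := hV.completeSpace_coe
  obtain ⟨f, hf, hf0⟩ := V.exists_mem_ne_zero_of_ne_bot hne.1
  obtain ⟨g, hg, hg0⟩ := Vᗮ.exists_mem_ne_zero_of_ne_bot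
    fun h => hne.2 (Submodule.orthogonal_eq_bot_iff.1 h)
  rcases eq_zero_or_eq_zero_of_inner hX f g fun y =>
    V.inner_left_of_mem_orthogonal (hinv y f hf) hg with h | h
  · exact hf0 h
  · exact hg0 h

end Orthogonality

section Dilation

theorem IsIrreducibleRep.comp_subtype_of_dense {G H : Type*} [Group G] [TopologicalSpace G]
    [NormedAddCommGroup H] [InnerProductSpace ℂ H] {π : G →* (H ≃ₗᵢ[ℂ] H)}
    (hirr : IsIrreducibleRep π) (hcont : IsStronglyContinuous π) {Δ : Subgroup G}
    (hΔ : Dense (Δ : Set G)) : IsIrreducibleRep (π.comp Δ.subtype) := by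
  refine ⟨hirr.1, fun V hV hinv => hirr.2 V hV fun x f hf => ?_⟩
  have hclosed : IsClosed {x | π x f ∈ V} := hV.preimage (hcont f)
  exact closure_minimal (fun y hy => hinv ⟨y, hy⟩ f hf) hclosed (hΔ x)

theorem denseRange_intCast_mul_zpow_of_one_lt {a : ℝ} (ha : 1 < |a|) :
    DenseRange fun p : ℤ × ℤ => (p.1 : ℝ) * a ^ p.2 := by
  have ha0 : a ≠ 0 := abs_pos.1 (one_pos.trans ha)
  refine Metric.denseRange_iff.2 fun t ε hε => ?_
  obtain ⟨i, hi⟩ := exists_pow_lt_of_lt_one hε (inv_lt_one_of_one_lt₀ ha)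
  refine ⟨(⌊t * a ^ i⌋, -i), ?_⟩
  have hfract : t - ⌊t * a ^ i⌋ * a ^ (-i : ℤ) = Int.fract (t * a ^ i) * a⁻¹ ^ i := by
    rw [Int.fract, sub_mul, mul_assoc t, ← mul_pow, mul_inv_cancel₀ ha0, one_pow, mul_one,
      zpow_neg, zpow_natCast, inv_pow]
  rw [Real.dist_eq, hfract, abs_mul, abs_pow, abs_inv, abs_of_nonneg (Int.fract_nonneg _)]
  exact (mul_le_of_le_one_left (by positivity) (Int.fract_lt_one _).le).trans_lt hi

theorem denseRange_intCast_mul_zpow {a : ℝ} (ha0 : a ≠ 0) (ha : |a| ≠ 1) :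
    DenseRange fun p : ℤ × ℤ => (p.1 : ℝ) * a ^ p.2 := by
  rcases ha.lt_or_gt with hlt | hgt
  · have hinv : 1 < |a⁻¹| := by
      rw [abs_inv]
      exact (one_lt_inv₀ (abs_pos.2 ha0)).2 hlt
    refine (denseRange_intCast_mul_zpow_of_one_lt hinv).mono ?_
    rintro _ ⟨p, rfl⟩
    exact ⟨(p.1, -p.2), by simp only [zpow_neg, inv_zpow]⟩
  · exact denseRange_intCast_mul_zpow_of_one_lt hgt

variable {m n : ℕ} {𝔫 : LieSubalgebra ℝ (Matrix (Fin m) (Fin m) ℝ)}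
  {X : Module.Basis (Fin n) ℝ 𝔫} {l : Module.Dual ℝ 𝔫}

theorem one_lt_abs_of_isExpansive {A : 𝔫 →ₗ[ℝ] 𝔫} {a : Fin n → ℝ}
    (hA : ∀ k, A (X k) = a k • X k) (h : IsExpansive (LinearMap.toMatrix X X A)) (k : Fin n) :
    1 < |a k| := by
  have hdiag : (LinearMap.toMatrix X X A).map (algebraMap ℝ ℂ) =
      Matrix.diagonal fun k => (a k : ℂ) := by
    ext i j
    rw [Matrix.map_apply, LinearMap.toMatrix_apply, hA, map_smul, Module.Basis.repr_self,
      Finsupp.smul_apply, Matrix.diagonal_apply, Finsupp.single_apply]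
    rcases eq_or_ne i j with rfl | hij
    · simp
    · simp [hij, hij.symm]
  have hnorm : 1 < ‖(a k : ℂ)‖ := h (a k) (by rw [hdiag, spectrum_diagonal]; exact ⟨k, rfl⟩)
  rwa [Complex.norm_real] at hnorm

theorem malcevCoord_single (k : Fin n) (t : ℝ) :
    malcevCoord X (Pi.single k t) = expN (t • X k) := by
  rw [malcevCoord, List.prod_map_eq_pow_single k,
    List.count_eq_one_of_mem (List.nodup_finRange n) (List.mem_finRange k), pow_one,
    Pi.single_eq_same]
  intro i hi _
  rw [Pi.single_eq_of_ne hi, zero_smul, expN_zero]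

theorem expN_basis_mem {Γ : Subgroup (lieGroup 𝔫)}
    (hΓ : (Γ : Set (lieGroup 𝔫)) = Set.range fun k : Fin n → ℤ => malcevCoord X fun i => (k i : ℝ))
    (k : Fin n) : expN (X k) ∈ Γ := by
  rw [← SetLike.mem_coe, hΓ]
  refine ⟨Pi.single k 1, ?_⟩
  rw [← one_smul ℝ (X k), ← malcevCoord_single]
  refine congrArg (malcevCoord X) (funext fun i => ?_)
  simp only [Pi.single_apply, Int.cast_ite, Int.cast_one, Int.cast_zero]

theorem expN_intCast_smul (Y : 𝔫) (N : ℤ) : expN ((N : ℝ) • Y) = expN Y ^ N := by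
  induction N with
  | zero => rw [Int.cast_zero, zero_smul, expN_zero, zpow_zero]
  | succ N ih => rw [Int.cast_add, Int.cast_one, expN_add_smul, ih, one_smul, zpow_add_one]
  | pred N ih =>
    rw [Int.cast_sub, Int.cast_one, sub_eq_add_neg, expN_add_smul, ih, neg_smul, one_smul, expN_neg,
      zpow_sub_one]

theorem zpow_apply_expN_smul {α : MulAut (lieGroup 𝔫)} {A : 𝔫 ≃ₗ⁅ℝ⁆ 𝔫}
    (hα : ∀ Y : 𝔫, α (expN Y) = expN (A Y)) {Y : 𝔫} {a : ℝ} (ha : a ≠ 0) (hY : A Y = a • Y)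
    (z : ℤ) (c : ℝ) : (α ^ z) (expN (c • Y)) = expN ((c * a ^ z) • Y) := by
  have hsmul (c : ℝ) : α (expN (c • Y)) = expN ((c * a) • Y) := by
    rw [hα, map_smul, hY, smul_smul]
  induction z generalizing c with
  | zero => rw [zpow_zero, zpow_zero, mul_one, MulAut.one_apply]
  | succ z ih => rw [zpow_add_one, MulAut.mul_apply, hsmul, ih, zpow_add_one₀ ha, mul_assoc,
      mul_comm a]
  | pred z ih =>
    have hinv : α⁻¹ (expN (c • Y)) = expN ((c * a⁻¹) • Y) := by
      rw [MulAut.inv_apply, MulEquiv.symm_apply_eq, hsmul, inv_mul_cancel_right₀ ha]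
    rw [zpow_sub_one, MulAut.mul_apply, hinv, ih, zpow_sub_one₀ ha, mul_right_comm, mul_assoc]

theorem expN_mem_dilationClosure {Γ : Subgroup (lieGroup 𝔫)} {α : MulAut (lieGroup 𝔫)}
    {A : 𝔫 ≃ₗ⁅ℝ⁆ 𝔫} (hα : ∀ Y : 𝔫, α (expN Y) = expN (A Y)) {Y : 𝔫} (hΓ : expN Y ∈ Γ) {a : ℝ}
    (ha : a ≠ 0) (hY : A Y = a • Y) (N z : ℤ) :
    expN ((N * a ^ z) • Y) ∈ dilationClosure α Γ := by
  refine Subgroup.subset_closure (Set.mem_iUnion.2 ⟨z, expN ((N : ℝ) • Y), ?_,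
    zpow_apply_expN_smul hα ha hY z N⟩)
  rw [expN_intCast_smul]
  exact zpow_mem hΓ N

variable [IsNilMatrixAlgebra 𝔫]

theorem mem_of_expN_smul_basis_mem (hX : IsStrongMalcev X) {S : Submonoid (lieGroup 𝔫)}
    (hS : ∀ (k : Fin n) (t : ℝ), expN (t • X k) ∈ S) (x : lieGroup 𝔫) : x ∈ S := by
  have hlevel : ∀ i ≤ n, ∀ x ∈ level X i, x ∈ S := by
    intro i
    induction i with
    | zero =>
      intro _ x hx
      rw [eq_one_of_mem_level_zero hx]
      exact one_mem S
    | succ i ih =>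
      intro hi x hx
      let k : Fin n := ⟨i, hi⟩
      have hmem : x * expN (-lead X k x • X k) ∈ level X i :=
        mul_mem_level_of_lead_eq_neg hX (k := k) hx
          (expN_mem_level (Submodule.smul_mem _ _ (basis_mem_flag k)))
          (by rw [lead_expN_smul_basis])
      have hmul := mul_mem (ih (by omega) _ hmem) (hS k (lead X k x))
      rwa [neg_smul, expN_neg, inv_mul_cancel_right] at hmul
  exact hlevel n le_rfl x (mem_level_of_le le_rfl x)

theorem dense_dilationClosure (hX : IsStrongMalcev X) {Γ : Subgroup (lieGroup 𝔫)}
    (hΓ : ∀ k, expN (X k) ∈ Γ) {A : 𝔫 ≃ₗ⁅ℝ⁆ 𝔫} {a : Fin n → ℝ} (hA : ∀ k, A (X k) = a k • X k)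
    (ha : ∀ k, |a k| ≠ 1) {α : MulAut (lieGroup 𝔫)} (hα : ∀ Y : 𝔫, α (expN Y) = expN (A Y)) :
    Dense (dilationClosure α Γ : Set (lieGroup 𝔫)) := by
  refine mem_of_expN_smul_basis_mem hX (S := (dilationClosure α Γ).topologicalClosure.toSubmonoid)
    fun k t => ?_
  have ha0 : a k ≠ 0 := by
    intro h
    have hAX : A (X k) = 0 := by rw [hA, h, zero_smul]
    exact X.ne_zero k ((map_eq_zero_iff A A.injective).1 hAX)
  have hdense : Dense (Set.range fun p : ℤ × ℤ => (p.1 : ℝ) * a k ^ p.2) :=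
    denseRange_intCast_mul_zpow ha0 (ha k)
  refine closure_mono ?_
    ((continuous_expN_smul (X k)).range_subset_closure_image_dense hdense ⟨t, rfl⟩)
  rintro _ ⟨_, ⟨p, rfl⟩, rfl⟩
  exact expN_mem_dilationClosure hα (hΓ k) ha0 (hA k) p.1 p.2

end Dilation

theorem mainTheorem2_general {m n : ℕ} (𝔫 : LieSubalgebra ℝ (Matrix (Fin m) (Fin m) ℝ))
    (hnil : ∀ X ∈ 𝔫, IsNilpotent X)
    (X : Module.Basis (Fin n) ℝ 𝔫) (hX : IsStrongMalcev X)
    (Γ : Subgroup (lieGroup 𝔫)) (hΓ : ∀ k, expN (X k) ∈ Γ)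
    (A : 𝔫 ≃ₗ⁅ℝ⁆ 𝔫) (a : Fin n → ℝ) (hA : ∀ k, A (X k) = a k • X k) (ha : ∀ k, |a k| ≠ 1)
    (α : MulAut (lieGroup 𝔫)) (hα : ∀ Y : 𝔫, α (expN Y) = expN (A Y))
    (l : Module.Dual ℝ 𝔫) :
    (∃! π : lieGroup 𝔫 →* (L2 X l ≃ₗᵢ[ℂ] L2 X l), IsInducedRep X l π) ∧
    ∀ π : lieGroup 𝔫 →* (L2 X l ≃ₗᵢ[ℂ] L2 X l), IsInducedRep X l π →
      IsStronglyContinuous π ∧ IsIrreducibleRep π ∧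
        IsIrreducibleRep (π.comp (dilationClosure α Γ).subtype) := by
  have : IsNilMatrixAlgebra 𝔫 := ⟨hnil⟩
  refine ⟨⟨inducedRep hX l, isInducedRep_inducedRep hX l, fun π hπ => eq_inducedRep hX hπ⟩,
    fun π hπ => ?_⟩
  rw [eq_inducedRep hX hπ]
  have hcont := isStronglyContinuous_inducedRep hX l
  have hirr := isIrreducibleRep_inducedRep hX l
  exact ⟨hcont, hirr, hirr.comp_subtype_of_dense hcont (dense_dilationClosure hX hΓ hA ha hα)⟩

end WaveletRep

end

open WaveletRep in
theorem mainTheorem2 {m n : ℕ} (𝔫 : LieSubalgebra ℝ (Matrix (Fin m) (Fin m) ℝ))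
    (hnil : ∀ X ∈ 𝔫, IsNilpotent X)
    (X : Module.Basis (Fin n) ℝ 𝔫) (hX : IsStrongMalcev X)
    (Γ : Subgroup (lieGroup 𝔫))
    (hΓ : (Γ : Set (lieGroup 𝔫)) = Set.range fun k : Fin n → ℤ => malcevCoord X fun i => (k i : ℝ))
    (A : 𝔫 ≃ₗ⁅ℝ⁆ 𝔫) (a : Fin n → ℝ) (hA : ∀ k, A (X k) = a k • X k)
    (α : MulAut (lieGroup 𝔫)) (hα : ∀ Y : 𝔫, α (expN Y) = expN (A Y))
    (hexp : IsExpansive (LinearMap.toMatrix X X (A : 𝔫 →ₗ[ℝ] 𝔫)))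
    (l : Module.Dual ℝ 𝔫) :
    (∃! π : lieGroup 𝔫 →* (L2 X l ≃ₗᵢ[ℂ] L2 X l), IsInducedRep X l π) ∧
    ∀ π : lieGroup 𝔫 →* (L2 X l ≃ₗᵢ[ℂ] L2 X l), IsInducedRep X l π →
      IsStronglyContinuous π ∧ IsIrreducibleRep π ∧
        IsIrreducibleRep (π.comp (dilationClosure α Γ).subtype) :=
  mainTheorem2_general 𝔫 hnil X hX Γ (expN_basis_mem hΓ) A a hA
    (fun k => (one_lt_abs_of_isExpansive hA hexp k).ne') α hα l
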